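/- Let $F$ be a non-archimedean local field with ring of integers $\mathfrak o$ and normalized absolute value $|\cdot|$, and let $n\ge 0$. Let $G=\mathrm{GL}_{2n}(F)$ and let $P$ be the subgroup of upper triangular matrices. Let $\psi$ be a (continuous, unitary) additive character of $F$ with conductor $\mathfrak o$. Let $S$ be the Shalika subgroup of matrices $s=\begin{pmatrix} g&\\&g\end{pmatrix}\begin{pmatrix} I&X\\&I\end{pmatrix}$ with $g\in\mathrm{GL}_n(F)$, $X\in\mathrm{Mat}_n(F)$, and let $\Psi(s)=\psi(\operatorname{tr}X)$. Let $w_0$ be the $n\times n$ matrix with ones on the antidiagonal and zeros elsewhere, $\xi=\begin{pmatrix}&I\\w_0&\end{pmatrix}$, $H=\xi S\xi^{-1}$ and $\Psi_H(h)=\Psi(\xi^{-1}h\xi)$. For $z_1,\dots,z_n\in\mathbb C$ let $\chi=(|\cdot|^{z_1},\dots,|\cdot|^{z_n},|\cdot|^{-z_n},\dots,|\cdot|^{-z_1})$, let $\delta=(|\cdot|^{2n-1},|\cdot|^{2n-3},\dots,|\cdot|^{-2n+1})$ be the modular character of $P$, and let $I(\chi)$ be the space of all locally constant $f:G\to\mathbb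 C$ with $f(pg)=\chi(p)\delta(p)^{1/2}f(g)$ for $p\in P$, $g\in G$, on which $G$ acts by right translations $(R_gf)(x)=f(xg)$. For $\phi\in I(\chi)$ the function $h\mapsto\phi(h)\Psi_H^{-1}(h)$ on $H$ is left invariant under $P\cap H$. Fix Haar measures on $H$ and on $P\cap H$. Then the quotient measure $dh$ on $P\cap H\backslash H$ exists. If $\operatorname{Re}z_1>\operatorname{Re}z_2>\dots>\operatorname{Re}z_n>0$, then the period integral $$\Lambda_H(\phi)=\int_{P\cap H\backslash H}\phi(h)\,\Psi_H^{-1}(h)\,dh$$ converges absolutely for every $\phi\in I(\chi)$. It defines a nonzero linear functional on $I(\chi)$ with $\Lambda_H(R_h\phi)=\Psi_H(h)\Lambda_H(\phi)$ for all $h\in H$. Equivalently, $\Lambda(\phi)=\Lambda_H(R_\xi\phi)$ is a nonzero Shalika functional: $\Lambda\neq 0$ and $\Lambda(R_s\phi)=\Psi(s)\Lambda(\phi)$ for all $s\in S$. -/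

import Mathlib

open MeasureTheory Matrix ValuativeRel
open scoped ENNReal NNReal

namespace Shalika

noncomputable section

section LocalField

variable (F : Type*) [Field F] [ValuativeRel F] [TopologicalSpace F]
  [IsNonarchimedeanLocalField F]

/-- The order `q` of the residue field. -/
def resCard : ℝ≥0 := (Nat.card 𝓀[F] : ℝ≥0)

theorem resCard_ne_zero : resCard F ≠ 0 := by
  unfold resCard
  exact_mod_cast Nat.card_pos.ne'

variable {F}

/-- The normalized absolute value of the local field `F`: `|ϖ| = q⁻¹` for a uniformizer `ϖ`. -/
def absF (x : F) : ℝ :=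
  (WithZeroMulInt.toNNReal (resCard_ne_zero F)
    (IsNonarchimedeanLocalField.valueGroupWithZeroIsoInt F (valuation F x)) : ℝ≥0)

theorem absF_pos {x : F} (hx : x ≠ 0) : 0 < absF x := by
  unfold absF
  exact_mod_cast WithZeroMulInt.toNNReal_pos _ (by simpa using hx)

/-- The additive character `ψ` has conductor `𝔬`: the largest fractional ideal on which it is
trivial is `𝔬`. -/
def HasConductorIntegers (ψ : AddChar F Circle) : Prop :=
  ∀ x : F, x ∈ 𝒪[F] ↔ ∀ y ∈ 𝒪[F], ψ (x * y) = 1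

end LocalField

section Groups

variable (n : ℕ) (F : Type*) [Field F]

/-- The group `GL_{2n}(F)`. Rows and columns are indexed by `Fin n ⊕ Fin n`, the left summand
being the first `n` indices and the right summand the last `n`. -/
abbrev G : Type _ := GL (Fin n ⊕ Fin n) F

/-- The Borel subgroup of upper triangular matrices (for the order of the `2n` indices
in which the first summand precedes the second). -/
def P : Subgroup (G n F) where
  carrier := {p | BlockTriangular (p : Matrix (Fin n ⊕ Fin n) (Fin n ⊕ Fin n) F) toLex}
  mul_mem' := by
    intro a b ha hb
    exact BlockTriangular.mul ha hb
  one_mem' := blockTriangular_one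
  inv_mem' := by
    intro a ha
    have : Invertible a.val := a.invertible
    have ha' : BlockTriangular a.val toLex := ha
    have h := blockTriangular_inv_of_blockTriangular ha'
    change BlockTriangular (a⁻¹).val toLex
    rwa [Matrix.coe_units_inv]

variable {n F}

/-- The block diagonal matrix `diag(g, g)`. -/
def levi (g : GL (Fin n) F) : G n F where
  val := fromBlocks g 0 0 g
  inv := fromBlocks (g⁻¹ : GL (Fin n) F) 0 0 (g⁻¹ : GL (Fin n) F)
  val_inv := by
    simp only [fromBlocks_multiply, ← Units.val_mul]
    simp
  inv_val := by
    simp only [fromBlocks_multiply, ← Units.val_mul]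
    simp

/-- The block unipotent matrix with upper right block `X`. -/
def unip (X : Matrix (Fin n) (Fin n) F) : G n F where
  val := fromBlocks 1 X 0 1
  inv := fromBlocks 1 (-X) 0 1
  val_inv := by simp [fromBlocks_multiply]
  inv_val := by simp [fromBlocks_multiply]

theorem levi_one : levi (1 : GL (Fin n) F) = 1 := by
  ext1; simp [levi]

theorem levi_mul (g g' : GL (Fin n) F) : levi g * levi g' = levi (g * g') := by
  ext1; simp [levi, fromBlocks_multiply]

theorem unip_zero : unip (0 : Matrix (Fin n) (Fin n) F) = 1 := by
  ext1; simp [unip]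

theorem unip_mul (X Y : Matrix (Fin n) (Fin n) F) : unip X * unip Y = unip (X + Y) := by
  ext1; simp [unip, fromBlocks_multiply, add_comm]

theorem unip_mul_levi (X : Matrix (Fin n) (Fin n) F) (g : GL (Fin n) F) :
    unip X * levi g = levi g * unip ((g⁻¹).val * X * g.val) := by
  ext1; simp [unip, levi, fromBlocks_multiply, ← mul_assoc, -coe_units_inv]

variable (n F)

/-- The Shalika subgroup, of all matrices `diag(g, g) * (1 X; 0 1)`. -/
def S : Subgroup (G n F) where
  carrier := {s | ∃ (g : GL (Fin n) F) (X : Matrix (Fin n) (Fin n) F), s = levi g * unip X}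
  mul_mem' := by
    rintro _ _ ⟨g, X, rfl⟩ ⟨g', X', rfl⟩
    refine ⟨g * g', (g'⁻¹).val * X * g'.val + X', ?_⟩
    rw [mul_assoc, ← mul_assoc (unip X), unip_mul_levi, mul_assoc, unip_mul, ← mul_assoc, levi_mul]
  one_mem' := ⟨1, 0, by rw [levi_one, unip_zero, one_mul]⟩
  inv_mem' := by
    rintro _ ⟨g, X, rfl⟩
    refine ⟨g⁻¹, (g⁻¹⁻¹).val * (-X) * (g⁻¹).val, ?_⟩
    rw [← unip_mul_levi, inv_eq_iff_mul_eq_one, mul_assoc, ← mul_assoc (unip X), unip_mul,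
      add_neg_cancel, unip_zero, one_mul, levi_mul, mul_inv_cancel, levi_one]

/-- The `n × n` matrix `w₀` with ones on the antidiagonal and zeros elsewhere. -/
def w₀ : Matrix (Fin n) (Fin n) F := fun i j => if j = Fin.rev i then 1 else 0

variable {n F} in
theorem w₀_mul_apply (A : Matrix (Fin n) (Fin n) F) (i j : Fin n) :
    (w₀ n F * A) i j = A (Fin.rev i) j := by
  simp [w₀, Matrix.mul_apply]

variable {n F} in
theorem mul_w₀_apply (A : Matrix (Fin n) (Fin n) F) (i j : Fin n) :
    (A * w₀ n F) i j = A i (Fin.rev j) := by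
  simp [w₀, Matrix.mul_apply, Fin.rev_eq_iff, eq_comm (a := j)]

theorem w₀_mul_w₀ : w₀ n F * w₀ n F = 1 := by
  ext i j
  rw [w₀_mul_apply]
  simp [w₀, Matrix.one_apply, eq_comm]

/-- The element `ξ = (0 1; w₀ 0)`. -/
def xi : G n F where
  val := fromBlocks 0 1 (w₀ n F) 0
  inv := fromBlocks 0 (w₀ n F) 1 0
  val_inv := by simp [fromBlocks_multiply, w₀_mul_w₀]
  inv_val := by simp [fromBlocks_multiply, w₀_mul_w₀]

/-- The conjugate `H = ξ S ξ⁻¹` of the Shalika subgroup. -/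
def H : Subgroup (G n F) := (S n F).map (MulAut.conj (xi n F)).toMonoidHom

variable {n F}

theorem conj_mem_S (h : H n F) : (xi n F)⁻¹ * (h : G n F) * xi n F ∈ S n F := by
  obtain ⟨_, s, hs, rfl⟩ := h
  simpa [mul_assoc] using hs

theorem conj_mem_H (s : S n F) : xi n F * (s : G n F) * (xi n F)⁻¹ ∈ H n F :=
  ⟨s, s.2, by simp⟩

/-- The group `P ∩ H`, as a subgroup of `H`. -/
abbrev PH (n : ℕ) (F : Type*) [Field F] : Subgroup (H n F) := (P n F).subgroupOf (H n F)

/-- The space `P ∩ H \ H` of right cosets. -/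
abbrev Quo (n : ℕ) (F : Type*) [Field F] : Type _ := Quotient (QuotientGroup.rightRel (PH n F))

/-- The character `Ψ` of the Shalika subgroup: if `s = diag(g, g) * (1 X; 0 1)`, then
`Ψ(s) = ψ(tr X)`. (The upper blocks of `s` are `g` and `g * X`.) -/
def Psi (ψ : AddChar F Circle) (s : S n F) : ℂ :=
  ψ (trace ((toBlocks₁₁ (s : G n F).val)⁻¹ * toBlocks₁₂ (s : G n F).val))

theorem Psi_apply (ψ : AddChar F Circle) (g : GL (Fin n) F) (X : Matrix (Fin n) (Fin n) F) :
    Psi ψ ⟨levi g * unip X, g, X, rfl⟩ = ψ (trace X) := by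
  simp [Psi, levi, unip, fromBlocks_multiply]

/-- The character `Ψ_H(h) = Ψ(ξ⁻¹ h ξ)` of `H`. -/
def PsiH (ψ : AddChar F Circle) (h : H n F) : ℂ :=
  Psi ψ ⟨(xi n F)⁻¹ * (h : G n F) * xi n F, conj_mem_S h⟩

/-- Elements of `P ∩ H` are conjugates of `diag(g, g)`, with `g` diagonal;
they are `diag(a₁, …, aₙ, aₙ, …, a₁)`. -/
theorem exists_of_mem_PH (t : PH n F) : ∃ g : GL (Fin n) F,
    ((t : H n F) : G n F) = xi n F * levi g * (xi n F)⁻¹ ∧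
    (∀ i, ((t : H n F) : G n F).val (Sum.inl i) (Sum.inl i) = g.val i i) ∧
    (∀ i, ((t : H n F) : G n F).val (Sum.inr i) (Sum.inr i) = g.val (Fin.rev i) (Fin.rev i)) := by
  obtain ⟨⟨_, s, ⟨g, X, rfl⟩, rfl⟩, ht⟩ := t
  have hm : (xi n F * (levi g * unip X) * (xi n F)⁻¹).val =
      fromBlocks g.val 0 (w₀ n F * (g.val * X)) (w₀ n F * g.val * w₀ n F) := by
    change fromBlocks 0 1 (w₀ n F) 0 * (fromBlocks g.val 0 0 g.val * fromBlocks 1 X 0 1) *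
      fromBlocks 0 (w₀ n F) 1 0 = _
    simp [fromBlocks_multiply]
  have hP : BlockTriangular (xi n F * (levi g * unip X) * (xi n F)⁻¹).val toLex := ht
  rw [hm] at hP
  have h0 : w₀ n F * (g.val * X) = 0 := by
    ext i j
    have := hP (i := Sum.inr i) (j := Sum.inl j) (Sum.Lex.inl_lt_inr j i)
    simpa using this
  have hX : X = 0 := by
    have h1 : g.val * X = 0 := by
      rw [← one_mul (g.val * X), ← w₀_mul_w₀, mul_assoc, h0, mul_zero]
    have h2 : g⁻¹.val * (g.val * X) = 0 := by rw [h1, mul_zero]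
    rwa [← mul_assoc, ← Units.val_mul, inv_mul_cancel, Units.val_one, one_mul] at h2
  refine ⟨g, ?_, ?_, ?_⟩
  · change xi n F * (levi g * unip X) * (xi n F)⁻¹ = _
    rw [hX, unip_zero, mul_one]
  · intro i
    change (xi n F * (levi g * unip X) * (xi n F)⁻¹).val _ _ = _
    rw [hm]; simp
  · intro i
    change (xi n F * (levi g * unip X) * (xi n F)⁻¹).val _ _ = _
    rw [hm]; simp [w₀_mul_apply, mul_w₀_apply]

theorem PsiH_mul_left (ψ : AddChar F Circle) (t : PH n F) (h : H n F) :
    PsiH ψ ((t : H n F) * h) = PsiH ψ h := by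
  obtain ⟨g, hg, -, -⟩ := exists_of_mem_PH t
  obtain ⟨g', X, hs⟩ := conj_mem_S h
  have h1 : (xi n F)⁻¹ * (((t : H n F) * h : H n F) : G n F) * xi n F =
      levi (g * g') * unip X := by
    rw [← levi_mul, mul_assoc (levi g), ← hs, Subgroup.coe_mul, hg]
    group
  simp only [PsiH, h1, hs, Psi_apply]

end Groups

section PrincipalSeries

variable {n : ℕ} {F : Type*} [Field F] [ValuativeRel F] [TopologicalSpace F]
  [IsNonarchimedeanLocalField F]

/-- The unramified character
`χ = (|·|^{z₁}, …, |·|^{zₙ}, |·|^{-zₙ}, …, |·|^{-z₁})` of `P`. -/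
def chi (z : Fin n → ℂ) (p : G n F) : ℂ :=
  ∏ i, (absF (p.val i i) : ℂ) ^ (Sum.elim z (fun j => -z (Fin.rev j)) i : ℂ)

/-- The modular character `δ = (|·|^{2n-1}, |·|^{2n-3}, …, |·|^{-2n+1})` of `P`. -/
def delta (p : G n F) : ℝ :=
  ∏ i, absF (p.val i i) ^ (2 * n - 1 - 2 * ((finSumFinEquiv i : Fin (n + n)) : ℕ) : ℤ)

variable (F) in
/-- The unramified principal series `I(χ)`: all locally constant functions `f` on `G` with
`f (p g) = χ(p) δ(p)^{1/2} f(g)`. -/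
def I (z : Fin n → ℂ) : Submodule ℂ (G n F → ℂ) where
  carrier := {f | IsLocallyConstant f ∧
    ∀ p ∈ P n F, ∀ g, f (p * g) = chi z p * (Real.sqrt (delta p) : ℂ) * f g}
  add_mem' := by
    rintro f f' ⟨hf, hf2⟩ ⟨hf', hf2'⟩
    refine ⟨hf.add hf', fun p hp g => ?_⟩
    simp only [Pi.add_apply, hf2 p hp, hf2' p hp]
    ring
  zero_mem' := ⟨IsLocallyConstant.const 0, fun p _ g => by simp⟩
  smul_mem' := by
    rintro c f ⟨hf, hf2⟩
    refine ⟨hf.comp (fun x => c • x), fun p hp g => ?_⟩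
    simp only [Pi.smul_apply, smul_eq_mul, hf2 p hp]
    ring

/-- The action of `G` on `I(χ)` by right translations, `(R_g f)(x) = f (x g)`. -/
def R {z : Fin n → ℂ} (g : G n F) : I F z →ₗ[ℂ] I F z where
  toFun f := ⟨fun x => f.1 (x * g), f.2.1.comp_continuous (continuous_mul_const g),
    fun p hp x => by simpa only [mul_assoc] using f.2.2 p hp (x * g)⟩
  map_add' _ _ := rfl
  map_smul' _ _ := rfl

/-- A Shalika functional on `I(χ)`: a linear functional `Λ` with `Λ(R_s f) = Ψ(s) Λ(f)` for all
`s` in the Shalika subgroup `S`. -/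
def IsShalikaFunctional (ψ : AddChar F Circle) {z : Fin n → ℂ} (Λ : I F z →ₗ[ℂ] ℂ) : Prop :=
  ∀ (s : S n F) (f : I F z), Λ (R (s : G n F) f) = Psi ψ s * Λ f

/-- The corresponding notion for the conjugate pair `(H, Ψ_H)`. -/
def IsShalikaFunctionalH (ψ : AddChar F Circle) {z : Fin n → ℂ} (Λ : I F z →ₗ[ℂ] ℂ) : Prop :=
  ∀ (h : H n F) (f : I F z), Λ (R (h : G n F) f) = PsiH ψ h * Λ f

theorem prod_PH (e : Fin n → F → ℂ) (e' : Fin n → F → ℂ)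
    (he : ∀ i x, x ≠ 0 → e i x * e' (Fin.rev i) x = 1) (t : PH n F) :
    ∏ i, Sum.elim e e' i (((t : H n F) : G n F).val i i) = 1 := by
  obtain ⟨g, -, h1, h2⟩ := exists_of_mem_PH t
  have hne : ∀ i, ((t : H n F) : G n F).val i i ≠ 0 := by
    intro i
    have hT : BlockTriangular ((t : H n F) : G n F).val toLex := t.2
    have hT' : BlockTriangular (((t : H n F) : G n F).val.submatrix ofLex ofLex) id :=
      fun a b hab => hT hab
    have hd := Matrix.det_of_isUpperTriangular hT'
    have hu : ((t : H n F) : G n F).val.det ≠ 0 :=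
      ((Matrix.isUnit_iff_isUnit_det _).1 ((t : H n F) : G n F).isUnit).ne_zero
    have : (((t : H n F) : G n F).val.submatrix ofLex ofLex).det =
        ((t : H n F) : G n F).val.det :=
      Matrix.det_submatrix_equiv_self (ofLex (α := Fin n ⊕ Fin n)) _
    rw [← this, hd] at hu
    exact Finset.prod_ne_zero_iff.1 hu (toLex i) (Finset.mem_univ _)
  rw [Fintype.prod_sum_type, ← Equiv.prod_comp Fin.revPerm
    (fun i => Sum.elim e e' (Sum.inr i) (((t : H n F) : G n F).val (Sum.inr i) (Sum.inr i))),
    ← Finset.prod_mul_distrib]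
  refine Finset.prod_eq_one fun i _ => ?_
  simp only [Sum.elim_inl, Sum.elim_inr, Fin.revPerm_apply, h1, h2, Fin.rev_rev]
  exact he i _ (h1 i ▸ hne _)

theorem chi_PH (z : Fin n → ℂ) (t : PH n F) : chi z ((t : H n F) : G n F) = 1 := by
  rw [← prod_PH (fun i x => (absF x : ℂ) ^ z i) (fun j x => (absF x : ℂ) ^ (-z (Fin.rev j))) _ t]
  · refine Finset.prod_congr rfl fun i _ => ?_
    cases i <;> rfl
  · intro i x hx
    have : (absF x : ℂ) ≠ 0 := by exact_mod_cast (absF_pos hx).ne'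
    simp only [Fin.rev_rev]
    rw [← Complex.cpow_add _ _ this, add_neg_cancel, Complex.cpow_zero]

theorem delta_PH (t : PH n F) : delta ((t : H n F) : G n F) = 1 := by
  have h := prod_PH (fun i x => (absF x : ℂ) ^ (2 * n - 1 - 2 * (i : ℕ) : ℤ))
    (fun j x => (absF x : ℂ) ^ (2 * n - 1 - 2 * ((n + j : ℕ)) : ℤ)) ?_ t
  · rw [← Complex.ofReal_inj, Complex.ofReal_one, ← h, delta, Complex.ofReal_prod]
    refine Finset.prod_congr rfl fun i _ => ?_
    cases i <;> simp [add_comm]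
  · intro i x hx
    have : (absF x : ℂ) ≠ 0 := by exact_mod_cast (absF_pos hx).ne'
    rw [← zpow_add₀ this]
    have h0 : (2 * n - 1 - 2 * (i : ℕ) : ℤ) + (2 * n - 1 - 2 * ((n + (Fin.rev i : ℕ) : ℕ)) : ℤ)
        = 0 := by
      have := i.2
      rw [Fin.val_rev]
      omega
    rw [h0, zpow_zero]

/-- The integrand `h ↦ φ(h) Ψ_H⁻¹(h)` of the period integral, as a function on `P ∩ H \ H`. -/
def periodIntegrand (ψ : AddChar F Circle) {z : Fin n → ℂ} (φ : I F z) : Quo n F → ℂ :=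
  Quotient.lift (fun h : H n F => φ.1 (h : G n F) * (PsiH ψ h)⁻¹) (by
    rintro _ h ⟨t, rfl⟩
    change φ.1 (((t : H n F) * h : H n F) : G n F) * (PsiH ψ ((t : H n F) * h))⁻¹ = _
    have h1 := φ.2.2 _ (show ((t : H n F) : G n F) ∈ P n F from t.2) (h : G n F)
    rw [PsiH_mul_left, Subgroup.coe_mul, h1, chi_PH, delta_PH]
    simp)

end PrincipalSeries

section QuotientMeasure

/-- `dq` is the quotient measure on `Γ \ A` of the measure `da` on the group `A` by the Haar
measure `dt` on the subgroup `Γ`: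
`∫_A f(a) da = ∫_{Γ \ A} (∫_Γ f(t a) dt) dq(Γ a)` for all measurable `f ≥ 0`.
The inner integral does not depend on the representative of the coset `Γ a` when `dt` is
right invariant. -/
def IsQuotientMeasure {A : Type*} [Group A] [MeasurableSpace A] (Γ : Subgroup A)
    (da : Measure A) (dt : Measure Γ) (dq : Measure (Quotient (QuotientGroup.rightRel Γ))) :
    Prop :=
  ∀ f : A → ℝ≥0∞, Measurable f → ∫⁻ a, f a ∂da = ∫⁻ q, ∫⁻ t : Γ, f ((t : A) * q.out) ∂dt ∂dq

end QuotientMeasure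

end

end Shalika

set_option linter.unusedSectionVars false

/-! Absolute convergence. By the Iwasawa decomposition (`exists_iwasawa`) and compactness of GL(𝔬),
|φ| is at most a constant times the positive function `spherical` attached to |χ|δ^{1/2}
(`exists_norm_le_spherical`), and |Ψ_H| = 1. It remains to bound a positive integral over P ∩ H \ H.

P ∩ H is the torus of the diag(a₁,…,aₙ,aₙ,…,a₁), and H is unimodular (`modularCharacter_H`). The set
`heightOne` of those h whose upper left block lies in N·GL_n(𝔬), N unipotent upper triangular, meets
every coset of the torus in a translate of the maximal compact subgroup of the torus. Its normalized
indicator `heightWeight` therefore has integral 1 along each coset, and the quotient measure must be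
the image of `heightWeight`·dh. This yields its existence, its uniqueness and its right invariance,
and with the last the equivariance of Λ_H.

Moreover `heightOne` = U·(H ∩ GL(𝔬)), where U is the group of the h with upper left block in N.
Instead of decomposing a Haar measure, `setLIntegral_lt_top_of_le_measure` bounds the integral over
`heightOne` by one over the coordinates of U. The upper left block of an element of U can be
stripped off on the left, where `spherical` ignores upper triangular unipotents
(`spherical_lowerH`). What remains is an integral of Gindikin–Karpelevich type over the entries
below the diagonal in the last n rows. `lmarginal_spherical_lowerGL_lt_top` removes these entries
one at a time by the rank-one formula `lintegral_spherical_transGL`, each at the cost of a factor ∫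
max(1,|y|)^{-(1+t)} dy. The numbers t that occur are Re zᵢ + Re zⱼ, and Re zᵢ - Re zⱼ for i < j;
they are positive by assumption (`charExpRe_lt`).

Nonvanishing. `testFunction` is supported on P·K₁, with K₁ the principal congruence subgroup. On H ∩
P·K₁ both it and Ψ_H equal 1: there X is integral, and the diagonal entries of p in mirrored
positions have equal absolute values, while χδ^{1/2} gives them opposite exponents. The period of
`testFunction` is thus the measure of a set containing the image of an open neighbourhood of 1.
Conjugation by ξ passes from H to S. -/

namespace Shalika

/-! ### The normalized absolute value and the topology of F -/

section AbsoluteValue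

variable {F : Type*} [Field F] [ValuativeRel F] [TopologicalSpace F]
  [IsNonarchimedeanLocalField F]

variable (F) in
theorem one_lt_resCard : 1 < resCard F := by
  unfold resCard
  exact_mod_cast Finite.one_lt_card

variable (F) in
theorem resCard_pos : 0 < (resCard F : ℝ) :=
  lt_trans zero_lt_one (by exact_mod_cast one_lt_resCard F)

theorem absF_nonneg (x : F) : 0 ≤ absF x := NNReal.coe_nonneg _

@[simp] theorem absF_zero : absF (0 : F) = 0 := by simp [absF]

@[simp] theorem absF_one : absF (1 : F) = 1 := by simp [absF]

@[simp] theorem absF_mul (x y : F) : absF (x * y) = absF x * absF y := by simp [absF]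

variable (F) in
/-- The absolute value as a homomorphism of monoids with zero. -/
noncomputable def absHom : F →*₀ ℝ where
  toFun := absF
  map_zero' := absF_zero
  map_one' := absF_one
  map_mul' := absF_mul

@[simp] theorem absF_inv (x : F) : absF x⁻¹ = (absF x)⁻¹ := map_inv₀ (absHom F) x

@[simp] theorem absF_div (x y : F) : absF (x / y) = absF x / absF y := map_div₀ (absHom F) x y

@[simp] theorem absF_prod {α : Type*} (s : Finset α) (f : α → F) :
    absF (∏ i ∈ s, f i) = ∏ i ∈ s, absF (f i) := map_prod (absHom F) f s

@[simp] theorem absF_zpow (x : F) (k : ℤ) : absF (x ^ k) = absF x ^ k := map_zpow₀ (absHom F) x k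

theorem absF_eq_zero {x : F} : absF x = 0 ↔ x = 0 := map_eq_zero (absHom F)

theorem absF_le_absF_iff {x y : F} : absF x ≤ absF y ↔ valuation F x ≤ valuation F y := by
  unfold absF
  rw [NNReal.coe_le_coe, (WithZeroMulInt.toNNReal_strictMono (one_lt_resCard F)).le_iff_le]
  exact map_le_map_iff _

theorem absF_lt_absF_iff {x y : F} : absF x < absF y ↔ valuation F x < valuation F y := by
  rw [← not_le, ← not_le, absF_le_absF_iff]

theorem absF_le_one_iff {x : F} : absF x ≤ 1 ↔ x ∈ 𝒪[F] := by
  rw [← absF_one (F := F), absF_le_absF_iff, map_one]; rfl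

theorem absF_neg (x : F) : absF (-x) = absF x := by
  refine le_antisymm ?_ ?_ <;> rw [absF_le_absF_iff, Valuation.map_neg]

theorem absF_add_le_max (x y : F) : absF (x + y) ≤ max (absF x) (absF y) := by
  rcases le_total (absF x) (absF y) with h | h
  · rw [max_eq_right h, absF_le_absF_iff]
    rw [absF_le_absF_iff] at h
    exact ((valuation F).map_add x y).trans (by simp [h])
  · rw [max_eq_left h, absF_le_absF_iff]
    rw [absF_le_absF_iff] at h
    exact ((valuation F).map_add x y).trans (by simp [h])

theorem absF_add_le {x y : F} {r : ℝ} (hx : absF x ≤ r) (hy : absF y ≤ r) : absF (x + y) ≤ r :=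
  (absF_add_le_max x y).trans (max_le hx hy)

theorem absF_sub_le {x y : F} {r : ℝ} (hx : absF x ≤ r) (hy : absF y ≤ r) : absF (x - y) ≤ r := by
  rw [sub_eq_add_neg]; exact absF_add_le hx (by rwa [absF_neg])

theorem absF_sum_le {α : Type*} {s : Finset α} {f : α → F} {r : ℝ} (hr : 0 ≤ r)
    (h : ∀ i ∈ s, absF (f i) ≤ r) : absF (∑ i ∈ s, f i) ≤ r := by
  classical
  induction s using Finset.induction_on with
  | empty => simpa
  | insert a s ha ih =>
    rw [Finset.sum_insert ha]
    exact absF_add_le (h a (Finset.mem_insert_self a s))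
      (ih fun i hi => h i (Finset.mem_insert_of_mem hi))

theorem absF_add_eq_of_lt {x y : F} (h : absF y < absF x) : absF (x + y) = absF x := by
  refine le_antisymm ((absF_add_le_max x y).trans (by simp [h.le])) ?_
  by_contra! hlt
  have := absF_add_le_max (x + y) (-y)
  rw [add_neg_cancel_right, absF_neg] at this
  exact absurd this (by simp [hlt, h])

variable (F) in
theorem exists_uniformizer : ∃ ϖ : F, absF ϖ = (resCard F : ℝ)⁻¹ := by
  obtain ⟨γ, hγ⟩ := (IsNonarchimedeanLocalField.valueGroupWithZeroIsoInt F).surjective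
    (WithZero.exp (-1))
  obtain ⟨x, rfl⟩ := ValuativeRel.valuation_surjective γ
  refine ⟨x, ?_⟩
  have hγ' : IsNonarchimedeanLocalField.valueGroupWithZeroIsoInt F (valuation F x) =
    WithZero.exp (-1) := hγ
  unfold absF
  have h1 : WithZero.unzero (x := (WithZero.exp (-1) : WithZero (Multiplicative ℤ))) (by simp) =
    Multiplicative.ofAdd (-1) := rfl
  rw [hγ', WithZeroMulInt.toNNReal_neg_apply _ (by simp), h1]
  simp

theorem exists_absF_eq_zpow {x : F} (hx : x ≠ 0) : ∃ k : ℤ, absF x = (resCard F : ℝ) ^ k := by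
  unfold absF
  rw [WithZeroMulInt.toNNReal_neg_apply _ (by simpa using hx)]
  exact ⟨_, by push_cast; rfl⟩

/-- The values are powers of q, so there is none strictly between q⁻¹ and 1. This trades strict
bounds for the non-strict ones to which `absF_sum_le` applies. -/
theorem absF_lt_one_iff {x : F} : absF x < 1 ↔ absF x ≤ (resCard F : ℝ)⁻¹ := by
  have h1 : (1 : ℝ) < resCard F := by exact_mod_cast one_lt_resCard F
  refine ⟨fun h => ?_, fun h => h.trans_lt (inv_lt_one_of_one_lt₀ h1)⟩
  by_cases hx : x = 0
  · simp [hx]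
  obtain ⟨k, hk⟩ := exists_absF_eq_zpow hx
  rw [hk, ← zpow_zero (resCard F : ℝ), zpow_lt_zpow_iff_right₀ h1] at h
  rw [hk, ← _root_.zpow_neg_one]
  exact zpow_le_zpow_right₀ h1.le (by omega)

theorem exists_absF_le_mem_nhds {U : Set F} (hU : U ∈ nhds 0) :
    ∃ ε > 0, {x : F | absF x ≤ ε} ⊆ U := by
  obtain ⟨γ, hγ, hU⟩ := (IsValuativeTopology.hasBasis_nhds_zero' F).mem_iff.1 hU
  obtain ⟨a, rfl⟩ := ValuativeRel.valuation_surjective γ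
  have ha : 0 < absF a := absF_pos (by simpa using hγ)
  exact ⟨absF a / 2, by positivity, fun x hx => hU (absF_lt_absF_iff.1
    (lt_of_le_of_lt hx (by linarith)))⟩

variable (F) in
theorem exists_absF_lt {ε : ℝ} (hε : 0 < ε) : ∃ a : F, a ≠ 0 ∧ absF a < ε := by
  obtain ⟨ϖ, hϖ⟩ := exists_uniformizer F
  have h1 : (1 : ℝ) < resCard F := by exact_mod_cast one_lt_resCard F
  obtain ⟨k, hk⟩ := exists_pow_lt_of_lt_one hε (inv_lt_one_of_one_lt₀ h1)
  refine ⟨ϖ ^ k, pow_ne_zero _ fun h => ?_, ?_⟩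
  · simp [h] at hϖ
    exact (resCard_pos F).ne hϖ
  · rwa [← zpow_natCast, absF_zpow, hϖ, zpow_natCast]

theorem absF_lt_mem_nhds {ε : ℝ} (hε : 0 < ε) : {x : F | absF x < ε} ∈ nhds 0 := by
  obtain ⟨a, ha, haε⟩ := exists_absF_lt F hε
  refine (IsValuativeTopology.hasBasis_nhds_zero' F).mem_iff.2
    ⟨valuation F a, by simpa using ha, fun x hx => ?_⟩
  exact (absF_lt_absF_iff.2 hx).trans haε

variable (F) in
/-- The ball of radius `r` around `0`, as an additive subgroup. -/
def ballGroup (r : ℝ) (hr : 0 ≤ r) : AddSubgroup F where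
  carrier := {x | absF x ≤ r}
  zero_mem' := by simpa
  add_mem' hx hy := absF_add_le hx hy
  neg_mem' hx := by simpa [absF_neg] using hx

theorem isOpen_absF_le {r : ℝ} (hr : 0 < r) : IsOpen {x : F | absF x ≤ r} :=
  AddSubgroup.isOpen_of_mem_nhds (ballGroup F r hr.le) (g := 0)
    (Filter.mem_of_superset (absF_lt_mem_nhds hr) fun x hx => show absF x ≤ r from le_of_lt hx)

theorem continuous_absF : Continuous (absF : F → ℝ) := by
  rw [continuous_iff_continuousAt]
  intro x
  by_cases hx : x = 0
  · subst hx
    rw [ContinuousAt, absF_zero, Metric.tendsto_nhds]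
    intro ε hε
    filter_upwards [absF_lt_mem_nhds hε] with y hy
    rwa [Real.dist_eq, sub_zero, abs_of_nonneg (absF_nonneg y)]
  -- Away from 0 the absolute value is locally constant, by `absF_add_eq_of_lt`.
  · refine (continuousAt_const (y := absF x)).congr ?_
    have h : {y : F | absF (y - x) < absF x} ∈ nhds x := by
      have : Filter.Tendsto (fun y : F => y - x) (nhds x) (nhds 0) := by
        simpa using (continuous_sub_right x).tendsto x
      exact this (absF_lt_mem_nhds (absF_pos hx))
    filter_upwards [h] with y hy
    simpa using (absF_add_eq_of_lt hy).symm

theorem isClosed_absF_le (r : ℝ) : IsClosed {x : F | absF x ≤ r} :=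
  isClosed_le continuous_absF continuous_const

variable (F) in
theorem exists_absF_gt (r : ℝ) : ∃ a : F, a ≠ 0 ∧ r < absF a := by
  obtain ⟨a, ha, h⟩ := exists_absF_lt F (ε := (max r 1)⁻¹) (by positivity)
  refine ⟨a⁻¹, inv_ne_zero ha, ?_⟩
  rw [absF_inv]
  have := absF_pos ha
  exact (le_max_left r 1).trans_lt ((lt_inv_comm₀ this (by positivity)).1 h)

theorem isCompact_absF_le (r : ℝ) : IsCompact {x : F | absF x ≤ r} := by
  obtain ⟨a, -, ha⟩ := exists_absF_gt F r
  refine (IsNonarchimedeanLocalField.isCompact_closedBall F (valuation F a)).of_isClosed_subset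
    (isClosed_absF_le r) fun x hx => ?_
  exact absF_le_absF_iff.1 (le_trans hx ha.le)

instance instSigmaCompactLocalField : SigmaCompactSpace F := by
  refine ⟨⟨fun n : ℕ => {x | absF x ≤ n}, fun n => isCompact_absF_le _, ?_⟩⟩
  refine Set.eq_univ_of_forall fun x => Set.mem_iUnion.2 ?_
  exact exists_nat_ge (absF x)

instance instT1LocalField : T1Space F := by
  have : IsClosed ({0} : Set F) := by
    convert isClosed_absF_le (F := F) 0 using 1
    ext x
    simp [← absF_eq_zero, (absF_nonneg x).ge_iff_eq']
  exact IsTopologicalAddGroup.t1Space F this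

instance instFirstCountableNhdsZero : (nhds (0 : F)).IsCountablyGenerated := by
  refine Filter.HasCountableBasis.isCountablyGenerated (ι := ℕ) (p := fun _ => True)
    (s := fun n => {x | absF x < ((n : ℝ) + 1)⁻¹}) ⟨⟨fun U => ⟨fun hU => ?_, ?_⟩⟩,
    Set.to_countable _⟩
  · obtain ⟨ε, hε, h⟩ := exists_absF_le_mem_nhds hU
    obtain ⟨n, hn⟩ := exists_nat_one_div_lt hε
    refine ⟨n, trivial, fun x hx => h (show absF x ≤ ε from le_of_lt (lt_trans hx ?_))⟩
    simpa using hn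
  · rintro ⟨n, -, h⟩
    exact Filter.mem_of_superset (absF_lt_mem_nhds (by positivity)) h

/-- First countability at 0 makes the additive group pseudometrizable, and σ-compactness then gives
a countable base. It is needed for Borel σ-algebras of finite products to be product σ-algebras. -/
instance instSecondCountableLocalField : SecondCountableTopology F := by
  let := IsTopologicalAddGroup.rightUniformSpace F
  have := isUniformAddGroup_of_addCommGroup (G := F)
  have : (_root_.uniformity F).IsCountablyGenerated := IsUniformAddGroup.uniformity_countably_generated
  let := TopologicalSpace.pseudoMetrizableSpacePseudoMetric F
  infer_instance

end AbsoluteValue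

/-! ### Haar measure on F: scaling, and the basic convergent integral -/

section Haar

open scoped Pointwise

variable {F : Type*} [Field F] [ValuativeRel F] [TopologicalSpace F]
  [IsNonarchimedeanLocalField F] [MeasurableSpace F]
  (μ : Measure F) [μ.IsAddHaarMeasure]

theorem measure_absF_le_ne_top (r : ℝ) : μ {x | absF x ≤ r} ≠ ∞ :=
  (isCompact_absF_le r).measure_lt_top.ne

theorem measure_absF_le_ne_zero {r : ℝ} (hr : 0 < r) : μ {x | absF x ≤ r} ≠ 0 :=
  (isOpen_absF_le hr).measure_ne_zero μ ⟨0, by simpa using hr.le⟩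

variable [BorelSpace F]

/-- The ring 𝔬 is the disjoint union of the q cosets of its maximal ideal, all of the same measure.
-/
theorem measure_integers_eq_mul :
    μ {x | absF x ≤ 1} = (resCard F : ℝ≥0∞) * μ {x | absF x ≤ (resCard F : ℝ)⁻¹} := by
  have hsurj := IsLocalRing.residue_surjective (R := 𝒪[F])
  let s : 𝓀[F] → 𝒪[F] := Function.surjInv hsurj
  have hs : ∀ a, IsLocalRing.residue 𝒪[F] (s a) = a := Function.surjInv_eq hsurj
  have hmem : ∀ x : 𝒪[F], IsLocalRing.residue 𝒪[F] x = 0 ↔ absF (x : F) ≤ (resCard F : ℝ)⁻¹ := by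
    intro x
    rw [IsLocalRing.residue_eq_zero_iff, IsLocalRing.mem_maximalIdeal, mem_nonunits_iff,
      ← absF_lt_one_iff, ← not_le, not_iff_not]
    constructor
    · intro h
      obtain ⟨y, hy⟩ := h.exists_right_inv
      have h1 : absF (x : F) * absF (y : F) = 1 := by
        rw [← absF_mul, ← absF_one (F := F)]; exact congrArg absF (congrArg Subtype.val hy)
      have hy1 : absF (y : F) ≤ 1 := absF_le_one_iff.2 y.2
      nlinarith [absF_nonneg (x : F), absF_nonneg (y : F)]
    · intro h
      have hx0 : (x : F) ≠ 0 := by intro h0; rw [h0, absF_zero] at h; linarith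
      refine IsUnit.of_mul_eq_one ⟨(x : F)⁻¹, absF_le_one_iff.1 ?_⟩ (Subtype.ext ?_)
      · rw [absF_inv]; exact inv_le_one_of_one_le₀ h
      · simp [hx0]
  have hU : {x : F | absF x ≤ 1} =
      ⋃ a : 𝓀[F], (fun x => (-(s a : F)) + x) ⁻¹' {x | absF x ≤ (resCard F : ℝ)⁻¹} := by
    ext x
    simp only [Set.mem_ofPred_eq, Set.mem_iUnion, Set.mem_preimage]
    constructor
    · intro hx
      let x' : 𝒪[F] := ⟨x, absF_le_one_iff.1 hx⟩
      refine ⟨IsLocalRing.residue _ x', ?_⟩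
      have := (hmem (-(s (IsLocalRing.residue _ x')) + x')).1 (by simp [hs])
      simpa using this
    · rintro ⟨a, ha⟩
      have h1 : absF (s a : F) ≤ 1 := absF_le_one_iff.2 (s a).2
      have h2 := absF_add_le h1 (absF_lt_one_iff.2 ha).le
      simpa using h2
  have hmeas : MeasurableSet {x : F | absF x ≤ (resCard F : ℝ)⁻¹} :=
    (isClosed_absF_le _).measurableSet
  have := Fintype.ofFinite 𝓀[F]
  rw [hU, measure_iUnion]
  · simp only [measure_preimage_add, tsum_fintype, Finset.sum_const, nsmul_eq_mul]
    congr 1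
    simp [resCard]
  · intro a b hab
    refine Set.disjoint_left.2 fun x hx hy => hab ?_
    have hxa : absF (-(s a : F) + x) ≤ (resCard F : ℝ)⁻¹ := hx
    have hxb : absF (-(s b : F) + x) ≤ (resCard F : ℝ)⁻¹ := hy
    have h := absF_sub_le hxb hxa
    have h' : IsLocalRing.residue 𝒪[F] (s a - s b) = 0 := by
      rw [hmem]
      convert h using 2
      push_cast
      ring
    rw [map_sub, hs, hs, sub_eq_zero] at h'
    exact h'
  · exact fun a => hmeas.preimage (measurable_const_add _)

/-- Both sides are multiplicative. They agree on units, which preserve 𝔬, and on a uniformizer,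
which maps 𝔬 onto an ideal of index q. -/
theorem distribHaarChar_eq_absF (a : Fˣ) :
    (distribHaarChar F a : ℝ) = absF (a : F) := by
  let ν : Measure F := Measure.addHaar
  have h0 := measure_absF_le_ne_zero ν one_pos
  have ht := measure_absF_le_ne_top ν 1
  have key : ∀ u : Fˣ, absF (u : F) = 1 → distribHaarChar F u = 1 := by
    intro u hu
    refine distribHaarChar_eq_of_measure_smul_eq_mul h0 ht ?_
    rw [ENNReal.coe_one, one_mul]
    congr 1
    ext x
    rw [Set.mem_smul_set_iff_inv_smul_mem]
    simp [Units.smul_def, hu]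
  obtain ⟨ϖ, hϖ⟩ := exists_uniformizer F
  have hq := resCard_pos F
  have hϖ0 : ϖ ≠ 0 := by rintro rfl; simp at hϖ; exact hq.ne hϖ
  have hpi : distribHaarChar F (Units.mk0 ϖ hϖ0) = (resCard F)⁻¹ := by
    refine distribHaarChar_eq_of_measure_smul_eq_mul h0 ht ?_
    have : Units.mk0 ϖ hϖ0 • {x : F | absF x ≤ 1} = {x | absF x ≤ (resCard F : ℝ)⁻¹} := by
      ext x
      rw [Set.mem_smul_set_iff_inv_smul_mem]
      simp only [Units.smul_def, Set.mem_ofPred_eq, smul_eq_mul, absF_mul, Units.val_inv_eq_inv_val,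
        Units.val_mk0, absF_inv, hϖ, inv_inv]
      constructor
      · intro h; rw [← one_div, le_div_iff₀ hq]; linarith
      · intro h; rw [← one_div, le_div_iff₀ hq] at h; linarith
    rw [this, measure_integers_eq_mul ν, ← mul_assoc, ← ENNReal.coe_mul,
      inv_mul_cancel₀ (resCard_ne_zero F), ENNReal.coe_one, one_mul]
  obtain ⟨k, hk⟩ := exists_absF_eq_zpow a.ne_zero
  -- Since |a| = q^k and |ϖ| = q⁻¹, the second factor a·ϖ^k is a unit of 𝔬.
  have ha : a = Units.mk0 ϖ hϖ0 ^ (-k) * (a * Units.mk0 ϖ hϖ0 ^ k) := by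
    rw [mul_comm a, ← mul_assoc, ← _root_.zpow_add, neg_add_cancel, zpow_zero, one_mul]
  rw [ha, map_mul, map_zpow, hpi, key, mul_one]
  · rw [← ha, hk]; simp
  · simp only [Units.val_mul, Units.val_zpow_eq_zpow_val, Units.val_mk0, absF_mul, absF_zpow, hk, hϖ]
    rw [← mul_zpow, mul_inv_cancel₀ hq.ne', _root_.one_zpow]

theorem measure_smul_eq_absF_mul {a : F} (ha : a ≠ 0) (s : Set F) :
    μ ((fun x => a⁻¹ * x) ⁻¹' s) = ENNReal.ofReal (absF a) * μ s := by
  have h := distribHaarChar_mul μ (Units.mk0 a ha) s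
  have h2 : Units.mk0 a ha • s = (fun x => a⁻¹ * x) ⁻¹' s := by
    ext x
    rw [Set.mem_smul_set_iff_inv_smul_mem]
    simp [Units.smul_def]
  rw [← h2, ← h]
  congr 1
  rw [← ENNReal.ofReal_coe_nnreal, distribHaarChar_eq_absF]
  rfl

theorem lintegral_comp_mul_add {a : F} (ha : a ≠ 0) (b : F) (f : F → ℝ≥0∞) :
    ∫⁻ x, f (a * x + b) ∂μ = ENNReal.ofReal (absF a)⁻¹ * ∫⁻ x, f x ∂μ := by
  have hmap : μ.map (fun x => a * x) = ENNReal.ofReal (absF a)⁻¹ • μ := by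
    ext s hs
    rw [Measure.map_apply (measurable_const_mul a) hs]
    have := measure_smul_eq_absF_mul μ (inv_ne_zero ha) s
    rw [inv_inv] at this
    rw [this, absF_inv]; rfl
  let e : F ≃ₜ F := (Homeomorph.mulLeft₀ a ha)
  have h1 : ∫⁻ x, f (a * x + b) ∂μ = ∫⁻ x, f (x + b) ∂(μ.map (fun x => a * x)) :=
    (lintegral_map_equiv (fun x => f (x + b)) e.toMeasurableEquiv).symm
  rw [h1, hmap, lintegral_smul_measure, lintegral_add_right_eq_self]
  rfl

/-- The ball of radius q^k has q^k times the volume of 𝔬, so the integral is dominated by a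
geometric series of ratio q^(-t). -/
theorem lintegral_max_one_absF_rpow_lt_top {t : ℝ} (ht : 0 < t) :
    ∫⁻ y : F, ENNReal.ofReal (max 1 (absF y) ^ (-(1 + t))) ∂μ < ∞ := by
  set q : ℝ := (resCard F : ℝ) with hq
  have hq1 : 1 < q := by rw [hq]; exact_mod_cast one_lt_resCard F
  have hq0 : 0 < q := by linarith
  obtain ⟨ϖ, hϖ⟩ := exists_uniformizer F
  have hϖ0 : ϖ ≠ 0 := by rintro rfl; simp at hϖ; exact hq0.ne hϖ
  have hvol : ∀ k : ℕ, μ {x | absF x ≤ q ^ k} = ENNReal.ofReal (q ^ k) * μ {x | absF x ≤ 1} := by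
    intro k
    have := measure_smul_eq_absF_mul μ (zpow_ne_zero (-(k : ℤ)) hϖ0) {x : F | absF x ≤ 1}
    rw [absF_zpow, hϖ, ← hq, _root_.inv_zpow', neg_neg, zpow_natCast] at this
    rw [← this]
    congr 1
    ext x
    simp only [Set.mem_ofPred_eq, Set.mem_preimage, absF_mul, absF_inv, absF_zpow, hϖ, ← hq]
    rw [_root_.inv_zpow', neg_neg, zpow_natCast, inv_mul_le_iff₀ (by positivity), mul_one]
  -- Full balls replace the shells |y| = q^k; the overlaps do no harm to an upper bound.
  have hbound : ∀ y : F, ENNReal.ofReal (max 1 (absF y) ^ (-(1 + t))) ≤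
      ∑' k : ℕ, Set.indicator {x : F | absF x ≤ q ^ k}
        (fun _ => ENNReal.ofReal ((q ^ k) ^ (-(1 + t)))) y := by
    intro y
    obtain ⟨k, hk⟩ : ∃ k : ℕ, max 1 (absF y) = q ^ k := by
      rcases le_total (absF y) 1 with h | h
      · exact ⟨0, by simp [h]⟩
      · obtain ⟨k, hk⟩ := exists_absF_eq_zpow (x := y) (by rintro rfl; simp at h; linarith)
        rw [hk] at h
        have hk0 : 0 ≤ k := by
          rw [← zpow_zero (resCard F : ℝ)] at h
          exact (zpow_le_zpow_iff_right₀ hq1).1 h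
        lift k to ℕ using hk0
        exact ⟨k, by rw [max_eq_right (by rwa [hk]), hk, zpow_natCast]⟩
    refine le_trans ?_ (ENNReal.le_tsum k)
    rw [Set.indicator_of_mem (by simp [← hk]), hk]
  refine (lintegral_mono hbound).trans_lt ?_
  rw [lintegral_tsum fun k => (measurable_const.indicator (isClosed_absF_le _).measurableSet).aemeasurable]
  have hterm : ∀ k : ℕ, ∫⁻ y : F, Set.indicator {x : F | absF x ≤ q ^ k}
      (fun _ => ENNReal.ofReal ((q ^ k) ^ (-(1 + t)))) y ∂μ =
      ENNReal.ofReal ((q ^ (-t)) ^ k) * μ {x | absF x ≤ 1} := by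
    intro k
    rw [lintegral_indicator_const (isClosed_absF_le _).measurableSet, hvol, ← mul_assoc,
      ← ENNReal.ofReal_mul (by positivity)]
    congr 2
    rw [← Real.rpow_natCast (q ^ (-t)), ← Real.rpow_mul hq0.le, ← Real.rpow_natCast q,
      ← Real.rpow_mul hq0.le, ← Real.rpow_add hq0]
    congr 1
    ring
  simp_rw [hterm]
  rw [ENNReal.tsum_mul_right]
  refine ENNReal.mul_lt_top ?_ (measure_absF_le_ne_top μ 1).lt_top
  have hlt : q ^ (-t) < 1 := Real.rpow_lt_one_of_one_lt_of_neg hq1 (by linarith)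
  have h0 : 0 ≤ q ^ (-t) := by positivity
  exact (summable_geometric_of_lt_one h0 hlt).tsum_ofReal_lt_top

end Haar

/-! ### Permutation, elementary and triangular matrices -/

section Matrices

variable {ι : Type*} [Fintype ι] [DecidableEq ι] {F : Type*} [Field F]

variable (F) in
/-- Permutation matrices as elements of `GL`. -/
def permGL (σ : Equiv.Perm ι) : GL ι F where
  val := σ.permMatrix F
  inv := (σ⁻¹).permMatrix F
  val_inv := by rw [← Matrix.permMatrix_mul, inv_mul_cancel, Matrix.permMatrix_one]
  inv_val := by rw [← Matrix.permMatrix_mul, mul_inv_cancel, Matrix.permMatrix_one]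

theorem mul_permGL_apply (A : Matrix ι ι F) (σ : Equiv.Perm ι) (i j : ι) :
    (A * (permGL F σ).val) i j = A i (σ⁻¹ j) := by
  change (A * σ.permMatrix F) i j = _
  rw [Equiv.Perm.permMatrix, PEquiv.mul_toMatrix_toPEquiv]
  rfl

theorem permGL_mul_apply (A : Matrix ι ι F) (σ : Equiv.Perm ι) (i j : ι) :
    ((permGL F σ).val * A) i j = A (σ i) j := by
  change (σ.permMatrix F * A) i j = _
  rw [Equiv.Perm.permMatrix, PEquiv.toMatrix_toPEquiv_mul]
  rfl

/-- The matrix `1 + N` for `N` with `N * N = 0`. -/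
def oneAddGL (N : Matrix ι ι F) (hN : N * N = 0) : GL ι F where
  val := 1 + N
  inv := 1 - N
  val_inv := by rw [mul_sub, mul_one, add_mul, one_mul, hN]; simp
  inv_val := by rw [mul_add, mul_one, sub_mul, one_mul, hN]; simp

/-- Row `i` of `permGL F σ` has its 1 in column `σ i`, hence the reversed order. Multiplying by a
swap on the left of the matrix therefore multiplies τ by the swap on the right. -/
theorem permGL_mul_permGL (σ τ : Equiv.Perm ι) : permGL F σ * permGL F τ = permGL F (τ * σ) := by
  ext1
  exact (Matrix.permMatrix_mul (R := F) τ σ).symm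

/-- The elementary matrix `1 + x * E_{j i}`. -/
def transGL {i j : ι} (hij : i ≠ j) (x : F) : GL ι F :=
  oneAddGL (Matrix.single j i x) (Matrix.single_mul_single_of_ne _ _ _ _ hij _)

theorem mul_transGL_apply (A : Matrix ι ι F) {i j : ι} (hij : i ≠ j) (x : F) (r s : ι) :
    (A * (transGL hij x).val) r s = A r s + if s = i then A r j * x else 0 := by
  change (A * (1 + Matrix.single j i x)) r s = _
  rw [mul_add, mul_one, Matrix.add_apply]
  congr 1
  split_ifs with h
  · subst h; simp
  · simp [h]

theorem transGL_mul_apply (A : Matrix ι ι F) {i j : ι} (hij : i ≠ j) (x : F) (r s : ι) :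
    ((transGL hij x).val * A) r s = A r s + if r = j then x * A i s else 0 := by
  change ((1 + Matrix.single j i x) * A) r s = _
  rw [add_mul, one_mul, Matrix.add_apply]
  congr 1
  split_ifs with h
  · subst h; simp
  · simp [h]

variable {m : ℕ} (b : ι ≃ Fin m)

variable (F) in
/-- The invertible matrices which are upper triangular for the order of the indices given
by `b`. -/
def borelGL : Subgroup (GL ι F) where
  carrier := {p | BlockTriangular p.val b}
  mul_mem' ha hb := BlockTriangular.mul ha hb
  one_mem' := blockTriangular_one
  inv_mem' := by
    intro a ha
    have : Invertible a.val := a.invertible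
    have h := blockTriangular_inv_of_blockTriangular (show BlockTriangular a.val b from ha)
    change BlockTriangular (a⁻¹).val b
    rwa [Matrix.coe_units_inv]

variable {b}

theorem blockTriangular_mul_diag {A B : Matrix ι ι F} (hA : BlockTriangular A b)
    (hB : BlockTriangular B b) (i : ι) : (A * B) i i = A i i * B i i := by
  rw [Matrix.mul_apply, Finset.sum_eq_single i]
  · intro j _ hj
    rcases lt_or_gt_of_ne (fun h => hj (b.injective h) : b j ≠ b i) with h | h
    · rw [hA h, zero_mul]
    · rw [hB h, mul_zero]
  · simp

theorem borelGL_mul_diag {p q : GL ι F} (hp : p ∈ borelGL F b) (hq : q ∈ borelGL F b) (i : ι) :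
    (p * q).val i i = p.val i i * q.val i i :=
  blockTriangular_mul_diag hp hq i

theorem borelGL_diag_mul_inv {p : GL ι F} (hp : p ∈ borelGL F b) (i : ι) :
    p.val i i * (p⁻¹).val i i = 1 := by
  rw [← borelGL_mul_diag hp (inv_mem hp), mul_inv_cancel]
  simp

theorem borelGL_diag_ne_zero {p : GL ι F} (hp : p ∈ borelGL F b) (i : ι) : p.val i i ≠ 0 :=
  left_ne_zero_of_mul_eq_one (borelGL_diag_mul_inv hp i)

end Matrices

/-! ### Iwasawa decomposition and heights -/

section Iwasawa

variable {ι : Type*} [Fintype ι] [DecidableEq ι] {F : Type*} [Field F] [ValuativeRel F]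
  [TopologicalSpace F] [IsNonarchimedeanLocalField F]

theorem absF_mul_apply_le {A B : Matrix ι ι F} (hA : ∀ i j, absF (A i j) ≤ 1)
    (hB : ∀ i j, absF (B i j) ≤ 1) (i j : ι) : absF ((A * B) i j) ≤ 1 := by
  rw [Matrix.mul_apply]
  refine absF_sum_le zero_le_one fun k _ => ?_
  rw [absF_mul]
  exact mul_le_one₀ (hA i k) (absF_nonneg _) (hB k j)

theorem absF_one_apply_le (i j : ι) : absF ((1 : Matrix ι ι F) i j) ≤ 1 := by
  rw [Matrix.one_apply]
  split_ifs <;> simp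

variable (ι F) in
/-- The group `GL(𝔬)` of integral matrices with integral inverse. -/
def integralGL : Subgroup (GL ι F) where
  carrier := {k | (∀ i j, absF (k.val i j) ≤ 1) ∧ ∀ i j, absF ((k⁻¹).val i j) ≤ 1}
  mul_mem' := by
    rintro a b ⟨ha, ha'⟩ ⟨hb, hb'⟩
    refine ⟨absF_mul_apply_le ha hb, ?_⟩
    rw [_root_.mul_inv_rev]
    exact absF_mul_apply_le hb' ha'
  one_mem' := by
    refine ⟨absF_one_apply_le, ?_⟩
    rw [inv_one]
    exact absF_one_apply_le
  inv_mem' := by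
    rintro a ⟨ha, ha'⟩
    exact ⟨ha', by rwa [inv_inv]⟩

theorem permGL_mem (σ : Equiv.Perm ι) : permGL F σ ∈ integralGL ι F := by
  have h : ∀ (τ : Equiv.Perm ι) (i j : ι), absF (τ.permMatrix F i j) ≤ 1 := by
    intro τ i j
    change absF (PEquiv.toMatrix τ.toPEquiv i j) ≤ 1
    rw [PEquiv.toMatrix_apply]
    split_ifs <;> simp
  exact ⟨h σ, h σ⁻¹⟩

theorem oneAddGL_mem {N : Matrix ι ι F} (hN : N * N = 0) (h : ∀ i j, absF (N i j) ≤ 1) :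
    oneAddGL N hN ∈ integralGL ι F := by
  refine ⟨fun i j => ?_, fun i j => ?_⟩
  · exact absF_add_le (absF_one_apply_le i j) (h i j)
  · exact absF_sub_le (absF_one_apply_le i j) (h i j)

variable {m : ℕ} {b : ι ≃ Fin m}

theorem absF_diag_eq_one {p : GL ι F} (hp : p ∈ borelGL F b) (hk : p ∈ integralGL ι F) (i : ι) :
    absF (p.val i i) = 1 := by
  have h := congrArg absF (borelGL_diag_mul_inv hp i)
  rw [absF_mul, absF_one] at h
  have h1 := hk.1 i i
  have h2 := hk.2 i i
  nlinarith [absF_nonneg (p.val i i), absF_nonneg ((p⁻¹).val i i)]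

/-- Column reduction from the bottom row upwards; `s` counts the rows already treated. Taking an
entry of largest absolute value as pivot keeps all quotients, hence the column operations, integral.
-/
theorem exists_clear_rows (b : ι ≃ Fin m) (g : GL ι F) (s : ℕ) (hs : s ≤ m) :
    ∃ k ∈ integralGL ι F, ∀ i, m - s ≤ (b i : ℕ) → ∀ j, b j < b i → (g * k).val i j = 0 := by
  induction s with
  | zero => exact ⟨1, one_mem _, fun i hi => absurd (b i).2 (by omega)⟩
  | succ s ih =>
    obtain ⟨k, hk, hM⟩ := ih (by omega)
    let i : ι := b.symm ⟨m - (s + 1), by omega⟩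
    have hi : (b i : ℕ) = m - (s + 1) := by simp [i]
    obtain ⟨j₀, hj₀, hmax⟩ := Finset.exists_max_image (Finset.univ.filter fun j => b j ≤ b i)
      (fun j => absF ((g * k).val i j)) ⟨i, by simp⟩
    simp only [Finset.mem_filter, Finset.mem_univ, true_and] at hj₀ hmax
    let σ := Equiv.swap i j₀
    let M' : GL ι F := g * k * permGL F σ
    have hM' : ∀ a c, M'.val a c = (g * k).val a (σ c) := by
      intro a c
      change ((g * k).val * (permGL F σ).val) a c = _
      rw [mul_permGL_apply, Equiv.swap_inv]
    have hσ : ∀ c, b c ≤ b i → b (σ c) ≤ b i := by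
      intro c hc
      by_cases h1 : c = i
      · rw [h1]; simpa [σ] using hj₀
      by_cases h2 : c = j₀
      · rw [h2]; simp [σ]
      · rwa [Equiv.swap_apply_of_ne_of_ne h1 h2]
    -- `1 + N` subtracts multiples of column `i` so as to clear row `i` to the left of the diagonal.
    -- `N` lives in row `i` and vanishes at column `i`, so its square is 0.
    let N : Matrix ι ι F := Matrix.of fun a c =>
      if a = i ∧ b c < b i then -(M'.val i c / M'.val i i) else 0
    have hN : N * N = 0 := by
      ext a c
      rw [Matrix.mul_apply, Matrix.zero_apply]
      refine Finset.sum_eq_zero fun d _ => ?_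
      by_cases hd : d = i
      · simp [N, hd]
      · simp [N, hd]
    have hle : ∀ c, b c ≤ b i → absF (M'.val i c) ≤ absF (M'.val i i) := by
      intro c hc
      rw [hM', hM']
      have : σ i = j₀ := by simp [σ]
      rw [this]
      exact hmax _ (hσ c hc)
    have hNle : ∀ a c, absF (N a c) ≤ 1 := by
      intro a c
      simp only [N, Matrix.of_apply]
      split_ifs with h
      · rw [absF_neg, absF_div]
        exact div_le_one_of_le₀ (hle c h.2.le) (absF_nonneg _)
      · simp
    refine ⟨k * permGL F σ * oneAddGL N hN,
      mul_mem (mul_mem hk (permGL_mem σ)) (oneAddGL_mem hN hNle), fun a ha c hc => ?_⟩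
    have hval : (g * (k * permGL F σ * oneAddGL N hN)).val a c =
        M'.val a c + M'.val a i * N i c := by
      have : g * (k * permGL F σ * oneAddGL N hN) = M' * oneAddGL N hN := by
        simp only [M', mul_assoc]
      rw [this]
      change (M'.val * (1 + N)) a c = _
      rw [mul_add, mul_one, Matrix.add_apply, Matrix.mul_apply, Finset.sum_eq_single i]
      · intro d _ hd
        simp [N, hd]
      · simp
    rw [hval]
    by_cases hai : a = i
    · subst hai
      simp only [N, Matrix.of_apply, true_and, hc, if_true]
      -- A zero pivot is a largest entry up to the diagonal, so the entries to be cleared are zero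
      -- already.
      by_cases h0 : M'.val i i = 0
      · have := hle c hc.le
        rw [h0, absF_zero] at this
        rw [h0, absF_eq_zero.1 (le_antisymm this (absF_nonneg _))]
        simp
      · field_simp
        simp
    -- Lower rows stay cleared: the swap only moves columns up to `b i`, and in those columns these
    -- rows are zero.
    · have hai' : b i < b a := by
        rw [Fin.lt_def]
        have : (b a : ℕ) ≠ b i := fun h => hai (b.injective (Fin.ext h))
        omega
      have ha' : m - s ≤ (b a : ℕ) := by rw [Fin.lt_def] at hai'; omega
      rw [hM', hM', hM a ha' _ ((hσ i le_rfl).trans_lt hai'), zero_mul, add_zero]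
      by_cases hci : b c ≤ b i
      · exact hM a ha' _ ((hσ c hci).trans_lt hai')
      · have h1 : c ≠ i := by rintro rfl; exact hci le_rfl
        have h2 : c ≠ j₀ := by rintro rfl; exact hci hj₀
        rw [Equiv.swap_apply_of_ne_of_ne h1 h2]
        exact hM a ha' c hc

variable (b) in
theorem exists_iwasawa (g : GL ι F) :
    ∃ p ∈ borelGL F b, ∃ k ∈ integralGL ι F, g = p * k := by
  obtain ⟨k, hk, h⟩ := exists_clear_rows b g m le_rfl
  refine ⟨g * k, fun i j hij => h i (by simp) j hij, k⁻¹, inv_mem hk, by simp⟩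

variable (b) in
/-- The absolute values of the diagonal entries of `p`, where `g = p * k` is an
Iwasawa decomposition. -/
noncomputable def height (g : GL ι F) (i : ι) : ℝ := absF ((exists_iwasawa b g).choose.val i i)

/-- Two Iwasawa decompositions differ by a triangular matrix in GL(𝔬), whose diagonal entries are
units. So the chosen decomposition in `height` does not matter. -/
theorem height_mul {p k : GL ι F} (hp : p ∈ borelGL F b) (hk : k ∈ integralGL ι F) (i : ι) :
    height b (p * k) i = absF (p.val i i) := by
  obtain ⟨hp', k', hk', h⟩ := (exists_iwasawa b (p * k)).choose_spec
  unfold height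
  set p' := (exists_iwasawa b (p * k)).choose
  have h1 : p⁻¹ * p' = k * k'⁻¹ := by
    rw [eq_mul_inv_iff_mul_eq, mul_assoc, ← h, inv_mul_cancel_left]
  have h2 := absF_diag_eq_one (mul_mem (inv_mem hp) hp')
    (h1 ▸ mul_mem hk (inv_mem hk')) i
  have h3 : p'.val i i = p.val i i * (p⁻¹ * p').val i i := by
    rw [← borelGL_mul_diag hp (mul_mem (inv_mem hp) hp'), mul_inv_cancel_left]
  rw [h3, absF_mul, h2, mul_one]

theorem height_borel {p : GL ι F} (hp : p ∈ borelGL F b) (i : ι) :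
    height b p i = absF (p.val i i) := by
  simpa using height_mul hp (one_mem (integralGL ι F)) i

theorem height_integral {k : GL ι F} (hk : k ∈ integralGL ι F) (i : ι) : height b k i = 1 := by
  simpa using height_mul (one_mem (borelGL F b)) hk i

theorem height_borel_mul {p : GL ι F} (hp : p ∈ borelGL F b) (g : GL ι F) (i : ι) :
    height b (p * g) i = absF (p.val i i) * height b g i := by
  obtain ⟨q, hq, k, hk, rfl⟩ := exists_iwasawa b g
  rw [← mul_assoc, height_mul (mul_mem hp hq) hk, height_mul hq hk, borelGL_mul_diag hp hq,
    absF_mul]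

theorem height_mul_integral (g : GL ι F) {k : GL ι F} (hk : k ∈ integralGL ι F) (i : ι) :
    height b (g * k) i = height b g i := by
  obtain ⟨q, hq, k', hk', rfl⟩ := exists_iwasawa b g
  rw [mul_assoc, height_mul hq (mul_mem hk' hk), height_mul hq hk']

theorem height_pos (g : GL ι F) (i : ι) : 0 < height b g i := by
  obtain ⟨q, hq, k, hk, rfl⟩ := exists_iwasawa b g
  rw [height_mul hq hk]
  exact absF_pos (borelGL_diag_ne_zero hq i)

variable (ι F) in
theorem isOpen_integralGL : IsOpen (integralGL ι F : Set (GL ι F)) := by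
  have h : (integralGL ι F : Set (GL ι F)) = (⋂ i, ⋂ j, {k | absF (k.val i j) ≤ 1}) ∩
      ⋂ i, ⋂ j, {k | absF ((k⁻¹).val i j) ≤ 1} := by
    ext k
    simp [integralGL]
  rw [h]
  refine IsOpen.inter ?_ ?_ <;>
  · refine isOpen_iInter_of_finite fun i => isOpen_iInter_of_finite fun j => ?_
    refine (isOpen_absF_le one_pos).preimage ?_
    fun_prop

-- Units embed as a closed subset of pairs (k, k⁻¹), and both members of the pair range over a
-- compact box.
variable (ι F) in
theorem isCompact_integralGL : IsCompact (integralGL ι F : Set (GL ι F)) := by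
  have hB : IsCompact {A : Matrix ι ι F | ∀ i j, absF (A i j) ≤ 1} := by
    have h : IsCompact (Set.univ.pi fun _ : ι => Set.univ.pi fun _ : ι => {x : F | absF x ≤ 1}) :=
      isCompact_univ_pi fun i => isCompact_univ_pi fun j => isCompact_absF_le (F := F) 1
    have h2 : {A : Matrix ι ι F | ∀ i j, absF (A i j) ≤ 1} =
        (Set.univ.pi fun _ : ι => Set.univ.pi fun _ : ι => {x : F | absF x ≤ 1}) := by
      ext A
      exact ⟨fun h i _ j _ => h i j, fun h i j => h i trivial j trivial⟩
    rw [h2]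
    exact h
  have hc := (Units.isClosedEmbedding_embedProduct (α := Matrix ι ι F)).isCompact_preimage
    (hB.prod (hB.image MulOpposite.continuous_op))
  refine hc.of_isClosed_subset ((integralGL ι F).isClosed_of_isOpen (isOpen_integralGL ι F)) fun k hk => ?_
  exact ⟨hk.1, (k⁻¹).val, hk.2, rfl⟩

theorem isLocallyConstant_height (i : ι) :
    IsLocallyConstant fun g : GL ι F => height b g i := by
  rw [IsLocallyConstant.iff_eventually_eq]
  intro g
  have hU : (fun x => g⁻¹ * x) ⁻¹' (integralGL ι F : Set (GL ι F)) ∈ nhds g :=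
    ((isOpen_integralGL ι F).preimage (continuous_const_mul g⁻¹)).mem_nhds
      (by simp [one_mem])
  filter_upwards [hU] with x hx
  rw [show x = g * (g⁻¹ * x) by simp, height_mul_integral g hx]

end Iwasawa

/-! ### Spherical functions and the rank-one integral -/

section Spherical

variable {ι : Type*} [Fintype ι] [DecidableEq ι] {F : Type*} [Field F] [ValuativeRel F]
  [TopologicalSpace F] [IsNonarchimedeanLocalField F] {m : ℕ} (b : ι ≃ Fin m)

/-- The spherical function `p * k ↦ ∏ |p i i| ^ (lam i - b i)`. -/
noncomputable def spherical (lam : ι → ℝ) (g : GL ι F) : ℝ :=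
  ∏ i, height b g i ^ (lam i - ((b i : ℕ) : ℝ))

variable {b}

theorem spherical_pos (lam : ι → ℝ) (g : GL ι F) : 0 < spherical b lam g :=
  Finset.prod_pos fun i _ => Real.rpow_pos_of_pos (height_pos g i) _

theorem spherical_mul_integral (lam : ι → ℝ) (g : GL ι F) {k : GL ι F}
    (hk : k ∈ integralGL ι F) : spherical b lam (g * k) = spherical b lam g := by
  simp only [spherical, height_mul_integral g hk]

theorem isLocallyConstant_spherical (lam : ι → ℝ) :
    IsLocallyConstant (spherical b lam : GL ι F → ℝ) := by
  rw [IsLocallyConstant.iff_eventually_eq]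
  intro g
  have : ∀ᶠ x in nhds g, ∀ i, height b x i = height b g i :=
    Filter.eventually_all.2 fun i => (isLocallyConstant_height i).eventually_eq g
  filter_upwards [this] with x hx
  simp only [spherical, hx]

theorem transGL_mem {i j : ι} (hij : i ≠ j) {x : F} (hx : absF x ≤ 1) :
    transGL hij x ∈ integralGL ι F := by
  refine oneAddGL_mem _ fun r s => ?_
  rw [Matrix.single_apply]
  split_ifs <;> simp [hx]

theorem height_of_mul {g k : GL ι F} (hp : g * k ∈ borelGL F b) (hk : k ∈ integralGL ι F)
    (i : ι) : height b g i = absF ((g * k).val i i) := by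
  rw [← height_mul_integral g hk, height_borel hp]

variable {i j : ι} (hij : i ≠ j) (hadj : (b j : ℕ) = b i + 1)

include hadj

/-- In rows and columns `i`, `j` the matrix is (0 d; a y) with y = p i j + x d. Its bottom row (a,
y) can be reduced by integral column operations to its entry of larger absolute value, which is the
height at `j`; the determinant gives the height at `i`. Adjacency of `i` and `j` keeps all other
positions triangular. -/
theorem height_transGL_swap {p : GL ι F} (hp : p ∈ borelGL F b) (x : F) :
    height b (transGL hij x * (permGL F (Equiv.swap i j) * p)) i =
      absF (p.val i i) * absF (p.val j j) /
        max (absF (p.val i i)) (absF (p.val i j + x * p.val j j)) ∧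
    height b (transGL hij x * (permGL F (Equiv.swap i j) * p)) j =
      max (absF (p.val i i)) (absF (p.val i j + x * p.val j j)) ∧
    ∀ r, r ≠ i → r ≠ j → height b (transGL hij x * (permGL F (Equiv.swap i j) * p)) r =
      absF (p.val r r) := by
  set A := transGL hij x * (permGL F (Equiv.swap i j) * p) with hA
  have hpT : ∀ r s, (b s : ℕ) < b r → p.val r s = 0 := fun r s h => hp (Fin.lt_def.2 h)
  have hbne : ∀ r s, r ≠ s → (b r : ℕ) ≠ b s := fun r s h h' => h (b.injective (Fin.ext h'))
  have hAval : ∀ r s, A.val r s = p.val (Equiv.swap i j r) s +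
      if r = j then x * p.val j s else 0 := by
    intro r s
    change ((transGL hij x).val * ((permGL F (Equiv.swap i j)).val * p.val)) r s = _
    rw [transGL_mul_apply, permGL_mul_apply, permGL_mul_apply, Equiv.swap_apply_left]
  have hAi : ∀ s, A.val i s = p.val j s := by intro s; rw [hAval]; simp [hij]
  have hAj : ∀ s, A.val j s = p.val i s + x * p.val j s := by intro s; rw [hAval]; simp
  have hAr : ∀ r s, r ≠ i → r ≠ j → A.val r s = p.val r s := by
    intro r s h1 h2; rw [hAval, Equiv.swap_apply_of_ne_of_ne h1 h2]; simp [h2]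
  have ha : p.val i i ≠ 0 := borelGL_diag_ne_zero hp i
  have ha' := absF_pos ha
  have hji : p.val j i = 0 := hpT j i (by omega)
  set a := p.val i i
  set d := p.val j j
  set y := p.val i j + x * d with hy
  have hzero : ∀ r s, (b s : ℕ) < b r → s ≠ i → A.val r s = 0 := by
    intro r s hrs hs
    have := hbne s i hs
    by_cases hri : r = i
    · subst hri; rw [hAi, hpT _ _ (by omega)]
    by_cases hrj : r = j
    · subst hrj; rw [hAj, hpT _ _ (by omega), hpT _ _ (by omega)]; simp
    · rw [hAr r s hri hrj, hpT _ _ hrs]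
  have hAij : A.val i j = d := hAi j
  have hAii : A.val i i = 0 := by rw [hAi, hji]
  have hAji : A.val j i = a := by rw [hAj, hji]; simp [a]
  have hAjj : A.val j j = y := hAj j
  have hfar : ∀ r, (b i : ℕ) < b r → r ≠ j → A.val r i = 0 ∧ A.val r j = 0 := by
    intro r hr hrj
    have h1 := hbne r j hrj
    have hri : r ≠ i := by rintro rfl; omega
    exact ⟨by rw [hAr r i hri hrj, hpT _ _ hr], by rw [hAr r j hri hrj, hpT _ _ (by omega)]⟩
  -- If |a| ≤ |y|, the pivot y is already on the diagonal and a is cleared by column `j`; otherwise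
  -- columns `i` and `j` are swapped before clearing.
  by_cases hay : absF a ≤ absF y
  · have hy0 : y ≠ 0 := by
      intro h; rw [h, absF_zero] at hay; linarith
    have hc : absF (-(a / y)) ≤ 1 := by
      rw [absF_neg, absF_div]; exact div_le_one_of_le₀ hay (absF_nonneg _)
    have hk := transGL_mem hij hc
    have hQval : ∀ r s, (A * transGL hij (-(a / y))).val r s =
        A.val r s + if s = i then A.val r j * -(a / y) else 0 := fun r s =>
      mul_transGL_apply _ hij _ r s
    have hQ : A * transGL hij (-(a / y)) ∈ borelGL F b := by
      intro r s hrs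
      replace hrs : (b s : ℕ) < b r := hrs
      rw [hQval]
      by_cases hs : s = i
      · subst hs
        rw [if_pos rfl]
        by_cases hr : r = j
        · subst hr; rw [hAji, hAjj]; field_simp; ring
        · rw [(hfar r hrs hr).1, (hfar r hrs hr).2]; simp
      · rw [if_neg hs, hzero r s hrs hs, add_zero]
    rw [max_eq_right hay]
    refine ⟨?_, ?_, fun r hri hrj => ?_⟩
    · rw [height_of_mul hQ hk, hQval, if_pos rfl, hAii, hAij, zero_add, absF_mul, absF_neg,
        absF_div]
      ring
    · rw [height_of_mul hQ hk, hQval, if_neg hij.symm, hAjj, add_zero]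
    · rw [height_of_mul hQ hk, hQval, if_neg hri, hAr r r hri hrj, add_zero]
  · push Not at hay
    have hc : absF (-(y / a)) ≤ 1 := by
      rw [absF_neg, absF_div]; exact div_le_one_of_le₀ hay.le (absF_nonneg _)
    have hk := mul_mem (permGL_mem (F := F) (Equiv.swap i j)) (transGL_mem hij hc)
    have hQval : ∀ r s, (A * (permGL F (Equiv.swap i j) * transGL hij (-(y / a)))).val r s =
        A.val r (Equiv.swap i j s) + if s = i then A.val r i * -(y / a) else 0 := by
      intro r s
      rw [← mul_assoc]
      change ((A.val * (permGL F (Equiv.swap i j)).val) * (transGL hij (-(y / a))).val) r s = _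
      rw [mul_transGL_apply, mul_permGL_apply, mul_permGL_apply, Equiv.swap_inv,
        Equiv.swap_apply_right]
    have hQ : A * (permGL F (Equiv.swap i j) * transGL hij (-(y / a))) ∈ borelGL F b := by
      intro r s hrs
      replace hrs : (b s : ℕ) < b r := hrs
      rw [hQval]
      by_cases hs : s = i
      · subst hs
        rw [if_pos rfl, Equiv.swap_apply_left]
        by_cases hr : r = j
        · subst hr; rw [hAji, hAjj]; field_simp; ring
        · rw [(hfar r hrs hr).1, (hfar r hrs hr).2]; simp
      rw [if_neg hs, add_zero]
      by_cases hs' : s = j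
      · subst hs'
        rw [Equiv.swap_apply_right]
        exact (hfar r (by omega) (by rintro rfl; omega)).1
      · rw [Equiv.swap_apply_of_ne_of_ne hs hs', hzero r s hrs hs]
    rw [max_eq_left hay.le]
    refine ⟨?_, ?_, fun r hri hrj => ?_⟩
    · rw [height_of_mul hQ hk, hQval, if_pos rfl, Equiv.swap_apply_left, hAii, hAij, zero_mul,
        add_zero]
      field_simp
    · rw [height_of_mul hQ hk, hQval, if_neg hij.symm, Equiv.swap_apply_right, hAji, add_zero]
    · rw [height_of_mul hQ hk, hQval, if_neg hri, Equiv.swap_apply_of_ne_of_ne hri hrj,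
        hAr r r hri hrj, add_zero]

variable [MeasurableSpace F] [BorelSpace F] (μ : Measure F) [μ.IsAddHaarMeasure]

/-- Rank-one Gindikin–Karpelevich formula. With swap·g = p k, the variable enters only through
max(1, |(d/a)x + c|)^(-(1+t)), where t = lam i - lam j. The affine substitution leaves a constant
integral and a Jacobian |a/d|. The shift by `b i` in `spherical` is what makes this Jacobian turn
the remaining powers into a spherical function with `lam` permuted. -/
theorem lintegral_spherical_transGL (lam : ι → ℝ) (g : GL ι F) :
    ∫⁻ x, ENNReal.ofReal (spherical b lam (transGL hij x * g)) ∂μ =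
      (∫⁻ y : F, ENNReal.ofReal (max 1 (absF y) ^ (-(1 + (lam i - lam j)))) ∂μ) *
        ENNReal.ofReal (spherical b (lam ∘ Equiv.swap i j) (permGL F (Equiv.swap i j) * g)) := by
  have hsq : permGL F (Equiv.swap i j) * permGL F (Equiv.swap i j) = 1 := by
    ext1
    change (Equiv.swap i j).permMatrix F * (Equiv.swap i j).permMatrix F = 1
    rw [← Matrix.permMatrix_mul, Equiv.swap_mul_self, Matrix.permMatrix_one]
  obtain ⟨p, hp, k, hk, hg⟩ := exists_iwasawa b (permGL F (Equiv.swap i j) * g)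
  have hg' : g = permGL F (Equiv.swap i j) * p * k := by
    rw [mul_assoc, ← hg, ← mul_assoc, hsq, one_mul]
  rw [hg, spherical_mul_integral _ _ hk, hg']
  set R : ℝ := ∏ r ∈ (Finset.univ.erase i).erase j, absF (p.val r r) ^ (lam r - ((b r : ℕ) : ℝ))
    with hR
  have hR0 : 0 ≤ R := Finset.prod_nonneg fun r _ => Real.rpow_nonneg (absF_nonneg _) _
  have hsplit : ∀ f : ι → ℝ, ∏ r, f r = f i * (f j * ∏ r ∈ (Finset.univ.erase i).erase j, f r) := by
    intro f
    rw [Finset.mul_prod_erase (Finset.univ.erase i) f (by simp [hij.symm]),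
      Finset.mul_prod_erase _ _ (Finset.mem_univ i)]
  have ha0 : p.val i i ≠ 0 := borelGL_diag_ne_zero hp i
  have hd0 : p.val j j ≠ 0 := borelGL_diag_ne_zero hp j
  have ha := absF_pos ha0
  have hd := absF_pos hd0
  set a := p.val i i
  set d := p.val j j
  set t := lam i - lam j with ht
  set e : ℝ := lam i - ((b i : ℕ) : ℝ) with he
  -- Here `b j = b i + 1` enters: the two exponents differ by 1 + t rather than by t.
  have hej : lam j - ((b j : ℕ) : ℝ) = e - t - 1 := by
    rw [hadj, he, ht]; push_cast; ring
  have hint : ∀ x, spherical b lam (transGL hij x * (permGL F (Equiv.swap i j) * p * k)) =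
      R * (absF a * absF d) ^ e * absF a ^ (-(1 + t)) *
        max 1 (absF (d / a * x + p.val i j / a)) ^ (-(1 + t)) := by
    intro x
    obtain ⟨h1, h2, h3⟩ := height_transGL_swap hij hadj hp x
    rw [← mul_assoc, spherical_mul_integral _ _ hk, ← mul_assoc] at *
    unfold spherical
    rw [hsplit, h1, h2, Finset.prod_congr rfl (g := fun r => absF (p.val r r) ^
      (lam r - ((b r : ℕ) : ℝ))), ← hR]
    · have hM : max (absF a) (absF (p.val i j + x * d)) =
          absF a * max 1 (absF (d / a * x + p.val i j / a)) := by
        rw [mul_max_of_nonneg _ _ ha.le, mul_one, ← absF_mul]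
        congr 2
        field_simp
        ring
      rw [hM, hej, ← he]
      have hm : 0 < max 1 (absF (d / a * x + p.val i j / a)) := by positivity
      set M := max 1 (absF (d / a * x + p.val i j / a))
      rw [Real.div_rpow (by positivity) (by positivity)]
      have h4 : (absF a * M) ^ (e - t - 1) = (absF a * M) ^ e * (absF a * M) ^ (-(1 + t)) := by
        rw [← Real.rpow_add (by positivity)]; congr 1; ring
      have h5 : (absF a * M) ^ e ≠ 0 := (Real.rpow_pos_of_pos (by positivity) _).ne'
      rw [h4, Real.mul_rpow (z := -(1 + t)) ha.le hm.le]
      field_simp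
      exact mul_comm _ _
    · intro r hr
      simp only [Finset.mem_erase, Finset.mem_univ, and_true] at hr
      rw [h3 r hr.2 hr.1]
  have htarget : spherical b (lam ∘ Equiv.swap i j) p =
      R * (absF a * absF d) ^ e * absF a ^ (-(1 + t)) * (absF a / absF d) := by
    unfold spherical
    rw [hsplit]
    simp only [Function.comp, Equiv.swap_apply_left, Equiv.swap_apply_right, height_borel hp]
    rw [Finset.prod_congr rfl (g := fun r => absF (p.val r r) ^
      (lam r - ((b r : ℕ) : ℝ))), ← hR]
    · have h1 : lam j - ((b i : ℕ) : ℝ) = e + (-(1 + t)) + 1 := by rw [he, ht]; ring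
      have h2 : lam i - ((b j : ℕ) : ℝ) = e - 1 := by rw [hadj, he]; push_cast; ring
      change absF a ^ _ * (absF d ^ _ * R) = _
      rw [h1, h2, Real.rpow_add ha, Real.rpow_add ha, Real.rpow_one, Real.rpow_sub hd,
        Real.rpow_one, Real.mul_rpow ha.le hd.le]
      ring
    · intro r hr
      simp only [Finset.mem_erase, Finset.mem_univ, and_true] at hr
      rw [Equiv.swap_apply_of_ne_of_ne hr.2 hr.1]
  have hC : 0 ≤ R * (absF a * absF d) ^ e * absF a ^ (-(1 + t)) := by positivity
  simp_rw [hint, ENNReal.ofReal_mul hC]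
  rw [lintegral_const_mul' _ _ ENNReal.ofReal_ne_top,
    lintegral_comp_mul_add μ (div_ne_zero hd0 ha0) _
      (fun y => ENNReal.ofReal (max 1 (absF y) ^ (-(1 + t)))), htarget, ENNReal.ofReal_mul hC,
    absF_div, inv_div]
  ring

end Spherical

/-! ### Integrals over lower unipotent matrices, one coordinate at a time -/

section GindikinKarpelevich

variable {ι : Type*} [Fintype ι] [DecidableEq ι] {F : Type*} [Field F] {m : ℕ} (b : ι ≃ Fin m)

/-- The lower triangular unipotent matrix whose nonzero entries below the diagonal are the
`x (q, q')` with `(q, q') ∈ T`. -/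
def lowerMat (T : Finset (ι × ι)) (x : ι × ι → F) : Matrix ι ι F := Matrix.of fun q q' =>
  (1 : Matrix ι ι F) q q' + if (q, q') ∈ T ∧ b q' < b q then x (q, q') else 0

theorem det_lowerMat (T : Finset (ι × ι)) (x : ι × ι → F) : (lowerMat b T x).det = 1 := by
  have h : BlockTriangular ((lowerMat b T x)ᵀ.submatrix b.symm b.symm) id := by
    intro r s hrs
    have h1 : b.symm s ≠ b.symm r := fun h => (ne_of_lt hrs) (b.symm.injective h)
    simp only [Matrix.submatrix_apply, Matrix.transpose_apply, lowerMat, Matrix.of_apply,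
      Matrix.one_apply_ne h1, Equiv.apply_symm_apply]
    rw [if_neg, add_zero]
    exact fun h => absurd h.2 (not_lt.2 hrs.le)
  have h2 := Matrix.det_of_isUpperTriangular h
  rw [Matrix.det_submatrix_equiv_self, Matrix.det_transpose] at h2
  rw [h2]
  exact Finset.prod_eq_one fun r _ => by simp [lowerMat]

/-- `lowerMat` as an element of `GL`. -/
def lowerGL (T : Finset (ι × ι)) (x : ι × ι → F) : GL ι F where
  val := lowerMat b T x
  inv := (lowerMat b T x).adjugate
  val_inv := by rw [Matrix.mul_adjugate, det_lowerMat, one_smul]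
  inv_val := by rw [Matrix.adjugate_mul, det_lowerMat, one_smul]

theorem lowerGL_congr {T : Finset (ι × ι)} {x y : ι × ι → F} (h : ∀ p ∈ T, x p = y p) :
    lowerGL b T x = lowerGL b T y := by
  ext q q'
  change lowerMat b T x q q' = lowerMat b T y q q'
  simp only [lowerMat, Matrix.of_apply]
  congr 1
  split_ifs with h1
  · exact h _ h1.1
  · rfl

theorem continuous_lowerGL [TopologicalSpace F] [IsTopologicalRing F] (T : Finset (ι × ι)) :
    Continuous fun x : ι × ι → F => lowerGL b T x := by
  have h : Continuous fun x : ι × ι → F => lowerMat b T x := by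
    refine continuous_matrix fun q q' => ?_
    simp only [lowerMat, Matrix.of_apply]
    refine continuous_const.add ?_
    split_ifs
    · exact continuous_apply _
    · exact continuous_const
  exact Units.continuous_iff.2 ⟨h, h.matrix_adjugate⟩

/-- The pairs of indices `(q, q')` with `q' < q` such that `q` satisfies `B` and `q'` precedes `q`
in the arrangement `τ`. -/
def pairsBefore (B : ι → Prop) [DecidablePred B] (τ : Equiv.Perm ι) : Finset (ι × ι) :=
  Finset.univ.filter fun p => B p.1 ∧ b p.2 < b p.1 ∧ b (τ.symm p.2) < b (τ.symm p.1)

variable {b}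

theorem mem_pairsBefore {B : ι → Prop} [DecidablePred B] {τ : Equiv.Perm ι} {q q' : ι} :
    (q, q') ∈ pairsBefore b B τ ↔ B q ∧ b q' < b q ∧ b (τ.symm q') < b (τ.symm q) := by
  simp [pairsBefore]

/-- One step of bubble sort. Take the least `q` occurring as first member of a pair, and the last
position before that of `q` carrying a value below `q`; the next position carries a value at least
`q`. Minimality of `q` yields the last clause, which says that row `τ i` of the unipotent matrix is
that of the identity. -/
theorem exists_adjacent_of_nonempty {B : ι → Prop} [DecidablePred B]
    (hB : ∀ q r, B q → b q ≤ b r → B r) {τ : Equiv.Perm ι} (h : (pairsBefore b B τ).Nonempty) :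
    ∃ i j : ι, (b j : ℕ) = b i + 1 ∧ b (τ i) < b (τ j) ∧ B (τ j) ∧
      ∀ q, (τ i, q) ∉ pairsBefore b B τ := by
  obtain ⟨⟨q, q'⟩, hq, hmin⟩ := Finset.exists_min_image _ (fun p => b p.1) h
  simp only [pairsBefore, Finset.mem_filter, Finset.mem_univ, true_and] at hq
  obtain ⟨hBq, hlt, hpos⟩ := hq
  obtain ⟨s, hs, hmax⟩ := Finset.exists_max_image
    (Finset.univ.filter fun s => b s < b (τ.symm q) ∧ b (τ s) < b q) (fun s => b s)
    ⟨τ.symm q', by simp [hpos, hlt]⟩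
  simp only [Finset.mem_filter, Finset.mem_univ, true_and] at hs hmax
  have hlt' : (b s : ℕ) + 1 < m := by
    have h1 := Fin.lt_def.1 hs.1
    have h2 := (b (τ.symm q)).2
    omega
  let j := b.symm ⟨b s + 1, hlt'⟩
  have hj : (b j : ℕ) = b s + 1 := by simp [j]
  have hqj : b q ≤ b (τ j) := by
    by_cases hjq : b j < b (τ.symm q)
    · by_contra! h
      have := Fin.le_def.1 (hmax j ⟨hjq, h⟩)
      omega
    · have : b j = b (τ.symm q) := by
        have h1 := Fin.lt_def.1 hs.1
        rw [Fin.lt_def] at hjq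
        exact Fin.ext (by omega)
      rw [b.injective this]; simp
  refine ⟨s, j, hj, hs.2.trans_le hqj, hB q _ hBq hqj, fun r hr => ?_⟩
  exact absurd (hmin _ hr) (not_le.2 hs.2)

/-- Swapping neighbouring positions changes the relative order of a single pair of values, so at
most this one pair can be lost. -/
theorem pairsBefore_mul_swap {B : ι → Prop} [DecidablePred B] {τ : Equiv.Perm ι} {i j : ι}
    (hadj : (b j : ℕ) = b i + 1) (hlt : b (τ i) < b (τ j)) :
    pairsBefore b B (τ * Equiv.swap i j) = (pairsBefore b B τ).erase (τ j, τ i) := by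
  ext ⟨q, q'⟩
  obtain ⟨s, rfl⟩ := τ.surjective q
  obtain ⟨s', rfl⟩ := τ.surjective q'
  have hsymm : ∀ r, (τ * Equiv.swap i j).symm (τ r) = Equiv.swap i j r := by
    intro r
    rw [Equiv.symm_apply_eq, Equiv.Perm.mul_apply, Equiv.swap_apply_self]
  rw [Finset.mem_erase, mem_pairsBefore, mem_pairsBefore, hsymm, hsymm, Equiv.symm_apply_apply,
    Equiv.symm_apply_apply, ne_eq, Prod.mk.injEq, τ.injective.eq_iff, τ.injective.eq_iff]
  have hbne : ∀ r s, r ≠ s → (b r : ℕ) ≠ b s := fun r s h h' => h (b.injective (Fin.ext h'))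
  by_cases h1 : s = i
  · subst h1
    have hs : s ≠ j := by rintro rfl; omega
    by_cases h2 : s' = j
    · subst h2
      simp only [Equiv.swap_apply_left, Equiv.swap_apply_right, hs, Fin.lt_def] at *
      omega
    by_cases h3 : s' = s
    · subst h3; simp
    · rw [Equiv.swap_apply_of_ne_of_ne h3 h2, Equiv.swap_apply_left]
      have := hbne _ _ h2
      have := hbne _ _ h3
      simp only [hs, Fin.lt_def] at *
      simp
      omega
  by_cases h2 : s = j
  · subst h2
    by_cases h3 : s' = i
    · subst h3
      simp only [Equiv.swap_apply_left, Equiv.swap_apply_right, Fin.lt_def] at *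
      simp
      omega
    by_cases h4 : s' = s
    · subst h4; simp
    · rw [Equiv.swap_apply_of_ne_of_ne h3 h4, Equiv.swap_apply_right]
      have := hbne _ _ h3
      have := hbne _ _ h4
      simp only [h3, Fin.lt_def] at *
      simp
      omega
  · rw [Equiv.swap_apply_of_ne_of_ne h1 h2]
    have ha := hbne _ _ h1
    have hb := hbne _ _ h2
    by_cases h3 : s' = i
    · subst h3
      rw [Equiv.swap_apply_left]
      simp only [h2, Fin.lt_def]
      simp
      omega
    by_cases h4 : s' = j
    · subst h4
      rw [Equiv.swap_apply_right]
      simp only [h2, Fin.lt_def]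
      simp
      omega
    · rw [Equiv.swap_apply_of_ne_of_ne h3 h4]
      simp [h2]

/-- Row `τ i` of the unipotent matrix is trivial, so adding a multiple of it to row `τ j` only fills
in the entry at `(τ j, τ i)`, without cross terms. -/
theorem permGL_mul_lowerGL {B : ι → Prop} [DecidablePred B] {τ : Equiv.Perm ι} {i j : ι}
    (hij : i ≠ j) (hadj : (b j : ℕ) = b i + 1) (hlt : b (τ i) < b (τ j)) (hBj : B (τ j))
    (hi : ∀ q, (τ i, q) ∉ pairsBefore b B τ) (x : ι × ι → F) :
    permGL F τ * lowerGL b (pairsBefore b B τ) x = transGL hij (x (τ j, τ i)) *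
      (permGL F τ * lowerGL b (pairsBefore b B (τ * Equiv.swap i j)) x) := by
  rw [pairsBefore_mul_swap hadj hlt]
  ext r s
  change ((permGL F τ).val * lowerMat b _ x) r s = ((transGL hij (x (τ j, τ i))).val *
    ((permGL F τ).val * lowerMat b _ x)) r s
  rw [transGL_mul_apply, permGL_mul_apply, permGL_mul_apply, permGL_mul_apply]
  have hmem : (τ j, τ i) ∈ pairsBefore b B τ := by
    simp only [pairsBefore, Finset.mem_filter, Finset.mem_univ, Equiv.symm_apply_apply, true_and]
    exact ⟨hBj, hlt, by rw [Fin.lt_def]; omega⟩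
  simp only [lowerMat, Matrix.of_apply, Finset.mem_erase, ne_eq, Prod.mk.injEq,
    EmbeddingLike.apply_eq_iff_eq, hi, and_false, false_and, if_false, add_zero]
  by_cases hr : r = j
  · subst hr
    by_cases hs : s = τ i
    · subst hs
      simp [hmem, hlt]
    · simp [hs, Ne.symm hs]
  · simp [hr]

variable [ValuativeRel F] [TopologicalSpace F] [IsNonarchimedeanLocalField F]
  [MeasurableSpace F] [BorelSpace F] (μ : Measure F) [μ.IsAddHaarMeasure]

theorem measurable_spherical_lowerGL (lam : ι → ℝ) (g : GL ι F) (T : Finset (ι × ι)) :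
    Measurable fun x : ι × ι → F => ENNReal.ofReal (spherical b lam (g * lowerGL b T x)) := by
  have h : Continuous fun x : ι × ι → F => spherical b lam (g * lowerGL b T x) :=
    (isLocallyConstant_spherical lam).continuous.comp
      (continuous_const.mul (continuous_lowerGL b T))
  exact h.measurable.ennreal_ofReal

/-- The integral of a strictly dominant spherical function over the lower triangular unipotent
matrices is finite. -/
theorem lmarginal_spherical_lowerGL_lt_top {B : ι → Prop} [DecidablePred B]
    (hB : ∀ q r, B q → b q ≤ b r → B r) {lam : ι → ℝ}
    (hlam : ∀ i j, B j → b i < b j → lam j < lam i) (τ : Equiv.Perm ι) (x : ι × ι → F) :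
    (∫⋯∫⁻_pairsBefore b B τ, fun x => ENNReal.ofReal (spherical b (lam ∘ τ)
      (permGL F τ * lowerGL b (pairsBefore b B τ) x)) ∂fun _ => μ) x < ∞ := by
  induction h : (pairsBefore b B τ).card generalizing τ x with
  | zero =>
    rw [Finset.card_eq_zero] at h
    rw [h, lmarginal_empty]
    exact ENNReal.ofReal_lt_top
  | succ k ih =>
    obtain ⟨i, j, hadj, hlt, hBj, hi⟩ := exists_adjacent_of_nonempty hB
      (Finset.card_pos.1 (by rw [h]; exact Nat.succ_pos k))
    have hij : i ≠ j := by rintro rfl; omega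
    have hmem : (τ j, τ i) ∈ pairsBefore b B τ := by
      simp only [pairsBefore, Finset.mem_filter, Finset.mem_univ, Equiv.symm_apply_apply, true_and]
      exact ⟨hBj, hlt, by rw [Fin.lt_def]; omega⟩
    have hswap := pairsBefore_mul_swap (B := B) hadj hlt
    have hcard : (pairsBefore b B (τ * Equiv.swap i j)).card = k := by
      rw [hswap, Finset.card_erase_of_mem hmem, h]; rfl
    have ih' := ih (τ * Equiv.swap i j) x hcard
    -- Fubini with the coordinate `(τ j, τ i)` innermost. The rank-one formula turns the inner
    -- integral into the constant `C` times the integrand for `τ * swap i j`, which has one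
    -- coordinate fewer.
    rw [lmarginal_erase' _ (measurable_spherical_lowerGL _ _ _) hmem, ← hswap]
    set C : ℝ≥0∞ := ∫⁻ y : F, ENNReal.ofReal (max 1 (absF y) ^
      (-(1 + ((lam ∘ τ) i - (lam ∘ τ) j)))) ∂μ with hC
    have hCt : C < ∞ :=
      lintegral_max_one_absF_rpow_lt_top μ (sub_pos.2 (hlam _ _ hBj hlt))
    have hstep : ∀ x : ι × ι → F, ∫⁻ y, ENNReal.ofReal (spherical b (lam ∘ τ)
        (permGL F τ * lowerGL b (pairsBefore b B τ) (Function.update x (τ j, τ i) y))) ∂μ =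
        C * ENNReal.ofReal (spherical b (lam ∘ (τ * Equiv.swap i j))
          (permGL F (τ * Equiv.swap i j) *
            lowerGL b (pairsBefore b B (τ * Equiv.swap i j)) x)) := by
      intro x
      have h1 := lintegral_spherical_transGL hij hadj μ (lam ∘ τ)
        (permGL F τ * lowerGL b (pairsBefore b B (τ * Equiv.swap i j)) x)
      rw [← mul_assoc, permGL_mul_permGL, ← hC] at h1
      rw [Equiv.Perm.coe_mul, ← Function.comp_assoc, ← h1]
      refine lintegral_congr fun y => ?_
      rw [permGL_mul_lowerGL hij hadj hlt hBj hi, Function.update_self]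
      rw [lowerGL_congr b (y := x) fun p hp => ?_]
      rw [Function.update_of_ne]
      rintro rfl
      rw [hswap] at hp
      exact Finset.notMem_erase _ _ hp
    simp_rw [hstep]
    unfold lmarginal at ih' ⊢
    rw [lintegral_const_mul']
    · exact ENNReal.mul_lt_top hCt ih'
    · exact hCt.ne

end GindikinKarpelevich

/-! ### Quotient measures constructed from weights -/

section QuotientMeasureTheory

variable {A : Type*} [Group A] [MeasurableSpace A] {Γ : Subgroup A}

/-- The projection onto the space of right cosets. -/
def cosetMk (Γ : Subgroup A) (a : A) : Quotient (QuotientGroup.rightRel Γ) := Quotient.mk _ a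

theorem measurable_cosetMk : Measurable (cosetMk Γ) := fun _ h => h

theorem cosetMk_mul_left (t : Γ) (a : A) : cosetMk Γ ((t : A) * a) = cosetMk Γ a :=
  Quotient.sound (QuotientGroup.rightRel_apply.2 (by simp))

theorem exists_out_cosetMk (Γ : Subgroup A) (a : A) :
    ∃ t : Γ, (cosetMk Γ a).out = (t : A) * a := by
  have h : cosetMk Γ (cosetMk Γ a).out = cosetMk Γ a := Quotient.out_eq _
  have h2 := QuotientGroup.rightRel_apply.1 (Quotient.exact h.symm)
  exact ⟨⟨_, h2⟩, by simp⟩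

theorem cosetMk_out (q : Quotient (QuotientGroup.rightRel Γ)) : cosetMk Γ q.out = q :=
  Quotient.out_eq q

variable {da : Measure A} {dt : Measure Γ}

theorem lintegral_out_cosetMk [MeasurableMul Γ] [dt.IsMulRightInvariant] (f : A → ℝ≥0∞) (a : A) :
    ∫⁻ t : Γ, f ((t : A) * (cosetMk Γ a).out) ∂dt = ∫⁻ t : Γ, f ((t : A) * a) ∂dt := by
  obtain ⟨s, hs⟩ := exists_out_cosetMk Γ a
  rw [hs, ← lintegral_mul_right_eq_self (fun t : Γ => f ((t : A) * a)) s]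
  simp [mul_assoc]

/-- A function `w` on the group whose integral along each right coset is `1`. -/
structure IsWeight (dt : Measure Γ) (w : A → ℝ≥0∞) : Prop where
  measurable : Measurable w
  lintegral_eq_one : ∀ a, ∫⁻ t : Γ, w ((t : A) * a) ∂dt = 1

variable {w : A → ℝ≥0∞}

/-- Test the defining identity on `w` times the indicator of the preimage of a set: the inner
integral collapses to the indicator of that set. Hence the quotient measure is unique and explicit.
-/
theorem IsQuotientMeasure.eq_map (hw : IsWeight dt w)
    {dq : Measure (Quotient (QuotientGroup.rightRel Γ))} (h : IsQuotientMeasure Γ da dt dq) :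
    dq = (da.withDensity w).map (cosetMk Γ) := by
  ext s hs
  have hs' := measurable_cosetMk (Γ := Γ) hs
  rw [Measure.map_apply measurable_cosetMk hs, withDensity_apply _ hs',
    ← lintegral_indicator hs', h _ (hw.measurable.indicator hs'), ← lintegral_indicator_one hs]
  refine lintegral_congr fun q => ?_
  by_cases hq : q ∈ s
  · rw [Set.indicator_of_mem hq, Pi.one_apply, ← hw.lintegral_eq_one q.out]
    refine lintegral_congr fun t => ?_
    rw [Set.indicator_of_mem]
    rwa [Set.mem_preimage, cosetMk_mul_left, cosetMk_out]
  · rw [Set.indicator_of_notMem hq]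
    refine lintegral_zero.symm.trans (lintegral_congr fun t => ?_)
    rw [Set.indicator_of_notMem]
    rwa [Set.mem_preimage, cosetMk_mul_left, cosetMk_out]

/-- Unfolding: exchange the integrals, translate `a` by `t⁻¹` using left invariance of `da`,
exchange back. Since `dt` is invariant under inversion, the integral of `w (t⁻¹ * a)` over `t` is
again 1. -/
theorem isQuotientMeasure_map [MeasurableMul₂ A] [SFinite da] [da.IsMulLeftInvariant]
    [MeasurableMul Γ] [MeasurableInv Γ] [SFinite dt] [dt.IsMulRightInvariant] [dt.IsInvInvariant]
    (hw : IsWeight dt w) :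
    IsQuotientMeasure Γ da dt ((da.withDensity w).map (cosetMk Γ)) := by
  intro f hf
  have hmul : Measurable fun p : A × Γ => (p.2 : A) * p.1 :=
    (measurable_subtype_coe.comp measurable_snd).mul measurable_fst
  have hg0 : Measurable fun a => ∫⁻ t : Γ, f ((t : A) * a) ∂dt :=
    Measurable.lintegral_prod_right' (f := fun p : A × Γ => f ((p.2 : A) * p.1)) (hf.comp hmul)
  have hg : Measurable fun q : Quotient (QuotientGroup.rightRel Γ) =>
      ∫⁻ t : Γ, f ((t : A) * q.out) ∂dt := by
    refine measurable_from_quotient.2 ?_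
    convert hg0 using 2 with a
    exact lintegral_out_cosetMk f a
  rw [lintegral_map hg measurable_cosetMk]
  simp only [lintegral_out_cosetMk]
  rw [lintegral_withDensity_eq_lintegral_mul _ hw.measurable hg0]
  simp only [Pi.mul_apply]
  have h1 : ∀ a, w a * ∫⁻ t : Γ, f ((t : A) * a) ∂dt =
      ∫⁻ t : Γ, w a * f ((t : A) * a) ∂dt := fun a =>
    (lintegral_const_mul _ (hf.comp (hmul.comp measurable_prodMk_left))).symm
  simp_rw [h1]
  rw [lintegral_lintegral_swap (((hw.measurable.comp measurable_fst).mul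
    (hf.comp hmul)).aemeasurable)]
  have h2 : ∀ t : Γ, ∫⁻ a, w a * f ((t : A) * a) ∂da = ∫⁻ a, w ((t : A)⁻¹ * a) * f a ∂da := by
    intro t
    rw [← lintegral_mul_left_eq_self (fun a => w ((t : A)⁻¹ * a) * f a) (t : A)]
    simp
  simp_rw [h2]
  have hmulinv : Measurable fun p : Γ × A => (p.1 : A)⁻¹ * p.2 :=
    (measurable_subtype_coe.comp (measurable_inv.comp measurable_fst)).mul measurable_snd
  rw [lintegral_lintegral_swap (((hw.measurable.comp hmulinv).mul
    (hf.comp measurable_snd)).aemeasurable)]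
  refine lintegral_congr fun a => ?_
  have hwa : Measurable fun t : Γ => w ((t : A)⁻¹ * a) :=
    hw.measurable.comp (hmulinv.comp measurable_prodMk_right)
  rw [lintegral_mul_const _ hwa]
  have h3 : ∫⁻ t : Γ, w ((t : A)⁻¹ * a) ∂dt = 1 := by
    rw [← hw.lintegral_eq_one a, ← lintegral_inv_eq_self (μ := dt) (fun t : Γ => w ((t : A) * a))]
    rfl
  rw [h3, one_mul]

/-- Right translation by `c` on the space of right cosets. -/
def cosetMulRight (Γ : Subgroup A) (c : A) (q : Quotient (QuotientGroup.rightRel Γ)) :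
    Quotient (QuotientGroup.rightRel Γ) :=
  Quotient.map (fun a => a * c) (fun a b h => by
    have := QuotientGroup.rightRel_apply.1 h
    exact QuotientGroup.rightRel_apply.2 (by simpa [mul_assoc] using this)) q

theorem cosetMulRight_cosetMk (c a : A) :
    cosetMulRight Γ c (cosetMk Γ a) = cosetMk Γ (a * c) := rfl

theorem measurable_cosetMulRight [MeasurableMul A] (c : A) : Measurable (cosetMulRight Γ c) :=
  measurable_from_quotient.2 (measurable_cosetMk.comp (measurable_mul_const c))

/-- Right translation on the space of right cosets as a measurable equivalence. -/
def cosetMulRightEquiv [MeasurableMul A] (Γ : Subgroup A) (c : A) :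
    Quotient (QuotientGroup.rightRel Γ) ≃ᵐ Quotient (QuotientGroup.rightRel Γ) where
  toFun := cosetMulRight Γ c
  invFun := cosetMulRight Γ c⁻¹
  left_inv q := by
    rw [← cosetMk_out q, cosetMulRight_cosetMk, cosetMulRight_cosetMk, mul_inv_cancel_right]
  right_inv q := by
    rw [← cosetMk_out q, cosetMulRight_cosetMk, cosetMulRight_cosetMk, inv_mul_cancel_right]
  measurable_toFun := measurable_cosetMulRight c
  measurable_invFun := measurable_cosetMulRight c⁻¹

/-- A right translate of a weight is a weight, and by uniqueness both give the same quotient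
measure. Right invariance of `da` identifies the second description with the translate of the first.
-/
theorem IsQuotientMeasure.measurePreserving_cosetMulRight [MeasurableMul A]
    [da.IsMulRightInvariant] (hw : IsWeight dt w)
    {dq : Measure (Quotient (QuotientGroup.rightRel Γ))} (h : IsQuotientMeasure Γ da dt dq)
    (c : A) : MeasurePreserving (cosetMulRightEquiv Γ c) dq dq := by
  refine ⟨(cosetMulRightEquiv Γ c).measurable, ?_⟩
  have hw' : IsWeight dt fun a => w (a * c⁻¹) :=
    ⟨hw.measurable.comp (measurable_mul_const _), fun a => by
      rw [← hw.lintegral_eq_one (a * c⁻¹)]; simp only [mul_assoc]⟩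
  conv_lhs => rw [h.eq_map hw]
  rw [h.eq_map hw', Measure.map_map (cosetMulRightEquiv Γ c).measurable measurable_cosetMk]
  have h1 : (cosetMulRightEquiv Γ c) ∘ cosetMk Γ = cosetMk Γ ∘ fun a => a * c := rfl
  rw [h1, ← Measure.map_map measurable_cosetMk (measurable_mul_const c)]
  congr 1
  ext s hs
  rw [Measure.map_apply (measurable_mul_const c) hs, withDensity_apply _ hs,
    withDensity_apply _ (measurable_mul_const c hs),
    ← lintegral_indicator hs, ← lintegral_indicator (measurable_mul_const c hs),
    ← lintegral_mul_right_eq_self (s.indicator fun a => w (a * c⁻¹)) c]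
  refine lintegral_congr fun a => ?_
  by_cases ha : a * c ∈ s
  · rw [Set.indicator_of_mem ha, Set.indicator_of_mem (by exact ha), mul_inv_cancel_right]
  · rw [Set.indicator_of_notMem ha, Set.indicator_of_notMem (by exact ha)]

end QuotientMeasureTheory

/-! ### Coordinates on H, its torus P ∩ H and the character Ψ_H -/

section ShalikaGroup

variable {n : ℕ} {F : Type*} [Field F]

theorem val_conj_xi (g : GL (Fin n) F) (X : Matrix (Fin n) (Fin n) F) :
    (xi n F * (levi g * unip X) * (xi n F)⁻¹).val =
      fromBlocks g.val 0 (w₀ n F * (g.val * X)) (w₀ n F * g.val * w₀ n F) := by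
  change fromBlocks 0 1 (w₀ n F) 0 * (fromBlocks g.val 0 0 g.val * fromBlocks 1 X 0 1) *
    fromBlocks 0 (w₀ n F) 1 0 = _
  simp [fromBlocks_multiply]

/-- The element `ξ diag(g, g) (1 X; 0 1) ξ⁻¹` of `H`. -/
def mkH (g : GL (Fin n) F) (X : Matrix (Fin n) (Fin n) F) : H n F :=
  ⟨xi n F * (levi g * unip X) * (xi n F)⁻¹, conj_mem_H ⟨_, g, X, rfl⟩⟩

theorem mkH_val (g : GL (Fin n) F) (X : Matrix (Fin n) (Fin n) F) :
    (mkH g X : G n F).val =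
      fromBlocks g.val 0 (w₀ n F * (g.val * X)) (w₀ n F * g.val * w₀ n F) :=
  val_conj_xi g X

theorem exists_mkH (h : H n F) : ∃ g X, h = mkH g X := by
  obtain ⟨_, s, ⟨g, X, rfl⟩, rfl⟩ := h
  exact ⟨g, X, rfl⟩

theorem mkH_mul (g g' : GL (Fin n) F) (X X' : Matrix (Fin n) (Fin n) F) :
    mkH g X * mkH g' X' = mkH (g * g') ((g'⁻¹).val * X * g'.val + X') := by
  ext1
  change (xi n F * (levi g * unip X) * (xi n F)⁻¹) * (xi n F * (levi g' * unip X') * (xi n F)⁻¹) =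
    xi n F * (levi (g * g') * unip ((g'⁻¹).val * X * g'.val + X')) * (xi n F)⁻¹
  rw [← levi_mul, ← unip_mul, mul_assoc (levi g) (levi g'), ← mul_assoc (levi g') (unip _),
    ← unip_mul_levi]
  group

theorem PsiH_mkH (ψ : AddChar F Circle) (g : GL (Fin n) F) (X : Matrix (Fin n) (Fin n) F) :
    PsiH ψ (mkH g X) = ψ (trace X) := by
  rw [← Psi_apply ψ g X, PsiH]
  congr 2
  change (xi n F)⁻¹ * (xi n F * (levi g * unip X) * (xi n F)⁻¹) * xi n F = _
  group

theorem PsiH_mul (ψ : AddChar F Circle) (h h' : H n F) :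
    PsiH ψ (h * h') = PsiH ψ h * PsiH ψ h' := by
  obtain ⟨g, X, rfl⟩ := exists_mkH h
  obtain ⟨g', X', rfl⟩ := exists_mkH h'
  rw [mkH_mul, PsiH_mkH, PsiH_mkH, PsiH_mkH, trace_add, AddChar.map_add_eq_mul, mul_assoc,
    Matrix.trace_mul_comm, mul_assoc, ← Units.val_mul, mul_inv_cancel, Units.val_one, mul_one]
  simp

/-- The upper left block of an element of `H`, as a homomorphism. -/
def topHom : H n F →* GL (Fin n) F := MonoidHom.mk'
  (fun h =>
    { val := toBlocks₁₁ (h : G n F).val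
      inv := toBlocks₁₁ ((h⁻¹ : H n F) : G n F).val
      val_inv := by
        obtain ⟨g, X, hg⟩ := exists_mkH h
        obtain ⟨g', X', hg'⟩ := exists_mkH h⁻¹
        have h1 : (h : G n F).val * ((h⁻¹ : H n F) : G n F).val = 1 := by
          rw [← Units.val_mul, ← Subgroup.coe_mul, mul_inv_cancel]; rfl
        rw [hg', hg, mkH_val, mkH_val, fromBlocks_multiply, ← fromBlocks_one, fromBlocks_inj] at h1
        rw [hg', hg, mkH_val, mkH_val]
        simpa using h1.1
      inv_val := by
        obtain ⟨g, X, hg⟩ := exists_mkH h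
        obtain ⟨g', X', hg'⟩ := exists_mkH h⁻¹
        have h1 : ((h⁻¹ : H n F) : G n F).val * (h : G n F).val = 1 := by
          rw [← Units.val_mul, ← Subgroup.coe_mul, inv_mul_cancel]; rfl
        rw [hg', hg, mkH_val, mkH_val, fromBlocks_multiply, ← fromBlocks_one, fromBlocks_inj] at h1
        rw [hg', hg, mkH_val, mkH_val]
        simpa using h1.1 })
  (fun h h' => by
    ext1
    obtain ⟨g, X, rfl⟩ := exists_mkH h
    obtain ⟨g', X', rfl⟩ := exists_mkH h'
    change toBlocks₁₁ ((mkH g X * mkH g' X' : H n F) : G n F).val =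
      toBlocks₁₁ (mkH g X : G n F).val * toBlocks₁₁ (mkH g' X' : G n F).val
    rw [mkH_mul, mkH_val, mkH_val, mkH_val]
    simp)

theorem topHom_val (h : H n F) : (topHom h).val = toBlocks₁₁ (h : G n F).val := rfl

@[simp] theorem topHom_mkH (g : GL (Fin n) F) (X : Matrix (Fin n) (Fin n) F) :
    topHom (mkH g X) = g := by
  ext1
  rw [topHom_val, mkH_val, toBlocks_fromBlocks₁₁]

theorem val_inl_inl (h : H n F) (i j : Fin n) :
    (h : G n F).val (Sum.inl i) (Sum.inl j) = (topHom h).val i j := rfl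

theorem val_inl_inr (h : H n F) (i j : Fin n) :
    (h : G n F).val (Sum.inl i) (Sum.inr j) = 0 := by
  obtain ⟨g, X, rfl⟩ := exists_mkH h
  rw [mkH_val, fromBlocks_apply₁₂, Matrix.zero_apply]

theorem val_inr_inr (h : H n F) (i j : Fin n) :
    (h : G n F).val (Sum.inr i) (Sum.inr j) = (topHom h).val (Fin.rev i) (Fin.rev j) := by
  obtain ⟨g, X, rfl⟩ := exists_mkH h
  rw [mkH_val, fromBlocks_apply₂₂, topHom_mkH, mul_w₀_apply, w₀_mul_apply]

/-- Equations for `H` in terms of blocks; they show that `H` is closed and allow elements of `H` to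
be built from their entries. -/
theorem coe_H_iff (A : G n F) : A ∈ H n F ↔ toBlocks₁₂ A.val = 0 ∧
    toBlocks₂₂ A.val = w₀ n F * toBlocks₁₁ A.val * w₀ n F := by
  constructor
  · intro hA
    obtain ⟨g, X, hg⟩ := exists_mkH ⟨A, hA⟩
    have : A = (mkH g X : G n F) := congrArg Subtype.val hg
    rw [this, mkH_val]
    simp
  · rintro ⟨h1, h2⟩
    have hval : A.val = fromBlocks (toBlocks₁₁ A.val) 0 (toBlocks₂₁ A.val)
        (w₀ n F * toBlocks₁₁ A.val * w₀ n F) := by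
      rw [← h1, ← h2, fromBlocks_toBlocks]
    have hdet : (toBlocks₁₁ A.val).det ≠ 0 := by
      intro h0
      have hA : A.val.det ≠ 0 := ((Matrix.isUnit_iff_isUnit_det _).1 A.isUnit).ne_zero
      rw [hval, det_fromBlocks_zero₁₂, h0, zero_mul] at hA
      exact hA rfl
    let g : GL (Fin n) F := Matrix.GeneralLinearGroup.mkOfDetNeZero _ hdet
    have hg : g.val = toBlocks₁₁ A.val := rfl
    have : A = (mkH g ((g⁻¹).val * (w₀ n F * toBlocks₂₁ A.val)) : G n F) := by
      ext1
      rw [mkH_val, ← mul_assoc g.val, ← Units.val_mul, mul_inv_cancel, Units.val_one, one_mul,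
        ← mul_assoc, w₀_mul_w₀, one_mul, hg]
      exact hval
    rw [this]
    exact (mkH _ _).2

/-- The upper left block is upper triangular, and so is the lower right one, its conjugate by w₀.
Reversing the indices, the upper left block is also lower triangular, hence diagonal. -/
theorem mem_PH_iff (h : H n F) : h ∈ PH n F ↔
    ∃ d : GL (Fin n) F, (∀ i j, i ≠ j → d.val i j = 0) ∧ h = mkH d 0 := by
  constructor
  · intro hh
    obtain ⟨g, hg, -, -⟩ := exists_of_mem_PH ⟨h, hh⟩
    have hh' : h = mkH g 0 := by
      ext1
      change (h : G n F) = xi n F * (levi g * unip 0) * (xi n F)⁻¹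
      rw [unip_zero, mul_one]
      exact hg
    refine ⟨g, fun i j hij => ?_, hh'⟩
    have hP : BlockTriangular (h : G n F).val toLex := hh
    rcases lt_or_gt_of_ne hij with hlt | hlt
    · have := @hP (Sum.inr (Fin.rev i)) (Sum.inr (Fin.rev j))
        (Sum.Lex.inr_lt_inr_iff.2 (Fin.rev_lt_rev.2 hlt))
      rw [val_inr_inr, Fin.rev_rev, Fin.rev_rev, hh', topHom_mkH] at this
      exact this
    · have := @hP (Sum.inl i) (Sum.inl j) (Sum.Lex.inl_lt_inl_iff.2 hlt)
      rw [val_inl_inl, hh', topHom_mkH] at this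
      exact this
  · rintro ⟨d, hd, rfl⟩
    change BlockTriangular (mkH d 0 : G n F).val toLex
    rintro (i | i) (j | j) hij
    · rw [val_inl_inl, topHom_mkH]
      exact hd i j (Sum.Lex.inl_lt_inl_iff.1 hij).ne'
    · exact val_inl_inr _ _ _
    · rw [mkH_val]; simp
    · rw [val_inr_inr, topHom_mkH]
      exact hd _ _ (fun h => (Sum.Lex.inr_lt_inr_iff.1 hij).ne' (Fin.rev_injective h))

theorem PH_mul_comm (s t : PH n F) : s * t = t * s := by
  obtain ⟨d, hd, hs⟩ := (mem_PH_iff _).1 s.2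
  obtain ⟨e, he, ht⟩ := (mem_PH_iff _).1 t.2
  have h : ∀ a b : GL (Fin n) F, (∀ i j, i ≠ j → a.val i j = 0) →
      (∀ i j, i ≠ j → b.val i j = 0) → a * b = b * a := by
    intro a b ha hb
    have ha' : a.val = diagonal fun i => a.val i i := by
      ext i j
      by_cases hij : i = j
      · subst hij; simp
      · rw [diagonal_apply_ne _ hij, ha i j hij]
    have hb' : b.val = diagonal fun i => b.val i i := by
      ext i j
      by_cases hij : i = j
      · subst hij; simp
      · rw [diagonal_apply_ne _ hij, hb i j hij]
    ext1
    rw [Units.val_mul, Units.val_mul, ha', hb', diagonal_mul_diagonal, diagonal_mul_diagonal]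
    simp only [mul_comm]
  apply Subtype.ext
  rw [Subgroup.coe_mul, Subgroup.coe_mul, hs, ht, mkH_mul, mkH_mul, h d e hd he]
  simp

section Topology

variable [TopologicalSpace F] [IsTopologicalRing F]

theorem continuous_topHom : Continuous (topHom : H n F → GL (Fin n) F) := by
  have h : Continuous fun h : H n F => toBlocks₁₁ (h : G n F).val :=
    continuous_matrix fun i j => (Units.continuous_val.comp continuous_subtype_val).matrix_elem _ _
  exact Units.continuous_iff.2 ⟨h, h.comp continuous_inv⟩

theorem continuous_PsiH {ψ : AddChar F Circle} (hψ : Continuous ψ) :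
    Continuous (PsiH ψ : H n F → ℂ) := by
  -- The matrix X is recovered from the upper left block g and the lower left block w₀ g X.
  have h1 : ∀ h : H n F, PsiH ψ h =
      ψ (trace (((topHom h)⁻¹).val * (w₀ n F * toBlocks₂₁ (h : G n F).val))) := by
    intro h
    obtain ⟨g, X, rfl⟩ := exists_mkH h
    rw [PsiH_mkH, topHom_mkH, mkH_val, toBlocks_fromBlocks₂₁, ← mul_assoc (w₀ n F), w₀_mul_w₀,
      one_mul, ← mul_assoc, ← Units.val_mul, inv_mul_cancel, Units.val_one, one_mul]
  simp_rw [funext h1]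
  refine continuous_subtype_val.comp (hψ.comp (Continuous.matrix_trace (Continuous.mul ?_ ?_)))
  · exact Units.continuous_val.comp (continuous_inv.comp continuous_topHom)
  · exact continuous_const.mul (continuous_matrix fun i j =>
      (Units.continuous_val.comp continuous_subtype_val).matrix_elem _ _)

variable (n F) in
theorem isClosed_H [T2Space F] : IsClosed (H n F : Set (G n F)) := by
  have h : (H n F : Set (G n F)) = {A | toBlocks₁₂ A.val = 0} ∩
      {A | toBlocks₂₂ A.val = w₀ n F * toBlocks₁₁ A.val * w₀ n F} := by
    ext A
    exact coe_H_iff A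
  have hv : Continuous fun A : G n F => A.val := Units.continuous_val
  rw [h]
  refine IsClosed.inter (isClosed_eq ?_ continuous_const) (isClosed_eq ?_ ?_)
  · exact continuous_matrix fun i j => hv.matrix_elem _ _
  · exact continuous_matrix fun i j => hv.matrix_elem _ _
  · exact (continuous_const.mul (continuous_matrix fun i j => hv.matrix_elem _ _)).mul
      continuous_const

variable (n F) in
theorem isClosed_PH [T2Space F] : IsClosed (PH n F : Set (H n F)) := by
  have h : (PH n F : Set (H n F)) = ⋂ i : Fin n ⊕ Fin n, ⋂ j : Fin n ⊕ Fin n,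
      {A : H n F | toLex j < toLex i → (A : G n F).val i j = 0} := by
    ext A
    simp only [Set.mem_iInter]
    exact ⟨fun h i j hij => h hij, fun h i j hij => h i j hij⟩
  rw [h]
  refine isClosed_iInter fun i => isClosed_iInter fun j => ?_
  by_cases hij : toLex j < toLex i
  · simp only [hij, true_imp_iff]
    exact isClosed_eq ((Units.continuous_val.comp continuous_subtype_val).matrix_elem _ _)
      continuous_const
  · simp [hij]

end Topology

end ShalikaGroup

/-! ### Topology of G, H and P ∩ H; invariance of the torus measure -/

section LocallyCompact

variable {n : ℕ} {F : Type*} [Field F] [ValuativeRel F] [TopologicalSpace F]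
  [IsNonarchimedeanLocalField F]

instance instSecondCountableG : SecondCountableTopology (G n F) := by
  have : SecondCountableTopology (Matrix (Fin n ⊕ Fin n) (Fin n ⊕ Fin n) F) :=
    inferInstanceAs (SecondCountableTopology (Fin n ⊕ Fin n → Fin n ⊕ Fin n → F))
  have h2 : SecondCountableTopology (Matrix (Fin n ⊕ Fin n) (Fin n ⊕ Fin n) F)ᵐᵒᵖ :=
    MulOpposite.opHomeomorph.symm.isEmbedding.secondCountableTopology
  exact Units.isEmbedding_embedProduct.secondCountableTopology

instance instLocallyCompactG : LocallyCompactSpace (G n F) := by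
  have : LocallyCompactSpace (Matrix (Fin n ⊕ Fin n) (Fin n ⊕ Fin n) F) :=
    inferInstanceAs (LocallyCompactSpace (Fin n ⊕ Fin n → Fin n ⊕ Fin n → F))
  infer_instance

instance instSecondCountableH : SecondCountableTopology (H n F) :=
  Topology.IsEmbedding.subtypeVal.secondCountableTopology

instance instSecondCountablePH : SecondCountableTopology (PH n F) :=
  Topology.IsEmbedding.subtypeVal.secondCountableTopology

instance instLocallyCompactH : LocallyCompactSpace (H n F) :=
  (isClosed_H n F).isClosedEmbedding_subtypeVal.locallyCompactSpace

instance instLocallyCompactPH : LocallyCompactSpace (PH n F) :=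
  (isClosed_PH n F).isClosedEmbedding_subtypeVal.locallyCompactSpace

variable [MeasurableSpace (GL (Fin n ⊕ Fin n) F)] [BorelSpace (GL (Fin n ⊕ Fin n) F)]

instance instRightInvariantPH (dt : Measure (PH n F)) [dt.IsMulLeftInvariant] :
    dt.IsMulRightInvariant where
  map_mul_right_eq_self t := by
    simp_rw [PH_mul_comm _ t]
    exact map_mul_left_eq_self dt t

instance instInvInvariantPH (dt : Measure (PH n F)) [dt.IsHaarMeasure] : dt.IsInvInvariant := by
  have : TopologicalSpace.PseudoMetrizableSpace (PH n F) := inferInstance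
  have : dt.Regular := inferInstance
  let : CommGroup (PH n F) :=
    { (inferInstance : Group (PH n F)) with mul_comm := PH_mul_comm }
  exact Measure.IsHaarMeasure.isInvInvariant_of_regular dt

end LocallyCompact

/-! ### H is unimodular -/

section Unimodular

variable {n : ℕ} {F : Type*} [Field F]

theorem mkH_one_zero : mkH (1 : GL (Fin n) F) 0 = 1 := by
  ext1
  change xi n F * (levi 1 * unip 0) * (xi n F)⁻¹ = 1
  rw [levi_one, unip_zero]
  group

theorem mkH_inv (g : GL (Fin n) F) (X : Matrix (Fin n) (Fin n) F) :
    (mkH g X)⁻¹ = mkH g⁻¹ (-(g.val * X * (g⁻¹).val)) := by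
  rw [inv_eq_iff_mul_eq_one, mkH_mul, mul_inv_cancel, inv_inv, add_neg_cancel, mkH_one_zero]

variable (n F) in
/-- The homomorphism `g ↦ ξ diag(g, g) ξ⁻¹`. -/
def leviHom : GL (Fin n) F →* H n F where
  toFun g := mkH g 0
  map_one' := mkH_one_zero
  map_mul' g g' := by rw [mkH_mul]; simp

theorem leviHom_apply (g : GL (Fin n) F) : leviHom n F g = mkH g 0 := rfl

theorem mkH_eq (g : GL (Fin n) F) (X : Matrix (Fin n) (Fin n) F) :
    mkH g X = leviHom n F g * mkH 1 X := by
  rw [leviHom_apply, mkH_mul]; simp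

/-- The invertible diagonal matrices. -/
def diagGL {ι : Type*} [Fintype ι] [DecidableEq ι] : (ι → Fˣ) →* GL ι F :=
  (Units.map (Matrix.diagonalRingHom ι F).toMonoidHom).comp MulEquiv.piUnits.symm.toMonoidHom

theorem diagGL_val {ι : Type*} [Fintype ι] [DecidableEq ι] (u : ι → Fˣ) :
    (diagGL u).val = diagonal fun i => (u i : F) := rfl

theorem permGL_conj_diagGL {ι : Type*} [Fintype ι] [DecidableEq ι] (σ : Equiv.Perm ι)
    (u : ι → Fˣ) : permGL F σ * diagGL u * (permGL F σ)⁻¹ = diagGL (u ∘ σ) := by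
  rw [mul_inv_eq_iff_eq_mul]
  ext i j
  change ((permGL F σ).val * (diagGL u).val) i j = ((diagGL (u ∘ σ)).val * (permGL F σ).val) i j
  rw [permGL_mul_apply, mul_permGL_apply, diagGL_val, diagGL_val, diagonal_apply, diagonal_apply]
  have h : σ i = j ↔ i = σ⁻¹ j := by rw [Equiv.Perm.eq_inv_iff_eq]
  simp [h]

/-- A homomorphism from the diagonal torus which is invariant under permutations and trivial on
scalars is trivial. -/
theorem eq_one_of_perm_invariant (f : (Fin n → Fˣ) →* ℝ≥0)
    (hperm : ∀ (σ : Equiv.Perm (Fin n)) u, f (u ∘ σ) = f u)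
    (hscalar : ∀ x : Fˣ, f (fun _ => x) = 1) (u : Fin n → Fˣ) : f u = 1 := by
  have hsingle : ∀ i (x : Fˣ), f (Pi.mulSingle i x) = 1 := by
    intro i x
    have h1 : ∀ j, f (Pi.mulSingle j x) = f (Pi.mulSingle i x) := by
      intro j
      rw [← hperm (Equiv.swap i j) (Pi.mulSingle i x)]
      congr 1
      ext k
      simp only [Function.comp, Pi.mulSingle_apply]
      simp only [Equiv.swap_apply_eq_iff, Equiv.swap_apply_left]
    have h2 := hscalar x
    rw [← Finset.univ_prod_mulSingle (fun _ : Fin n => x), map_prod,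
      Finset.prod_congr rfl fun j _ => h1 j, Finset.prod_const, Finset.card_univ,
      Fintype.card_fin] at h2
    -- By symmetry the value on a scalar is the n-th power of the value on one factor. In `ℝ≥0` only
    -- 1 has n-th power 1, and n ≠ 0 because an index exists.
    exact (pow_eq_one_iff.1 h2).resolve_right (by rintro rfl; exact i.elim0)
  rw [← Finset.univ_prod_mulSingle u, map_prod]
  exact Finset.prod_eq_one fun i _ => hsingle i _

/-- The matrix `diag(1, c)`. -/
def lowerScalar (c : Fˣ) : G n F where
  val := fromBlocks 1 0 0 ((c : F) • 1)
  inv := fromBlocks 1 0 0 ((c⁻¹ : Fˣ) • (1 : Matrix (Fin n) (Fin n) F))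
  val_inv := by simp [fromBlocks_multiply, Units.smul_def, smul_smul]
  inv_val := by simp [fromBlocks_multiply, Units.smul_def, smul_smul]

theorem lowerScalar_conj_mkH (c : Fˣ) (X : Matrix (Fin n) (Fin n) F) :
    lowerScalar c * (mkH 1 X : G n F) * (lowerScalar c)⁻¹ = (mkH 1 ((c : F) • X) : G n F) := by
  rw [mul_inv_eq_iff_eq_mul]
  ext1
  rw [Units.val_mul, Units.val_mul, mkH_val, mkH_val]
  change fromBlocks 1 0 0 ((c : F) • 1) * _ = _ * fromBlocks 1 0 0 ((c : F) • 1)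
  simp [fromBlocks_multiply, w₀_mul_w₀]

variable [ValuativeRel F] [TopologicalSpace F] [IsNonarchimedeanLocalField F]

theorem mkH_mem_integralGL {g : GL (Fin n) F} (hg : g ∈ integralGL (Fin n) F)
    {X : Matrix (Fin n) (Fin n) F} (hX : ∀ i j, absF (X i j) ≤ 1) :
    (mkH g X : G n F) ∈ integralGL (Fin n ⊕ Fin n) F := by
  have key : ∀ {g : GL (Fin n) F} {X : Matrix (Fin n) (Fin n) F}, g ∈ integralGL (Fin n) F →
      (∀ i j, absF (X i j) ≤ 1) → ∀ i j, absF ((mkH g X : G n F).val i j) ≤ 1 := by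
    intro g X hg hX i j
    rw [mkH_val]
    rcases i with i | i <;> rcases j with j | j
    · exact hg.1 i j
    · simp
    · rw [fromBlocks_apply₂₁, w₀_mul_apply]
      exact absF_mul_apply_le hg.1 hX _ _
    · rw [fromBlocks_apply₂₂, mul_w₀_apply, w₀_mul_apply]
      exact hg.1 _ _
  refine ⟨key hg hX, ?_⟩
  rw [← Subgroup.coe_inv, mkH_inv]
  refine key (inv_mem hg) fun i j => ?_
  rw [Matrix.neg_apply, absF_neg]
  exact absF_mul_apply_le (absF_mul_apply_le hg.1 hX) (inv_mem hg).1 i j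

/-- Right translation by `h` fixes the compact open subgroup H ∩ s⁻¹ GL(𝔬) s, of positive finite
measure. The element `s` need neither lie in `H` nor normalize it. -/
theorem modularCharacter_eq_one_of_conj {h : H n F} (s : G n F)
    (hs : s * (h : G n F) * s⁻¹ ∈ integralGL (Fin n ⊕ Fin n) F) :
    Measure.modularCharacter h = 1 := by
  let : MeasurableSpace (H n F) := borel _
  have : BorelSpace (H n F) := ⟨rfl⟩
  let K : Subgroup (H n F) :=
    (integralGL (Fin n ⊕ Fin n) F).comap ((MulAut.conj s).toMonoidHom.comp (H n F).subtype)
  let e : G n F ≃ₜ G n F := (Homeomorph.mulLeft s).trans (Homeomorph.mulRight s⁻¹)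
  have hK : (K : Set (H n F)) = (fun x : H n F => e x) ⁻¹' (integralGL (Fin n ⊕ Fin n) F) := rfl
  have hcl : Topology.IsClosedEmbedding fun x : H n F => e x :=
    e.isClosedEmbedding.comp (isClosed_H n F).isClosedEmbedding_subtypeVal
  have hcomp : IsCompact (K : Set (H n F)) := hcl.isCompact_preimage (isCompact_integralGL _ F)
  have hopen : IsOpen (K : Set (H n F)) := (isOpen_integralGL _ F).preimage hcl.continuous
  have hhK : h ∈ K := hs
  let μ : Measure (H n F) := Measure.haar
  have h1 := congrArg (fun ν => ν (K : Set (H n F)))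
    (Measure.map_right_mul_eq_modularCharacterFun_smul μ h)
  change Measure.map (fun x => x * h) μ K = (Measure.modularCharacterFun h • μ) K at h1
  rw [Measure.map_apply (measurable_mul_const h) hopen.measurableSet] at h1
  have h2 : (fun x => x * h) ⁻¹' (K : Set (H n F)) = K := by
    ext x
    exact K.mul_mem_cancel_right hhK
  rw [h2] at h1
  have h0 : μ (K : Set (H n F)) ≠ 0 := (hopen.measure_pos μ ⟨1, K.one_mem⟩).ne'
  have h3 : (Measure.modularCharacterFun h : ℝ≥0∞) * μ K = 1 * μ K := by
    rw [one_mul]; exact h1.symm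
  rw [ENNReal.mul_left_inj h0 hcomp.measure_lt_top.ne] at h3
  exact_mod_cast h3

/-- Right translation by a central element is a left translation. -/
theorem modularCharacter_eq_one_of_central {h : H n F} (hc : ∀ x, x * h = h * x) :
    Measure.modularCharacter h = 1 := by
  let : MeasurableSpace (H n F) := borel _
  have : BorelSpace (H n F) := ⟨rfl⟩
  let μ : Measure (H n F) := Measure.haar
  have h1 := Measure.map_right_mul_eq_modularCharacterFun_smul μ h
  simp_rw [hc] at h1
  rw [map_mul_left_eq_self] at h1
  have hK : IsCompact ((fun x : H n F => (x : G n F)) ⁻¹' (integralGL (Fin n ⊕ Fin n) F)) :=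
    (isClosed_H n F).isClosedEmbedding_subtypeVal.isCompact_preimage (isCompact_integralGL _ F)
  have hopen : IsOpen ((fun x : H n F => (x : G n F)) ⁻¹' (integralGL (Fin n ⊕ Fin n) F)) :=
    (isOpen_integralGL _ F).preimage continuous_subtype_val
  set K := ((fun x : H n F => (x : G n F)) ⁻¹' (integralGL (Fin n ⊕ Fin n) F))
  have h0 : μ K ≠ 0 := (hopen.measure_pos μ ⟨1, one_mem (integralGL _ F)⟩).ne'
  have h3 : (Measure.modularCharacterFun h : ℝ≥0∞) * μ K = 1 * μ K := by
    rw [one_mul]; exact (congrArg (fun ν => ν K) h1).symm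
  rw [ENNReal.mul_left_inj h0 hK.measure_lt_top.ne] at h3
  exact_mod_cast h3

/-- Conjugation by diag(1, c) scales X by c, so a small c makes the element integral. -/
theorem modularCharacter_mkH_one (X : Matrix (Fin n) (Fin n) F) :
    Measure.modularCharacter (mkH 1 X) = 1 := by
  obtain ⟨r, hr⟩ : ∃ r : ℝ, ∀ i j, absF (X i j) ≤ r :=
    ⟨∑ i, ∑ j, absF (X i j), fun i j =>
      (Finset.single_le_sum (f := fun j => absF (X i j)) (fun _ _ => absF_nonneg _)
        (Finset.mem_univ j)).trans (Finset.single_le_sum (f := fun i => ∑ j, absF (X i j))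
          (fun _ _ => Finset.sum_nonneg fun _ _ => absF_nonneg _) (Finset.mem_univ i))⟩
  obtain ⟨a, ha0, ha⟩ := exists_absF_gt F r
  refine modularCharacter_eq_one_of_conj (lowerScalar (Units.mk0 a ha0)⁻¹) ?_
  rw [lowerScalar_conj_mkH]
  refine mkH_mem_integralGL (one_mem _) fun i j => ?_
  have hpos := absF_pos ha0
  rw [Matrix.smul_apply, smul_eq_mul, absF_mul]
  simp only [Units.val_inv_eq_inv_val, Units.val_mk0, absF_inv]
  rw [inv_mul_le_iff₀ hpos, mul_one]
  exact (hr i j).trans ha.le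

/-- Conjugation by the torus shrinks the off-diagonal entry into 𝔬, and a character does not see
conjugation. -/
theorem modularCharacter_leviHom_transGL {i j : Fin n} (hij : i ≠ j) (x : F) :
    Measure.modularCharacter (leviHom n F (transGL hij x)) = 1 := by
  obtain ⟨a, ha0, ha⟩ := exists_absF_gt F (absF x)
  have hpos := absF_pos ha0
  have hconj : diagGL (Pi.mulSingle j (Units.mk0 a ha0)⁻¹) * transGL hij x *
      (diagGL (Pi.mulSingle j (Units.mk0 a ha0)⁻¹))⁻¹ = transGL hij (a⁻¹ * x) := by
    rw [mul_inv_eq_iff_eq_mul]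
    ext r s
    set D : GL (Fin n) F := diagGL (Pi.mulSingle j (Units.mk0 a ha0)⁻¹) with hD
    change (D.val * (transGL hij x).val) r s = ((transGL hij (a⁻¹ * x)).val * D.val) r s
    rw [mul_transGL_apply, transGL_mul_apply]
    simp only [hD, diagGL_val, diagonal_apply, Pi.mulSingle_apply]
    by_cases hs : s = i
    · subst hs
      by_cases hr : r = j
      · subst hr; simp [hij, hij.symm]
      · simp [hr]
    · by_cases hr : r = j
      · subst hr; simp [hs, Ne.symm hs]
      · simp [hs, hr]
  have h1 : Measure.modularCharacter (leviHom n F (transGL hij (a⁻¹ * x))) = 1 := by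
    refine modularCharacter_eq_one_of_conj 1 ?_
    rw [one_mul, inv_one, mul_one, leviHom_apply]
    refine mkH_mem_integralGL (transGL_mem hij ?_) (by simp)
    rw [absF_mul, absF_inv, inv_mul_le_iff₀ hpos, mul_one]
    exact ha.le
  rw [← hconj, map_mul, map_mul, map_inv, map_mul, map_mul, mul_right_comm, ← map_mul,
    mul_inv_cancel, map_one, one_mul] at h1
  exact h1

/-- Permutation matrices conjugate the torus by permuting its coordinates, and scalars are central
in `H`; `eq_one_of_perm_invariant` does the rest. -/
theorem modularCharacter_leviHom_diagGL (u : Fin n → Fˣ) :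
    Measure.modularCharacter (leviHom n F (diagGL u)) = 1 := by
  refine eq_one_of_perm_invariant
    (Measure.modularCharacter.comp ((leviHom n F).comp diagGL)) (fun σ u => ?_) (fun x => ?_) u
  · simp only [MonoidHom.comp_apply]
    rw [← permGL_conj_diagGL, map_mul, map_mul, map_inv, map_mul, map_mul, mul_right_comm,
      ← map_mul, mul_inv_cancel, map_one, one_mul]
  · refine modularCharacter_eq_one_of_central fun h => ?_
    obtain ⟨g, X, rfl⟩ := exists_mkH h
    have hcomm : ∀ A : Matrix (Fin n) (Fin n) F,
        A * (diagGL fun _ : Fin n => x).val = (diagGL fun _ : Fin n => x).val * A := by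
      intro A
      have : (diagGL fun _ : Fin n => x).val = (x : F) • (1 : Matrix (Fin n) (Fin n) F) := by
        rw [diagGL_val, smul_one_eq_diagonal]
      rw [this]; simp
    simp only [MonoidHom.comp_apply]
    rw [leviHom_apply, mkH_mul, mkH_mul, mul_assoc _ X, hcomm X, ← mul_assoc, ← Units.val_mul,
      inv_mul_cancel]
    have : g * (diagGL fun _ : Fin n => x) = (diagGL fun _ : Fin n => x) * g :=
      Units.ext (hcomm g.val)
    rw [this]
    simp

theorem modularCharacter_H (h : H n F) : Measure.modularCharacter h = 1 := by
  obtain ⟨g, X, rfl⟩ := exists_mkH h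
  rw [mkH_eq, map_mul, modularCharacter_mkH_one, mul_one]
  have hdet : g.val.det ≠ 0 := ((Matrix.isUnit_iff_isUnit_det _).1 g.isUnit).ne_zero
  -- Diagonal matrices and transvections generate GL_n, so the two preceding cases suffice.
  have key := Matrix.diagonal_transvection_induction_of_det_ne_zero
    (fun M => ∀ A : GL (Fin n) F, A.val = M → Measure.modularCharacter (leviHom n F A) = 1)
    g.val hdet ?_ ?_ ?_
  · exact key g rfl
  · intro D hD A hA
    rw [det_diagonal, Finset.prod_ne_zero_iff] at hD
    have : A = diagGL fun i => Units.mk0 (D i) (hD i (Finset.mem_univ i)) := Units.ext hA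
    rw [this, modularCharacter_leviHom_diagGL]
  · intro t A hA
    have : A = transGL t.hij.symm t.c := Units.ext hA
    rw [this, modularCharacter_leviHom_transGL]
  · intro A B hA hB ihA ihB C hC
    have : C = Matrix.GeneralLinearGroup.mkOfDetNeZero A hA *
        Matrix.GeneralLinearGroup.mkOfDetNeZero B hB := Units.ext hC
    rw [this, map_mul, map_mul, ihA _ rfl, ihB _ rfl, one_mul]

instance instRightInvariantH [MeasurableSpace (GL (Fin n ⊕ Fin n) F)]
    [BorelSpace (GL (Fin n ⊕ Fin n) F)] (dh : Measure (H n F)) [dh.IsHaarMeasure] :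
    dh.IsMulRightInvariant where
  map_mul_right_eq_self h := by
    have : TopologicalSpace.PseudoMetrizableSpace (H n F) := inferInstance
    have : dh.Regular := inferInstance
    rw [Measure.map_right_mul_eq_modularCharacterFun_smul dh h]
    have : Measure.modularCharacterFun h = 1 := modularCharacter_H h
    rw [this, one_smul]

end Unimodular

/-! ### The order of the 2n indices -/

section Order

variable {n : ℕ}

theorem finSumFinEquiv_lt_iff (i j : Fin n ⊕ Fin n) :
    (finSumFinEquiv i : Fin (n + n)) < finSumFinEquiv j ↔ toLex i < toLex j := by
  rcases i with i | i <;> rcases j with j | j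
  · simp only [finSumFinEquiv_apply_left, Sum.Lex.inl_lt_inl_iff]
    exact Iff.rfl
  · have := i.2
    simp only [finSumFinEquiv_apply_left, finSumFinEquiv_apply_right, Fin.lt_def,
      Fin.val_castAdd, Fin.val_natAdd]
    exact ⟨fun _ => Sum.Lex.inl_lt_inr _ _, fun _ => by omega⟩
  · have := j.2
    simp only [finSumFinEquiv_apply_left, finSumFinEquiv_apply_right, Fin.lt_def,
      Fin.val_castAdd, Fin.val_natAdd]
    exact ⟨fun _ => by omega, fun h => absurd h Sum.Lex.not_inr_lt_inl⟩
  · simp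

theorem mem_P_iff {F : Type*} [Field F] (p : G n F) : p ∈ P n F ↔ p ∈ borelGL F finSumFinEquiv :=
  ⟨fun h i j hij => h ((finSumFinEquiv_lt_iff j i).1 hij),
    fun h i j hij => h ((finSumFinEquiv_lt_iff j i).2 hij)⟩

end Order

/-! ### Membership in GL(𝔬), and matrices with trivial heights -/

section Integral

variable {ι : Type*} [Fintype ι] [DecidableEq ι] {F : Type*} [Field F] [ValuativeRel F]
  [TopologicalSpace F] [IsNonarchimedeanLocalField F]

theorem absF_sign_smul (σ : Equiv.Perm ι) (x : F) : absF (Equiv.Perm.sign σ • x) = absF x := by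
  rcases Int.units_eq_one_or (Equiv.Perm.sign σ) with h | h <;> simp [h, absF_neg]

theorem absF_det_le_one {A : Matrix ι ι F} (hA : ∀ i j, absF (A i j) ≤ 1) : absF A.det ≤ 1 := by
  rw [det_apply]
  refine absF_sum_le zero_le_one fun σ _ => ?_
  rw [absF_sign_smul, absF_prod]
  exact Finset.prod_le_one (fun _ _ => absF_nonneg _) fun _ _ => hA _ _

/-- An integral matrix whose determinant is a unit has an integral inverse. -/
theorem mem_integralGL_of_det {A : GL ι F} (hA : ∀ i j, absF (A.val i j) ≤ 1)
    (hdet : absF A.val.det = 1) : A ∈ integralGL ι F := by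
  refine ⟨hA, fun i j => ?_⟩
  have h : (A⁻¹).val = (A.val.det)⁻¹ • A.val.adjugate := by
    rw [Matrix.coe_units_inv, Matrix.inv_def, Ring.inverse_eq_inv']
  rw [h, Matrix.smul_apply, smul_eq_mul, absF_mul, absF_inv, hdet, inv_one, one_mul,
    adjugate_apply]
  refine absF_det_le_one fun r s => ?_
  rw [updateRow_apply]
  split_ifs
  · rw [Pi.single_apply]; split_ifs <;> simp
  · exact hA r s

variable {m : ℕ} (b : ι ≃ Fin m)

variable (F) in
/-- The unipotent upper triangular matrices for the order given by `b`. -/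
def unipotentGL : Subgroup (GL ι F) where
  carrier := {p | p ∈ borelGL F b ∧ ∀ i, p.val i i = 1}
  mul_mem' := by
    rintro p q ⟨hp, hp'⟩ ⟨hq, hq'⟩
    exact ⟨mul_mem hp hq, fun i => by rw [borelGL_mul_diag hp hq, hp', hq', one_mul]⟩
  one_mem' := ⟨one_mem _, fun i => by simp⟩
  inv_mem' := by
    rintro p ⟨hp, hp'⟩
    refine ⟨inv_mem hp, fun i => ?_⟩
    have := borelGL_diag_mul_inv hp i
    rwa [hp', one_mul] at this

/-- A decomposition of `g` when all its heights are `1`. -/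
theorem exists_unipotent_mul_integral {g : GL ι F} (hg : ∀ i, height b g i = 1) :
    ∃ p ∈ unipotentGL F b, ∃ k ∈ integralGL ι F, g = p * k := by
  obtain ⟨p, hp, k, hk, rfl⟩ := exists_iwasawa b g
  have hu : ∀ i, absF (p.val i i) = 1 := fun i => by rw [← height_mul hp hk, hg]
  -- The diagonal part of `p` has unit entries, so it can be moved into the integral factor.
  let d : GL ι F := diagGL fun i => Units.mk0 (p.val i i) (borelGL_diag_ne_zero hp i)
  have hdv : d.val = diagonal fun i => p.val i i := rfl
  have hdb : d ∈ borelGL F b := by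
    intro i j hij
    rw [hdv, diagonal_apply_ne _ (fun h => (ne_of_lt hij) (by rw [h]))]
  have hdk : d ∈ integralGL ι F := by
    refine mem_integralGL_of_det (fun i j => ?_) ?_
    · rw [hdv, diagonal_apply]
      split_ifs
      · exact (hu i).le
      · simp
    · rw [hdv, det_diagonal, absF_prod]
      exact Finset.prod_eq_one fun i _ => hu i
  refine ⟨p * d⁻¹, ⟨mul_mem hp (inv_mem hdb), fun i => ?_⟩, d * k, mul_mem hdk hk, by group⟩
  rw [borelGL_mul_diag hp (inv_mem hdb)]
  have := borelGL_diag_mul_inv hdb i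
  rwa [hdv, diagonal_apply_eq] at this

end Integral

/-! ### Triangular changes of variables -/

section Shear

variable {F : Type*} [AddCommGroup F] [MeasurableSpace F] [MeasurableAdd₂ F] (μ : Measure F)
  [SigmaFinite μ] [μ.IsAddLeftInvariant] {α : Type*} [Fintype α] [DecidableEq α]

/-- Integrating over coordinate `s` first, the shear is a translation by a constant. -/
theorem lintegral_pi_update_add (s : α) {c : (α → F) → F} (hc : Measurable c)
    (hcs : ∀ x a, c (Function.update x s a) = c x) {f : (α → F) → ℝ≥0∞} (hf : Measurable f) :
    ∫⁻ x, f (Function.update x s (x s + c x)) ∂Measure.pi (fun _ => μ) =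
      ∫⁻ x, f x ∂Measure.pi (fun _ => μ) := by
  have hm : Measurable fun x : α → F => Function.update x s (x s + c x) := by
    refine measurable_pi_iff.2 fun t => ?_
    by_cases h : t = s
    · subst h
      simpa using (measurable_pi_apply t : Measurable fun x : α → F => x t).fun_add hc
    · simpa [h] using measurable_pi_apply t
  refine lintegral_eq_of_lmarginal_eq {s} (hf.comp hm) hf ?_
  ext x
  rw [lmarginal_singleton, lmarginal_singleton]
  simp only [hcs, Function.update_idem, Function.update_self]
  simp_rw [add_comm _ (c x)]
  exact lintegral_add_left_eq_self (fun a => f (Function.update x s a)) (c x)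

/-- Unipotent triangular (not necessarily linear) maps preserve the product measure. -/
theorem lintegral_pi_triangular (rk : α → ℕ) {p : (α → F) → α → F}
    (hp : ∀ s, Measurable fun x => p x s)
    (hrk : ∀ s x y, (∀ t, rk t < rk s → x t = y t) → p x s = p y s)
    {f : (α → F) → ℝ≥0∞} (hf : Measurable f) :
    ∫⁻ x, f (fun s => x s + p x s) ∂Measure.pi (fun _ => μ) =
      ∫⁻ x, f x ∂Measure.pi (fun _ => μ) := by
  -- The coordinates are sheared in order of increasing rank. A newly added `s` has maximal rank in
  -- the set, so none of the shears already made depends on coordinate `s`.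
  have key : ∀ C : Finset α, ∫⁻ x, f (fun s => if s ∈ C then x s + p x s else x s)
      ∂Measure.pi (fun _ => μ) = ∫⁻ x, f x ∂Measure.pi (fun _ => μ) := by
    intro C
    induction C using Finset.induction_on_max_value rk with
    | empty => simp
    | insert s C hs hmax ih =>
      have hmeas : Measurable fun x : α → F => f fun s => if s ∈ C then x s + p x s else x s := by
        refine hf.comp (measurable_pi_iff.2 fun t => ?_)
        by_cases h : t ∈ C
        · simpa [h] using (measurable_pi_apply t : Measurable fun x : α → F => x t).fun_add (hp t)
        · simpa [h] using measurable_pi_apply t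
      have hind : ∀ t, rk t ≤ rk s → ∀ x a, p (Function.update x s a) t = p x t := by
        intro t ht x a
        refine hrk t _ _ fun r hr => ?_
        rw [Function.update_of_ne]
        rintro rfl
        omega
      rw [← ih, ← lintegral_pi_update_add μ s (hp s) (hind s le_rfl) hmeas]
      refine lintegral_congr fun x => congrArg f ?_
      ext t
      by_cases hts : t = s
      · subst hts; simp [hs]
      · by_cases ht : t ∈ C
        · simp only [Finset.mem_insert, hts, ht, or_true, if_true]
          rw [Function.update_of_ne hts, hind t (hmax t ht)]
        · simp [hts, ht]
  simpa using key Finset.univ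

end Shear

/-! ### Bounding an integral over a group by one over a parameter space -/

section Comparison

variable {A : Type*} [Group A] [MeasurableSpace A] [MeasurableMul₂ A] [MeasurableInv A]
  {da : Measure A} [SFinite da] [da.IsMulLeftInvariant] {Y : Type*} [MeasurableSpace Y]
  {ν : Measure Y} [SFinite ν]

/-- Double counting of the pairs (a, y) with u y ∈ a K. For fixed a ∈ E they fill ν-measure at least
v; for fixed y they fill the coset u y K, of measure `da K`. On such pairs f(a) = f(u y). No product
decomposition of the Haar measure is needed. -/
theorem setLIntegral_lt_top_of_le_measure {K : Subgroup A} (hK : MeasurableSet (K : Set A))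
    (hKtop : da K < ∞) {u : Y → A} (hu : Measurable u) {E : Set A} (hE : MeasurableSet E)
    {v : ℝ≥0∞} (hv0 : v ≠ 0) (hv : ∀ a ∈ E, v ≤ ν {y | a⁻¹ * u y ∈ K}) {f : A → ℝ≥0∞}
    (hf : Measurable f) (hfK : ∀ a, ∀ k ∈ K, f (a * k) = f a)
    (hint : ∫⁻ y, f (u y) ∂ν < ∞) : ∫⁻ a in E, f a ∂da < ∞ := by
  have hmeas : Measurable fun q : A × Y => (K : Set A).indicator (1 : A → ℝ≥0∞) (q.1⁻¹ * u q.2) :=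
    (measurable_one.indicator hK).comp
      ((measurable_inv.comp measurable_fst).mul (hu.comp measurable_snd))
  have h1 : v * ∫⁻ a in E, f a ∂da ≤ (∫⁻ y, f (u y) ∂ν) * da K := by
    calc v * ∫⁻ a in E, f a ∂da = ∫⁻ a in E, v * f a ∂da := (lintegral_const_mul _ hf).symm
      _ ≤ ∫⁻ a in E, ∫⁻ y, f (u y) * (K : Set A).indicator 1 (a⁻¹ * u y) ∂ν ∂da := by
        refine setLIntegral_mono' hE fun a ha => ?_
        have h2 : ∀ y, f (u y) * (K : Set A).indicator 1 (a⁻¹ * u y) =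
            f a * {y | a⁻¹ * u y ∈ K}.indicator 1 y := by
          intro y
          by_cases hy : a⁻¹ * u y ∈ K
          · rw [Set.indicator_of_mem (by exact hy), Set.indicator_of_mem (by exact hy)]
            have := hfK a _ hy
            rw [mul_inv_cancel_left] at this
            rw [this]; rfl
          · rw [Set.indicator_of_notMem (by exact hy), Set.indicator_of_notMem (by exact hy)]
            simp
        simp_rw [h2]
        have hS : MeasurableSet {y | a⁻¹ * u y ∈ K} := (hu.const_mul a⁻¹) hK
        rw [lintegral_const_mul _ (measurable_one.indicator hS), lintegral_indicator_one hS,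
          mul_comm]
        gcongr
        exact hv a ha
      _ ≤ ∫⁻ a, ∫⁻ y, f (u y) * (K : Set A).indicator 1 (a⁻¹ * u y) ∂ν ∂da :=
        setLIntegral_le_lintegral _ _
      _ = ∫⁻ y, ∫⁻ a, f (u y) * (K : Set A).indicator 1 (a⁻¹ * u y) ∂da ∂ν := by
        refine lintegral_lintegral_swap (Measurable.aemeasurable ?_)
        exact (hf.comp (hu.comp measurable_snd)).mul hmeas
      _ = ∫⁻ y, f (u y) * da K ∂ν := by
        refine lintegral_congr fun y => ?_
        have hy : Measurable fun a => (K : Set A).indicator (1 : A → ℝ≥0∞) (a⁻¹ * u y) :=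
          hmeas.comp measurable_prodMk_right
        rw [lintegral_const_mul _ hy]
        congr 1
        rw [← lintegral_mul_left_eq_self _ (u y), ← lintegral_indicator_one hK]
        refine lintegral_congr fun a => ?_
        have h3 : (u y * a)⁻¹ * u y = a⁻¹ := by group
        rw [h3]
        by_cases ha : a ∈ K
        · rw [Set.indicator_of_mem (by exact inv_mem ha), Set.indicator_of_mem (by exact ha)]
          rfl
        · rw [Set.indicator_of_notMem (by simpa using ha), Set.indicator_of_notMem (by exact ha)]
      _ = (∫⁻ y, f (u y) ∂ν) * da K := lintegral_mul_const _ (hf.comp hu)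
  by_contra htop
  rw [not_lt, top_le_iff] at htop
  rw [htop, ENNReal.mul_top hv0] at h1
  exact absurd (h1.trans_lt (ENNReal.mul_lt_top hint hKtop)) (lt_irrefl _)

end Comparison

/-! ### The unipotent subgroup of H and its integral -/

section Unipotent

variable {n : ℕ} {F : Type*} [Field F]

variable (n) in
/-- The positions of the free entries of the lower triangular unipotent elements of `H`. -/
def lowerPairs : Finset ((Fin n ⊕ Fin n) × (Fin n ⊕ Fin n)) :=
  pairsBefore finSumFinEquiv (fun i => i.isRight = true) 1

theorem inl_notMem_lowerPairs (i : Fin n) (j : Fin n ⊕ Fin n) :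
    (Sum.inl i, j) ∉ lowerPairs n := by
  simp [lowerPairs, mem_pairsBefore]

theorem inr_inl_mem_lowerPairs (i j : Fin n) : (Sum.inr i, Sum.inl j) ∈ lowerPairs n := by
  have h : (finSumFinEquiv (Sum.inl j) : Fin (n + n)) < finSumFinEquiv (Sum.inr i) :=
    (finSumFinEquiv_lt_iff _ _).2 (Sum.Lex.inl_lt_inr _ _)
  simp only [lowerPairs, mem_pairsBefore]
  exact ⟨rfl, h, h⟩

theorem inr_inr_mem_lowerPairs {i j : Fin n} :
    (Sum.inr i, Sum.inr j) ∈ lowerPairs n ↔ j < i := by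
  have h : (finSumFinEquiv (Sum.inr j) : Fin (n + n)) < finSumFinEquiv (Sum.inr i) ↔ j < i := by
    rw [finSumFinEquiv_lt_iff, Sum.Lex.inr_lt_inr_iff]
  simp only [lowerPairs, mem_pairsBefore]
  exact ⟨fun hh => h.1 hh.2.1, fun hh => ⟨rfl, h.2 hh, h.2 hh⟩⟩

theorem lt_of_mem_lowerPairs {p : (Fin n ⊕ Fin n) × (Fin n ⊕ Fin n)} (hp : p ∈ lowerPairs n) :
    (finSumFinEquiv p.2 : Fin (n + n)) < finSumFinEquiv p.1 := by
  rw [lowerPairs, pairsBefore, Finset.mem_filter] at hp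
  exact hp.2.2.1

variable (x : (Fin n ⊕ Fin n) × (Fin n ⊕ Fin n) → F)

/-- The matrix `lowerMat` for the positions `lowerPairs`. -/
def lowerPairsMat : Matrix (Fin n ⊕ Fin n) (Fin n ⊕ Fin n) F :=
  lowerMat finSumFinEquiv (lowerPairs n) x

theorem lowerPairsMat_apply (p q : Fin n ⊕ Fin n) : lowerPairsMat x p q =
    (1 : Matrix (Fin n ⊕ Fin n) (Fin n ⊕ Fin n) F) p q +
      if (p, q) ∈ lowerPairs n then x (p, q) else 0 := by
  rw [lowerPairsMat, lowerMat, Matrix.of_apply]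
  congr 1
  exact if_congr ⟨fun h => h.1, fun h => ⟨h, lt_of_mem_lowerPairs h⟩⟩ rfl rfl

theorem lowerPairsMat_inr_inr (i j : Fin n) : lowerPairsMat x (Sum.inr i) (Sum.inr j) =
    (1 : Matrix (Fin n) (Fin n) F) i j + if j < i then x (Sum.inr i, Sum.inr j) else 0 := by
  rw [lowerPairsMat_apply]
  simp only [inr_inr_mem_lowerPairs, Matrix.one_apply, Sum.inr.injEq]

theorem lowerPairsMat_inr_inl (i j : Fin n) : lowerPairsMat x (Sum.inr i) (Sum.inl j) =
    x (Sum.inr i, Sum.inl j) := by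
  rw [lowerPairsMat_apply, if_pos (inr_inl_mem_lowerPairs i j), Matrix.one_apply_ne (by simp),
    zero_add]

theorem lowerPairsMat_eq : lowerPairsMat x = fromBlocks 1 0 (toBlocks₂₁ (lowerPairsMat x))
    (toBlocks₂₂ (lowerPairsMat x)) := by
  ext p q
  rcases p with i | i <;> rcases q with j | j
  · rw [lowerPairsMat_apply, if_neg (inl_notMem_lowerPairs _ _), add_zero]
    simp [Matrix.one_apply]
  · rw [lowerPairsMat_apply, if_neg (inl_notMem_lowerPairs _ _), add_zero]
    simp
  · rfl
  · rfl

theorem det_toBlocks₂₂_lowerPairsMat : (toBlocks₂₂ (lowerPairsMat x)).det = 1 := by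
  have h : (lowerPairsMat x).det = 1 := det_lowerMat _ _ _
  rwa [lowerPairsMat_eq, det_fromBlocks_zero₁₂, det_one, one_mul] at h

/-- The matrix of the lower triangular (in the lower right block) unipotent element of `H` with
entries `x`. -/
def lowerHMat : Matrix (Fin n ⊕ Fin n) (Fin n ⊕ Fin n) F :=
  fromBlocks (w₀ n F * toBlocks₂₂ (lowerPairsMat x) * w₀ n F) 0 (toBlocks₂₁ (lowerPairsMat x))
    (toBlocks₂₂ (lowerPairsMat x))

theorem det_w₀_mul_det_w₀ : (w₀ n F).det * (w₀ n F).det = 1 := by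
  rw [← det_mul, w₀_mul_w₀, det_one]

theorem det_lowerHMat : (lowerHMat x).det = 1 := by
  rw [lowerHMat, det_fromBlocks_zero₁₂, det_mul, det_mul, det_toBlocks₂₂_lowerPairsMat, mul_one,
    mul_one, det_w₀_mul_det_w₀]

/-- The unipotent element of `H` whose lower half has entries `x`. -/
def lowerH : H n F where
  val :=
    { val := lowerHMat x
      inv := (lowerHMat x).adjugate
      val_inv := by rw [Matrix.mul_adjugate, det_lowerHMat, one_smul]
      inv_val := by rw [Matrix.adjugate_mul, det_lowerHMat, one_smul] }
  property := (coe_H_iff _).2 ⟨toBlocks_fromBlocks₁₂ _ _ _ _, by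
    change toBlocks₂₂ (lowerHMat x) = w₀ n F * toBlocks₁₁ (lowerHMat x) * w₀ n F
    rw [lowerHMat, toBlocks_fromBlocks₁₁, toBlocks_fromBlocks₂₂, mul_assoc, mul_assoc,
      w₀_mul_w₀, mul_one, ← mul_assoc, w₀_mul_w₀, one_mul]⟩

theorem lowerH_val : (lowerH x : G n F).val = lowerHMat x := rfl

theorem lowerH_inr_inr (i j : Fin n) : (lowerH x : G n F).val (Sum.inr i) (Sum.inr j) =
    (1 : Matrix (Fin n) (Fin n) F) i j + if j < i then x (Sum.inr i, Sum.inr j) else 0 :=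
  lowerPairsMat_inr_inr x i j

theorem lowerH_inr_inl (i j : Fin n) : (lowerH x : G n F).val (Sum.inr i) (Sum.inl j) =
    x (Sum.inr i, Sum.inl j) :=
  lowerPairsMat_inr_inl x i j

theorem lowerH_inl_inl (i j : Fin n) : (lowerH x : G n F).val (Sum.inl i) (Sum.inl j) =
    (lowerH x : G n F).val (Sum.inr (Fin.rev i)) (Sum.inr (Fin.rev j)) := by
  rw [val_inr_inr, Fin.rev_rev, Fin.rev_rev, val_inl_inl]

theorem topHom_lowerH_mem : topHom (lowerH x) ∈ unipotentGL F (Equiv.refl (Fin n)) := by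
  have h : ∀ i j, (topHom (lowerH x)).val i j = (1 : Matrix (Fin n) (Fin n) F)
      (Fin.rev i) (Fin.rev j) + if i < j then x (Sum.inr (Fin.rev i), Sum.inr (Fin.rev j))
        else 0 := by
    intro i j
    rw [← val_inl_inl, lowerH_inl_inl, lowerH_inr_inr]
    simp only [Fin.rev_lt_rev]
  refine ⟨fun i j hij => ?_, fun i => ?_⟩
  · have hij' : j < i := hij
    rw [h, if_neg hij'.not_gt, add_zero, Matrix.one_apply_ne]
    exact fun h => hij'.ne' (Fin.rev_injective h)
  · rw [h, if_neg (lt_irrefl i), add_zero, Matrix.one_apply_eq]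

/-- Every element of `H` with unipotent upper left block is of the form `lowerH x`. -/
theorem eq_lowerH {h : H n F} (hh : topHom h ∈ unipotentGL F (Equiv.refl (Fin n)))
    (hx : ∀ p ∈ lowerPairs n, x p = (h : G n F).val p.1 p.2) : lowerH x = h := by
  have h22 : ∀ i j, (lowerH x : G n F).val (Sum.inr i) (Sum.inr j) =
      (h : G n F).val (Sum.inr i) (Sum.inr j) := by
    intro i j
    rw [lowerH_inr_inr]
    rcases lt_trichotomy j i with hij | rfl | hij
    · rw [if_pos hij, Matrix.one_apply_ne hij.ne', zero_add,
        hx _ (inr_inr_mem_lowerPairs.2 hij)]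
    · rw [if_neg (lt_irrefl _), add_zero, Matrix.one_apply_eq, val_inr_inr, hh.2]
    · rw [if_neg hij.not_gt, Matrix.one_apply_ne hij.ne, add_zero, val_inr_inr]
      exact (hh.1 (show Fin.rev j < Fin.rev i from Fin.rev_lt_rev.2 hij)).symm
  ext p q
  rcases p with i | i <;> rcases q with j | j
  · rw [lowerH_inl_inl, h22, val_inr_inr, Fin.rev_rev, Fin.rev_rev, val_inl_inl]
  · rw [val_inl_inr, val_inl_inr]
  · rw [lowerH_inr_inl, hx _ (inr_inl_mem_lowerPairs i j)]
  · exact h22 i j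

theorem continuous_lowerH [TopologicalSpace F] [IsTopologicalRing F] :
    Continuous fun x : (Fin n ⊕ Fin n) × (Fin n ⊕ Fin n) → F => lowerH x := by
  have h0 : Continuous fun x : (Fin n ⊕ Fin n) × (Fin n ⊕ Fin n) → F => lowerPairsMat x :=
    Units.continuous_val.comp (continuous_lowerGL finSumFinEquiv (lowerPairs n))
  have h22 : Continuous fun x : (Fin n ⊕ Fin n) × (Fin n ⊕ Fin n) → F =>
      toBlocks₂₂ (lowerPairsMat x) := continuous_matrix fun i j => h0.matrix_elem _ _
  have h : Continuous fun x : (Fin n ⊕ Fin n) × (Fin n ⊕ Fin n) → F => lowerHMat x :=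
    Continuous.matrix_fromBlocks ((continuous_const.mul h22).mul continuous_const)
      continuous_const (continuous_matrix fun i j => h0.matrix_elem _ _) h22
  exact Continuous.subtype_mk (Units.continuous_iff.2 ⟨h, h.matrix_adjugate⟩) _

variable [ValuativeRel F] [TopologicalSpace F] [IsNonarchimedeanLocalField F]

/-- The two matrices differ on the left by a block diagonal unipotent upper triangular matrix, which
leaves all heights unchanged. This removes the dependence of the upper left block on the same
coordinates. -/
theorem spherical_lowerH (lam : Fin n ⊕ Fin n → ℝ) :
    spherical finSumFinEquiv lam (lowerH x : G n F) =
      spherical finSumFinEquiv lam (lowerGL finSumFinEquiv (lowerPairs n) x) := by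
  set L : G n F := lowerGL finSumFinEquiv (lowerPairs n) x with hL
  have hp : ((lowerH x : G n F) * L⁻¹).val =
      fromBlocks (w₀ n F * toBlocks₂₂ (lowerPairsMat x) * w₀ n F) 0 0 1 := by
    have h1 : (lowerH x : G n F).val =
        fromBlocks (w₀ n F * toBlocks₂₂ (lowerPairsMat x) * w₀ n F) 0 0 1 * L.val := by
      have : L.val = lowerPairsMat x := rfl
      rw [this, lowerPairsMat_eq, lowerH_val, fromBlocks_multiply, lowerHMat]
      simp
    rw [Units.val_mul, h1, mul_assoc, ← Units.val_mul, mul_inv_cancel, Units.val_one, mul_one]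
  have h11 : ∀ i j, (w₀ n F * toBlocks₂₂ (lowerPairsMat x) * w₀ n F) i j =
      (topHom (lowerH x)).val i j := by
    intro i j
    rw [mul_w₀_apply, w₀_mul_apply, ← val_inl_inl, lowerH_inl_inl]
    rfl
  have hb : (lowerH x : G n F) * L⁻¹ ∈ borelGL F (finSumFinEquiv (m := n) (n := n)) := by
    rintro p q hpq
    rw [hp]
    rw [finSumFinEquiv_lt_iff] at hpq
    rcases p with i | i <;> rcases q with j | j
    · rw [fromBlocks_apply₁₁, h11]
      exact (topHom_lowerH_mem x).1 (Sum.Lex.inl_lt_inl_iff.1 hpq)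
    · rfl
    · rfl
    · rw [fromBlocks_apply₂₂, Matrix.one_apply_ne]
      rintro rfl
      exact lt_irrefl _ hpq
  have hdiag : ∀ i, ((lowerH x : G n F) * L⁻¹).val i i = 1 := by
    intro i
    rw [hp]
    rcases i with i | i
    · rw [fromBlocks_apply₁₁, h11]
      exact (topHom_lowerH_mem x).2 i
    · simp
  have h2 : (lowerH x : G n F) = ((lowerH x : G n F) * L⁻¹) * L := by group
  rw [h2, spherical, spherical]
  refine Finset.prod_congr rfl fun i _ => ?_
  rw [height_borel_mul hb, hdiag, absF_one, one_mul]

/-- Every other entry is 0, 1 or a copy of a free one, and the determinant is 1. -/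
theorem mem_integralGL_of_lowerPairs {h : H n F}
    (hh : topHom h ∈ unipotentGL F (Equiv.refl (Fin n)))
    (hx : ∀ p ∈ lowerPairs n, absF ((h : G n F).val p.1 p.2) ≤ 1) :
    (h : G n F) ∈ integralGL (Fin n ⊕ Fin n) F := by
  have h22 : ∀ i j, absF ((h : G n F).val (Sum.inr i) (Sum.inr j)) ≤ 1 := by
    intro i j
    rcases lt_trichotomy j i with hij | rfl | hij
    · exact hx _ (inr_inr_mem_lowerPairs.2 hij)
    · rw [val_inr_inr, hh.2, absF_one]
    · have h0 : (topHom h).val (Fin.rev i) (Fin.rev j) = 0 :=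
        hh.1 (show Fin.rev j < Fin.rev i from Fin.rev_lt_rev.2 hij)
      rw [val_inr_inr, h0, absF_zero]
      exact zero_le_one
  refine mem_integralGL_of_det ?_ ?_
  · rintro (i | i) (j | j)
    · have := h22 (Fin.rev i) (Fin.rev j)
      rwa [val_inr_inr, Fin.rev_rev, Fin.rev_rev] at this
    · rw [val_inl_inr, absF_zero]; exact zero_le_one
    · exact hx _ (inr_inl_mem_lowerPairs i j)
    · exact h22 i j
  · rw [← eq_lowerH (fun p => (h : G n F).val p.1 p.2) hh fun _ _ => rfl, lowerH_val,
      det_lowerHMat, absF_one]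

/-- The map `lowerH` on families indexed by the free positions. -/
def lowerHOf (y : lowerPairs n → F) : H n F := lowerH (Function.updateFinset 0 (lowerPairs n) y)

theorem continuous_lowerHOf : Continuous (lowerHOf : (lowerPairs n → F) → H n F) := by
  refine continuous_lowerH.comp (continuous_pi fun p => ?_)
  by_cases hp : p ∈ lowerPairs n
  · simpa [Function.updateFinset, hp] using continuous_apply _
  · simpa [Function.updateFinset, hp] using continuous_const

theorem exists_lowerHOf {h : H n F} (hh : topHom h ∈ unipotentGL F (Equiv.refl (Fin n))) :
    ∃ y, lowerHOf y = h :=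
  ⟨fun s => (h : G n F).val s.1.1 s.1.2, eq_lowerH _ hh fun p hp => by
    simp [Function.updateFinset, hp]⟩

variable [MeasurableSpace F] [BorelSpace F] (μ : Measure F) [μ.IsAddHaarMeasure]

/-- The case of the identity permutation, with `B` selecting the last n indices: only pairs whose
larger index lies there enter, so dominance is required for these alone. -/
theorem lintegral_spherical_lowerHOf_lt_top {lam : Fin n ⊕ Fin n → ℝ}
    (hlam : ∀ (i : Fin n ⊕ Fin n) (j : Fin n), toLex i < toLex (Sum.inr j) →
      lam (Sum.inr j) < lam i) :
    ∫⁻ y, ENNReal.ofReal (spherical finSumFinEquiv lam (lowerHOf (F := F) (n := n) y : G n F))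
      ∂Measure.pi (fun _ => μ) < ∞ := by
  have h := lmarginal_spherical_lowerGL_lt_top (F := F) (b := finSumFinEquiv) μ
    (B := fun i : Fin n ⊕ Fin n => i.isRight = true) (lam := lam) ?_ ?_ 1 0
  · have h1 : permGL F (1 : Equiv.Perm (Fin n ⊕ Fin n)) = 1 := by
      ext1; exact Matrix.permMatrix_one
    refine lt_of_eq_of_lt (lintegral_congr fun y => ?_) h
    refine congrArg _ ((spherical_lowerH _ _).trans ?_)
    rw [← one_mul (lowerGL _ _ _), ← h1]
    rfl
  · rintro (i | i) (j | j) hi hij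
    · simp at hi
    · rfl
    · exact absurd hij (not_le.2 ((finSumFinEquiv_lt_iff _ _).2 (Sum.Lex.inl_lt_inr _ _)))
    · rfl
  · rintro i (j | j) hj hij
    · simp at hj
    · exact hlam i j ((finSumFinEquiv_lt_iff _ _).1 hij)

end Unipotent

/-! ### Left translations in unipotent coordinates -/

section Translation

variable {n : ℕ} {F : Type*} [Field F]

/-- A rank function on the positions of the entries, for which left translations by unipotent
elements of `H` are triangular. -/
def entryRank (p : (Fin n ⊕ Fin n) × (Fin n ⊕ Fin n)) : ℕ :=
  Sum.elim (fun _ : Fin n => 0) (fun i : Fin n => (i : ℕ)) p.1 +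
    Sum.elim (fun _ : Fin n => n) (fun _ : Fin n => 0) p.2

theorem lowerHOf_inr_congr {x y : lowerPairs n → F} (k : Fin n) (q : Fin n ⊕ Fin n)
    (h : ∀ s : lowerPairs n, entryRank s.1 ≤ entryRank (Sum.inr k, q) → x s = y s) :
    (lowerHOf x : G n F).val (Sum.inr k) q = (lowerHOf y : G n F).val (Sum.inr k) q := by
  have h1 : ∀ x : lowerPairs n → F, (lowerHOf x : G n F).val (Sum.inr k) q =
      lowerPairsMat (Function.updateFinset 0 (lowerPairs n) x) (Sum.inr k) q := by
    intro x
    cases q <;> rfl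
  rw [h1, h1, lowerPairsMat_apply, lowerPairsMat_apply]
  congr 1
  split_ifs with hm
  · simp only [Function.updateFinset, hm, dif_pos]
    exact h ⟨_, hm⟩ le_rfl
  · rfl

/-- Left translation by a unipotent element of `H` is triangular in the coordinates. -/
theorem translation_sub_congr {u : H n F} (hu : topHom u ∈ unipotentGL F (Equiv.refl (Fin n)))
    {x y : lowerPairs n → F} (s : lowerPairs n)
    (h : ∀ t : lowerPairs n, entryRank t.1 < entryRank s.1 → x t = y t) :
    ((u * lowerHOf x : H n F) : G n F).val s.1.1 s.1.2 - x s =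
      ((u * lowerHOf y : H n F) : G n F).val s.1.1 s.1.2 - y s := by
  obtain ⟨⟨p, q⟩, hs⟩ := s
  rcases p with i | i
  · exact absurd hs (inl_notMem_lowerPairs _ _)
  have huu : ∀ k, i ≤ k → (u : G n F).val (Sum.inr i) (Sum.inr k) = if k = i then 1 else 0 := by
    intro k hk
    rw [val_inr_inr]
    split_ifs with hki
    · subst hki; exact hu.2 _
    · exact hu.1 (show Fin.rev k < Fin.rev i from
        Fin.rev_lt_rev.2 (lt_of_le_of_ne hk (Ne.symm hki)))
  have hval : ∀ z : lowerPairs n → F, (lowerHOf z : G n F).val (Sum.inr i) q =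
      ((lowerHOf (0 : lowerPairs n → F) : H n F) : G n F).val (Sum.inr i) q + z ⟨(Sum.inr i, q), hs⟩ := by
    have h1 : ∀ x : lowerPairs n → F, (lowerHOf x : G n F).val (Sum.inr i) q =
        lowerPairsMat (Function.updateFinset 0 (lowerPairs n) x) (Sum.inr i) q := by
      intro x
      cases q <;> rfl
    intro z
    rw [h1, h1, lowerPairsMat_apply, lowerPairsMat_apply, if_pos hs, if_pos hs]
    simp [Function.updateFinset, hs]
  have hlow : ∀ k, k < i → (lowerHOf x : G n F).val (Sum.inr k) q =
      (lowerHOf y : G n F).val (Sum.inr k) q := by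
    intro k hk
    refine lowerHOf_inr_congr k q fun t ht => h t (lt_of_le_of_lt ht ?_)
    simpa [entryRank] using hk
  -- The upper left block repeats lower right entries, of rank below n. They contribute only to
  -- lower left positions, whose rank is at least n.
  have hinl : ∀ k, (lowerHOf x : G n F).val (Sum.inl k) q =
      (lowerHOf y : G n F).val (Sum.inl k) q := by
    intro k
    rcases q with j | j
    · rw [lowerHOf, lowerHOf, lowerH_inl_inl, lowerH_inl_inl]
      refine lowerHOf_inr_congr _ _ fun t ht => h t (lt_of_le_of_lt ht ?_)
      have := (Fin.rev k).2
      simp only [entryRank, Sum.elim_inr, Sum.elim_inl]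
      omega
    · rw [val_inl_inr, val_inl_inr]
  have hsum : ∀ z : lowerPairs n → F, ((u * lowerHOf z : H n F) : G n F).val (Sum.inr i) q =
      ∑ k, (u : G n F).val (Sum.inr i) (Sum.inl k) * (lowerHOf z : G n F).val (Sum.inl k) q +
      ∑ k, (u : G n F).val (Sum.inr i) (Sum.inr k) *
        (lowerHOf z : G n F).val (Sum.inr k) q := by
    intro z
    rw [Subgroup.coe_mul, Units.val_mul, Matrix.mul_apply, Fintype.sum_sum_type]
  have hsplit : ∀ z : lowerPairs n → F, ∑ k, (u : G n F).val (Sum.inr i) (Sum.inr k) *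
      (lowerHOf z : G n F).val (Sum.inr k) q = (lowerHOf z : G n F).val (Sum.inr i) q +
      ∑ k, if k < i then (u : G n F).val (Sum.inr i) (Sum.inr k) *
        (lowerHOf z : G n F).val (Sum.inr k) q else 0 := by
    intro z
    have h2 : (lowerHOf z : G n F).val (Sum.inr i) q =
        ∑ k, if k = i then (lowerHOf z : G n F).val (Sum.inr k) q else 0 := by simp
    rw [h2, ← Finset.sum_add_distrib]
    refine Finset.sum_congr rfl fun k _ => ?_
    rcases lt_or_ge k i with hk | hk
    · rw [if_neg hk.ne, if_pos hk, zero_add]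
    · rw [huu k hk, if_neg hk.not_gt, add_zero, ite_mul, one_mul, zero_mul]
  have e1 : ∑ k, (u : G n F).val (Sum.inr i) (Sum.inl k) * (lowerHOf x : G n F).val (Sum.inl k) q
      = ∑ k, (u : G n F).val (Sum.inr i) (Sum.inl k) * (lowerHOf y : G n F).val (Sum.inl k) q :=
    Finset.sum_congr rfl fun k _ => by rw [hinl]
  have e2 : (∑ k, if k < i then (u : G n F).val (Sum.inr i) (Sum.inr k) *
        (lowerHOf x : G n F).val (Sum.inr k) q else 0) =
      ∑ k, if k < i then (u : G n F).val (Sum.inr i) (Sum.inr k) *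
        (lowerHOf y : G n F).val (Sum.inr k) q else 0 := by
    refine Finset.sum_congr rfl fun k _ => ?_
    split_ifs with hk
    · rw [hlow k hk]
    · rfl
  dsimp only
  rw [hsum, hsum, hsplit, hsplit, hval x, hval y, e1, e2]
  ring

variable [ValuativeRel F] [TopologicalSpace F] [IsNonarchimedeanLocalField F]

variable (n F) in
/-- The integral elements of `H`. -/
def integralH : Subgroup (H n F) := (integralGL (Fin n ⊕ Fin n) F).subgroupOf (H n F)

theorem isOpen_integralH : IsOpen (integralH n F : Set (H n F)) :=
  (isOpen_integralGL _ F).preimage continuous_subtype_val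

theorem isCompact_integralH : IsCompact (integralH n F : Set (H n F)) :=
  (isClosed_H n F).isClosedEmbedding_subtypeVal.isCompact_preimage (isCompact_integralGL _ F)

variable (n F) in
/-- The elements of `H` whose upper left block has all heights `1`. -/
def heightOne : Set (H n F) := {h | ∀ i, height (Equiv.refl (Fin n)) (topHom h) i = 1}

theorem isClopen_heightOne : IsClopen (heightOne n F) := by
  have h : heightOne n F =
      ⋂ i, {h : H n F | height (Equiv.refl (Fin n)) (topHom h) i = 1} := by
    ext h; simp [heightOne]
  rw [h]
  exact isClopen_iInter_of_finite fun i => ((isLocallyConstant_height i).comp_continuous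
    continuous_topHom).isClopen_fiber 1

/-- With g = p k for p unipotent and k integral, `mkH g X` splits as `mkH p (k X k⁻¹) * mkH k 0`,
whose first factor is unipotent. -/
theorem exists_lowerHOf_mul_integral {a : H n F} (ha : a ∈ heightOne n F) :
    ∃ y, (lowerHOf y)⁻¹ * a ∈ integralH n F := by
  obtain ⟨g, X, rfl⟩ := exists_mkH a
  obtain ⟨p, hp, k, hk, hgk⟩ := exists_unipotent_mul_integral (Equiv.refl (Fin n)) ha
  rw [topHom_mkH] at hgk
  obtain ⟨y, hy⟩ := exists_lowerHOf (h := mkH p (k.val * X * (k⁻¹).val)) (by rwa [topHom_mkH])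
  refine ⟨y, ?_⟩
  have h1 : mkH g X = mkH p (k.val * X * (k⁻¹).val) * mkH k 0 := by
    rw [mkH_mul, hgk, add_zero, mul_assoc k.val, ← mul_assoc, ← Units.val_mul, inv_mul_cancel,
      Units.val_one, one_mul, mul_assoc, ← Units.val_mul, inv_mul_cancel, Units.val_one, mul_one]
  rw [hy, h1, inv_mul_cancel_left]
  exact mkH_mem_integralGL hk (by simp)

variable [MeasurableSpace F] [BorelSpace F] (μ : Measure F) [μ.IsAddHaarMeasure]

/-- Supplies a lower bound uniform in `a` for the comparison. If `a` lies in u·`integralH` with u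
unipotent, it suffices that u⁻¹·`lowerHOf y` have integral coordinates. The passage from y to these
coordinates is triangular, so it preserves the measure. -/
theorem measure_integral_le {a : H n F} (ha : a ∈ heightOne n F) :
    Measure.pi (fun _ : lowerPairs n => μ) {y | ∀ s, absF (y s) ≤ 1} ≤
      Measure.pi (fun _ : lowerPairs n => μ) {y | a⁻¹ * lowerHOf y ∈ integralH n F} := by
  obtain ⟨y₀, hy₀⟩ := exists_lowerHOf_mul_integral ha
  set u := lowerHOf y₀ with hu
  have hutop : topHom u⁻¹ ∈ unipotentGL F (Equiv.refl (Fin n)) := by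
    rw [map_inv]; exact inv_mem (topHom_lowerH_mem _)
  have hO : MeasurableSet {y : lowerPairs n → F | ∀ s, absF (y s) ≤ 1} := by
    have : {y : lowerPairs n → F | ∀ s, absF (y s) ≤ 1} = ⋂ s, {y | absF (y s) ≤ 1} := by
      ext; simp
    rw [this]
    exact MeasurableSet.iInter fun s =>
      ((isClosed_absF_le 1).preimage (continuous_apply s)).measurableSet
  have hcont : ∀ s : lowerPairs n, Continuous fun y : lowerPairs n → F =>
      ((u⁻¹ * lowerHOf y : H n F) : G n F).val s.1.1 s.1.2 := fun s =>
    (Units.continuous_val.comp (continuous_subtype_val.comp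
      (continuous_const.mul continuous_lowerHOf))).matrix_elem _ _
  rw [← lintegral_indicator_one hO, ← lintegral_pi_triangular μ (fun s => entryRank s.1)
    (p := fun y s => ((u⁻¹ * lowerHOf y : H n F) : G n F).val s.1.1 s.1.2 - y s)
    (fun s => ((hcont s).sub (continuous_apply s)).measurable)
    (fun s x y h => translation_sub_congr hutop s h) (measurable_one.indicator hO)]
  have hK : MeasurableSet {y : lowerPairs n → F | a⁻¹ * lowerHOf y ∈ integralH n F} :=
    (isOpen_integralH.preimage (continuous_const.mul continuous_lowerHOf)).measurableSet
  rw [← lintegral_indicator_one hK]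
  refine lintegral_mono fun y => ?_
  by_cases hy : ∀ s : lowerPairs n,
      absF (((u⁻¹ * lowerHOf y : H n F) : G n F).val s.1.1 s.1.2) ≤ 1
  · have h1 : u⁻¹ * lowerHOf y ∈ integralH n F := by
      refine mem_integralGL_of_lowerPairs ?_ fun p hp => hy ⟨p, hp⟩
      rw [map_mul]
      exact mul_mem hutop (topHom_lowerH_mem _)
    have h2 : a⁻¹ * lowerHOf y ∈ integralH n F := by
      have h3 : a⁻¹ * lowerHOf y = (u⁻¹ * a)⁻¹ * (u⁻¹ * lowerHOf y) := by group
      rw [h3]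
      exact mul_mem (inv_mem hy₀) h1
    rw [Set.indicator_of_mem (s := {y | a⁻¹ * lowerHOf y ∈ integralH n F}) h2]
    exact Set.indicator_le_self _ _ _
  · rw [Set.indicator_of_notMem]
    · exact zero_le
    · intro h
      refine hy fun s => ?_
      have := h s
      dsimp only at this
      rwa [add_sub_cancel] at this

end Translation

/-! ### The weight on H, and finiteness of the spherical integral -/

section Weight

variable {n : ℕ} {F : Type*} [Field F] [ValuativeRel F] [TopologicalSpace F]
  [IsNonarchimedeanLocalField F]

theorem mem_integralH_iff_of_mem_PH {t : H n F} (ht : t ∈ PH n F) :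
    t ∈ integralH n F ↔ ∀ i, absF ((topHom t).val i i) = 1 := by
  obtain ⟨d, hd, rfl⟩ := (mem_PH_iff t).1 ht
  have hdv : d.val = diagonal fun i => d.val i i := by
    ext i j
    by_cases hij : i = j
    · subst hij; simp
    · rw [diagonal_apply_ne _ hij, hd i j hij]
  constructor
  · intro h i
    exact absF_diag_eq_one ((mem_P_iff _).1 ht) h (Sum.inl i)
  · intro h
    rw [topHom_mkH] at h
    refine mkH_mem_integralGL (mem_integralGL_of_det (fun i j => ?_) ?_) (by simp)
    · by_cases hij : i = j
      · subst hij; exact (h i).le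
      · rw [hd i j hij, absF_zero]; exact zero_le_one
    · rw [hdv, det_diagonal, absF_prod]
      exact Finset.prod_eq_one fun i _ => h i

theorem height_topHom_mul {t : H n F} (ht : t ∈ PH n F) (h : H n F) (i : Fin n) :
    height (Equiv.refl (Fin n)) (topHom (t * h)) i =
      absF ((topHom t).val i i) * height (Equiv.refl (Fin n)) (topHom h) i := by
  obtain ⟨d, hd, rfl⟩ := (mem_PH_iff t).1 ht
  rw [map_mul, topHom_mkH, height_borel_mul]
  exact fun i j hij => hd i j (ne_of_gt hij)

theorem exists_PH_absF_eq_height (h : H n F) : ∃ t : PH n F, ∀ i,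
    absF ((topHom (t : H n F)).val i i) = height (Equiv.refl (Fin n)) (topHom h) i := by
  obtain ⟨p, hp, k, hk, hpk⟩ := exists_iwasawa (Equiv.refl (Fin n)) (topHom h)
  refine ⟨⟨mkH (diagGL fun i => Units.mk0 (p.val i i) (borelGL_diag_ne_zero hp i)) 0,
    (mem_PH_iff _).2 ⟨_, fun i j hij => ?_, rfl⟩⟩, fun i => ?_⟩
  · rw [diagGL_val, diagonal_apply_ne _ hij]
  · rw [hpk, height_mul hp hk, topHom_mkH, diagGL_val, diagonal_apply_eq]
    rfl

variable [MeasurableSpace (GL (Fin n ⊕ Fin n) F)] [BorelSpace (GL (Fin n ⊕ Fin n) F)]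
  (dt : Measure (PH n F)) [dt.IsHaarMeasure]

/-- The comparison with K = `integralH`, `u = lowerHOf` and v the volume of the unit box reduces
this to the unipotent integral. -/
theorem setLIntegral_spherical_heightOne_lt_top
    (dh : Measure (H n F)) [dh.IsHaarMeasure]
    {lam : Fin n ⊕ Fin n → ℝ}
    (hlam : ∀ (i : Fin n ⊕ Fin n) (j : Fin n), toLex i < toLex (Sum.inr j) →
      lam (Sum.inr j) < lam i) :
    ∫⁻ h in heightOne n F, ENNReal.ofReal (spherical finSumFinEquiv lam (h : G n F)) ∂dh < ∞ := by
  let : MeasurableSpace F := borel F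
  have : BorelSpace F := ⟨rfl⟩
  let μ : Measure F := Measure.addHaar
  refine setLIntegral_lt_top_of_le_measure (K := integralH n F) (u := lowerHOf)
    (ν := Measure.pi fun _ : lowerPairs n => μ) isOpen_integralH.measurableSet
    isCompact_integralH.measure_lt_top continuous_lowerHOf.measurable
    isClopen_heightOne.1.measurableSet ?_ (fun a ha => measure_integral_le μ ha) ?_ ?_
    (lintegral_spherical_lowerHOf_lt_top μ hlam)
  · have h : {y : lowerPairs n → F | ∀ s, absF (y s) ≤ 1} =
        Set.univ.pi fun _ => {x : F | absF x ≤ 1} := by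
      ext; simp
    rw [h, Measure.pi_pi]
    exact Finset.prod_ne_zero_iff.2 fun _ _ => measure_absF_le_ne_zero μ one_pos
  · exact ((isLocallyConstant_spherical lam).continuous.comp
      continuous_subtype_val).measurable.ennreal_ofReal
  · intro a k hk
    rw [Subgroup.coe_mul]
    exact congrArg _ (spherical_mul_integral lam (a : G n F) hk)

/-- The weight on `H` which is supported on the elements whose upper left block has all
heights `1`. -/
noncomputable def heightWeight : H n F → ℝ≥0∞ :=
  (heightOne n F).indicator fun _ => (dt ((integralH n F).subgroupOf (PH n F)))⁻¹

theorem measure_integralPH_ne_zero : dt ((integralH n F).subgroupOf (PH n F)) ≠ 0 :=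
  (IsOpen.measure_pos dt (isOpen_integralH.preimage continuous_subtype_val)
    ⟨1, one_mem ((integralH n F).subgroupOf (PH n F))⟩).ne'

theorem measure_integralPH_ne_top : dt ((integralH n F).subgroupOf (PH n F)) ≠ ∞ :=
  ((isClosed_PH n F).isClosedEmbedding_subtypeVal.isCompact_preimage
    isCompact_integralH).measure_lt_top.ne

/-- Choose a torus element s with the heights of a. Then t a lies in `heightOne` exactly when t s is
an integral torus element, so by invariance each coset contributes the volume used for
normalization. -/
theorem isWeight_heightWeight : IsWeight dt (heightWeight dt) where
  measurable := measurable_const.indicator isClopen_heightOne.1.measurableSet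
  lintegral_eq_one a := by
    obtain ⟨s, hs⟩ := exists_PH_absF_eq_height a
    have hO : MeasurableSet ((integralH n F).subgroupOf (PH n F) : Set (PH n F)) :=
      (isOpen_integralH.preimage continuous_subtype_val).measurableSet
    have h1 : ∀ t : PH n F, heightWeight dt ((t : H n F) * a) =
        (dt ((integralH n F).subgroupOf (PH n F)))⁻¹ *
          ((integralH n F).subgroupOf (PH n F) : Set (PH n F)).indicator 1 (t * s) := by
      intro t
      have h2 : (t : H n F) * a ∈ heightOne n F ↔ t * s ∈ (integralH n F).subgroupOf (PH n F) := by
        rw [Subgroup.mem_subgroupOf, mem_integralH_iff_of_mem_PH (t * s).2]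
        refine forall_congr' fun i => ?_
        rw [height_topHom_mul t.2, ← hs i, Subgroup.coe_mul]
        have h3 := height_topHom_mul t.2 (s : H n F) i
        have hb : ∀ r : PH n F, topHom (r : H n F) ∈ borelGL F (Equiv.refl (Fin n)) := by
          intro r
          obtain ⟨d, hd, hr⟩ := (mem_PH_iff _).1 r.2
          rw [hr, topHom_mkH]
          exact fun i j hij => hd i j (ne_of_gt hij)
        rw [height_borel (hb s), ← Subgroup.coe_mul, height_borel (hb (t * s))] at h3
        rw [← h3, Subgroup.coe_mul]
      by_cases h : (t : H n F) * a ∈ heightOne n F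
      · rw [heightWeight, Set.indicator_of_mem h, Set.indicator_of_mem (h2.1 h), Pi.one_apply,
          mul_one]
      · rw [heightWeight, Set.indicator_of_notMem h,
          Set.indicator_of_notMem (fun h' => h (h2.2 h')), mul_zero]
    simp_rw [h1]
    rw [lintegral_mul_right_eq_self (fun t => (dt ((integralH n F).subgroupOf (PH n F)))⁻¹ *
      ((integralH n F).subgroupOf (PH n F) : Set (PH n F)).indicator 1 t) s,
      lintegral_const_mul _ (measurable_one.indicator hO), lintegral_indicator_one hO,
      ENNReal.inv_mul_cancel (measure_integralPH_ne_zero dt) (measure_integralPH_ne_top dt)]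

theorem lintegral_spherical_withDensity_lt_top (dh : Measure (H n F)) [dh.IsHaarMeasure]
    {lam : Fin n ⊕ Fin n → ℝ}
    (hlam : ∀ (i : Fin n ⊕ Fin n) (j : Fin n), toLex i < toLex (Sum.inr j) →
      lam (Sum.inr j) < lam i) :
    ∫⁻ h, ENNReal.ofReal (spherical finSumFinEquiv lam (h : G n F))
      ∂dh.withDensity (heightWeight dt) < ∞ := by
  have hE : MeasurableSet (heightOne n F) := isClopen_heightOne.1.measurableSet
  have hm : Measurable fun h : H n F =>
      ENNReal.ofReal (spherical finSumFinEquiv lam (h : G n F)) :=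
    ((isLocallyConstant_spherical lam).continuous.comp
      continuous_subtype_val).measurable.ennreal_ofReal
  rw [heightWeight, withDensity_indicator hE, withDensity_const, lintegral_smul_measure]
  exact ENNReal.mul_lt_top (ENNReal.inv_lt_top.2 (measure_integralPH_ne_zero dt).bot_lt)
    (setLIntegral_spherical_heightOne_lt_top dh hlam)

end Weight

/-! ### Convergence and equivariance of the period -/

section Bound

variable {n : ℕ} {F : Type*} [Field F] [ValuativeRel F] [TopologicalSpace F]
  [IsNonarchimedeanLocalField F]

/-- The exponents of the character `χ δ^{1/2}` of `P`. -/
noncomputable def charExp (z : Fin n → ℂ) (i : Fin n ⊕ Fin n) : ℂ :=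
  Sum.elim z (fun j => -z (Fin.rev j)) i +
    (((2 * n - 1) / 2 - ((finSumFinEquiv i : Fin (n + n)) : ℕ) : ℝ) : ℂ)

theorem P_diag_ne_zero {p : G n F} (hp : p ∈ P n F) (i : Fin n ⊕ Fin n) : p.val i i ≠ 0 :=
  borelGL_diag_ne_zero ((mem_P_iff p).1 hp) i

theorem sqrt_delta (p : G n F) : Real.sqrt (delta p) =
    ∏ i, absF (p.val i i) ^ ((2 * n - 1) / 2 - ((finSumFinEquiv i : Fin (n + n)) : ℕ) : ℝ) := by
  rw [delta, Real.sqrt_eq_rpow, ← Real.finsetProd_rpow _ _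
    fun i _ => zpow_nonneg (absF_nonneg _) _]
  refine Finset.prod_congr rfl fun i _ => ?_
  rw [← Real.rpow_intCast, ← Real.rpow_mul (absF_nonneg _)]
  congr 1
  push_cast
  ring

theorem chi_mul_sqrt_delta (z : Fin n → ℂ) {p : G n F} (hp : p ∈ P n F) :
    chi z p * (Real.sqrt (delta p) : ℂ) = ∏ i, (absF (p.val i i) : ℂ) ^ charExp z i := by
  rw [sqrt_delta, chi, Complex.ofReal_prod, ← Finset.prod_mul_distrib]
  refine Finset.prod_congr rfl fun i _ => ?_
  rw [charExp, Complex.cpow_add _ _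
    (by exact_mod_cast (absF_pos (P_diag_ne_zero hp i)).ne'), Complex.ofReal_cpow (absF_nonneg _)]

/-- The real exponents of `χ δ^{1/2}`, shifted by the position. -/
noncomputable def charExpRe (z : Fin n → ℂ) (i : Fin n ⊕ Fin n) : ℝ :=
  Sum.elim (fun j => (z j).re) (fun j => -(z (Fin.rev j)).re) i + (2 * n - 1) / 2

theorem charExp_re (z : Fin n → ℂ) (i : Fin n ⊕ Fin n) :
    (charExp z i).re = charExpRe z i - ((finSumFinEquiv i : Fin (n + n)) : ℕ) := by
  rw [charExp, charExpRe, Complex.add_re, Complex.ofReal_re]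
  cases i <;> simp <;> ring

theorem norm_chi_mul_sqrt_delta (z : Fin n → ℂ) {p : G n F} (hp : p ∈ P n F) :
    ‖chi z p * (Real.sqrt (delta p) : ℂ)‖ = spherical finSumFinEquiv (charExpRe z) p := by
  rw [chi_mul_sqrt_delta z hp, norm_prod, spherical]
  refine Finset.prod_congr rfl fun i _ => ?_
  rw [Complex.norm_cpow_eq_rpow_re_of_pos (absF_pos (P_diag_ne_zero hp i)), charExp_re,
    height_borel ((mem_P_iff p).1 hp)]

/-- φ is bounded on the compact group GL(𝔬), and on p k both sides scale by the absolute value of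
χδ^{1/2}(p). -/
theorem exists_norm_le_spherical {z : Fin n → ℂ} (φ : I F z) :
    ∃ C : ℝ, ∀ g, ‖φ.1 g‖ ≤ C * spherical finSumFinEquiv (charExpRe z) g := by
  obtain ⟨C, hC⟩ := (isCompact_integralGL (Fin n ⊕ Fin n) F).exists_bound_of_continuousOn
    φ.2.1.continuous.continuousOn
  refine ⟨C, fun g => ?_⟩
  obtain ⟨p, hp, k, hk, rfl⟩ := exists_iwasawa (finSumFinEquiv (m := n) (n := n)) g
  have hp' := (mem_P_iff p).2 hp
  rw [φ.2.2 p hp', norm_mul, norm_chi_mul_sqrt_delta z hp', spherical_mul_integral _ _ hk,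
    mul_comm]
  exact mul_le_mul_of_nonneg_right (hC k hk) (spherical_pos _ _).le

theorem norm_PsiH (ψ : AddChar F Circle) (h : H n F) : ‖PsiH ψ h‖ = 1 := by
  rw [PsiH, Psi, Circle.norm_coe]

/-- For an index in the first half the difference is a sum of two positive Re z; within the second
half, monotonicity of Re z applies, reversed twice. -/
theorem charExpRe_lt {z : Fin n → ℂ} (hz : ∀ i j : Fin n, i < j → (z j).re < (z i).re)
    (hpos : ∀ i : Fin n, 0 < (z i).re) (i : Fin n ⊕ Fin n) (j : Fin n)
    (hij : toLex i < toLex (Sum.inr j)) : charExpRe z (Sum.inr j) < charExpRe z i := by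
  simp only [charExpRe]
  rcases i with i | i
  · have h1 := hpos i
    have h2 := hpos (Fin.rev j)
    simp only [Sum.elim_inl, Sum.elim_inr]
    linarith
  · have h1 := hz _ _ (Fin.rev_lt_rev.2 (Sum.Lex.inr_lt_inr_iff.1 hij))
    simp only [Sum.elim_inr]
    linarith

theorem periodIntegrand_cosetMk (ψ : AddChar F Circle) {z : Fin n → ℂ} (φ : I F z) (h : H n F) :
    periodIntegrand ψ φ (cosetMk (PH n F) h) = φ.1 (h : G n F) * (PsiH ψ h)⁻¹ := rfl

variable [MeasurableSpace (GL (Fin n ⊕ Fin n) F)] [BorelSpace (GL (Fin n ⊕ Fin n) F)]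

theorem measurable_periodIntegrand {ψ : AddChar F Circle} (hψ : Continuous ψ) {z : Fin n → ℂ}
    (φ : I F z) : Measurable (periodIntegrand ψ φ) := by
  refine measurable_from_quotient.2 ?_
  have h : Continuous fun h : H n F => φ.1 (h : G n F) * (PsiH ψ h)⁻¹ :=
    (φ.2.1.continuous.comp continuous_subtype_val).mul
      ((continuous_PsiH hψ).inv₀ fun h h0 => by simpa [h0] using norm_PsiH ψ h)
  exact h.measurable

variable {dh : Measure (H n F)} [dh.IsHaarMeasure] {dt : Measure (PH n F)} [dt.IsHaarMeasure]
  {dq : Measure (Quo n F)}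

theorem integrable_periodIntegrand {ψ : AddChar F Circle} (hψ : Continuous ψ) {z : Fin n → ℂ}
    (hz : ∀ i j : Fin n, i < j → (z j).re < (z i).re) (hpos : ∀ i : Fin n, 0 < (z i).re)
    (hdq : IsQuotientMeasure (PH n F) dh dt dq) (φ : I F z) :
    Integrable (periodIntegrand ψ φ) dq := by
  have hm := measurable_periodIntegrand hψ φ
  -- The explicit form of `dq` turns the integral over the quotient into one over `H` with density
  -- `heightWeight dt`.
  rw [hdq.eq_map (isWeight_heightWeight dt),
    integrable_map_measure hm.aestronglyMeasurable measurable_cosetMk.aemeasurable]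
  refine ⟨(hm.comp measurable_cosetMk).aestronglyMeasurable, ?_⟩
  obtain ⟨C, hC⟩ := exists_norm_le_spherical φ
  have hlt := lintegral_spherical_withDensity_lt_top dt dh (charExpRe_lt hz hpos)
  refine lt_of_le_of_lt (lintegral_mono fun h => ?_)
    (lt_of_eq_of_lt (lintegral_const_mul' (ENNReal.ofReal C) _ ENNReal.ofReal_ne_top)
      (ENNReal.mul_lt_top ENNReal.ofReal_lt_top hlt))
  rw [Function.comp, periodIntegrand_cosetMk, ← ENNReal.ofReal_mul' (spherical_pos _ _).le,
    ← ofReal_norm, norm_mul, norm_inv, norm_PsiH, inv_one, mul_one]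
  exact ENNReal.ofReal_le_ofReal (hC _)

theorem periodIntegrand_add (ψ : AddChar F Circle) {z : Fin n → ℂ} (φ φ' : I F z) :
    periodIntegrand ψ (φ + φ') = periodIntegrand ψ φ + periodIntegrand ψ φ' := by
  ext q
  rw [← cosetMk_out q]
  exact add_mul _ _ _

theorem periodIntegrand_smul (ψ : AddChar F Circle) {z : Fin n → ℂ} (c : ℂ) (φ : I F z) :
    periodIntegrand ψ (c • φ) = c • periodIntegrand ψ φ := by
  ext q
  rw [← cosetMk_out q]
  exact mul_assoc _ _ _

theorem periodIntegrand_R (ψ : AddChar F Circle) {z : Fin n → ℂ} (h : H n F) (φ : I F z) :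
    periodIntegrand ψ (R (h : G n F) φ) =
      fun q => PsiH ψ h * periodIntegrand ψ φ (cosetMulRightEquiv (PH n F) h q) := by
  ext q
  rw [← cosetMk_out q]
  change φ.1 (_ * (h : G n F)) * (PsiH ψ _)⁻¹ =
    PsiH ψ h * (φ.1 (((q.out * h : H n F)) : G n F) * (PsiH ψ (q.out * h))⁻¹)
  have h0 : PsiH ψ h ≠ 0 := fun h0 => by simpa [h0] using norm_PsiH ψ h
  rw [PsiH_mul, _root_.mul_inv_rev, Subgroup.coe_mul, mul_left_comm, mul_inv_cancel_left₀ h0]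

/-- The period integral as a linear functional. -/
noncomputable def periodFunctional {ψ : AddChar F Circle} {z : Fin n → ℂ}
    (hint : ∀ φ : I F z, Integrable (periodIntegrand ψ φ) dq) : I F z →ₗ[ℂ] ℂ where
  toFun φ := ∫ q, periodIntegrand ψ φ q ∂dq
  map_add' φ φ' := by
    rw [periodIntegrand_add]
    exact integral_add (hint φ) (hint φ')
  map_smul' c φ := by
    rw [periodIntegrand_smul]
    exact integral_smul c _

theorem isShalikaFunctionalH_periodFunctional {ψ : AddChar F Circle} {z : Fin n → ℂ}
    (hdq : IsQuotientMeasure (PH n F) dh dt dq)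
    (hint : ∀ φ : I F z, Integrable (periodIntegrand ψ φ) dq) :
    IsShalikaFunctionalH ψ (periodFunctional hint) := by
  intro h φ
  change ∫ q, periodIntegrand ψ (R (h : G n F) φ) q ∂dq = PsiH ψ h * ∫ q, periodIntegrand ψ φ q ∂dq
  rw [periodIntegrand_R, integral_const_mul]
  congr 1
  exact (hdq.measurePreserving_cosetMulRight (isWeight_heightWeight dt) h).integral_comp'
    (periodIntegrand ψ φ)

end Bound

/-! ### From H to S by translation with ξ -/

section Conjugation

variable {n : ℕ} {F : Type*} [Field F] [ValuativeRel F] [TopologicalSpace F]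
  [IsNonarchimedeanLocalField F]

theorem R_mul {z : Fin n → ℂ} (g g' : G n F) (φ : I F z) : R (g * g') φ = R g (R g' φ) := by
  apply Subtype.ext
  ext x
  exact congrArg φ.1 (mul_assoc _ _ _).symm

theorem R_one {z : Fin n → ℂ} (φ : I F z) : R (1 : G n F) φ = φ := by
  apply Subtype.ext
  ext x
  exact congrArg φ.1 (mul_one _)

theorem IsShalikaFunctionalH.comp_R_xi {ψ : AddChar F Circle} {z : Fin n → ℂ}
    {Λ : I F z →ₗ[ℂ] ℂ} (hΛ : IsShalikaFunctionalH ψ Λ) :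
    IsShalikaFunctional ψ (Λ ∘ₗ R (xi n F)) := by
  intro s φ
  have h := hΛ ⟨_, conj_mem_H s⟩ (R (xi n F) φ)
  rw [LinearMap.comp_apply, LinearMap.comp_apply, ← R_mul]
  have h1 : xi n F * (s : G n F) = xi n F * (s : G n F) * (xi n F)⁻¹ * xi n F := by group
  have h2 : PsiH ψ ⟨_, conj_mem_H s⟩ = Psi ψ s := by
    rw [PsiH]
    congr 1
    apply Subtype.ext
    change (xi n F)⁻¹ * (xi n F * (s : G n F) * (xi n F)⁻¹) * xi n F = s
    group
  rw [h1, R_mul, h, h2]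

theorem comp_R_ne_zero {z : Fin n → ℂ} {Λ : I F z →ₗ[ℂ] ℂ} (hΛ : Λ ≠ 0) (g : G n F) :
    Λ ∘ₗ R g ≠ 0 := by
  intro h
  refine hΛ (LinearMap.ext fun φ => ?_)
  have := LinearMap.congr_fun h (R g⁻¹ φ)
  rwa [LinearMap.comp_apply, ← R_mul, mul_inv_cancel, R_one] at this

end Conjugation

/-! ### The principal congruence subgroup -/

section Congruence

variable {ι : Type*} [Fintype ι] [DecidableEq ι] {F : Type*} [Field F] [ValuativeRel F]
  [TopologicalSpace F] [IsNonarchimedeanLocalField F]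

/-- The matrices which are congruent to `1` modulo the maximal ideal. -/
def IsCong (A : Matrix ι ι F) : Prop := ∀ i j, absF ((A - 1) i j) < 1

theorem absF_add_lt {x y : F} (hx : absF x < 1) (hy : absF y < 1) : absF (x + y) < 1 :=
  (absF_add_le_max x y).trans_lt (max_lt hx hy)

theorem absF_sum_lt {α : Type*} {s : Finset α} {f : α → F} (h : ∀ i ∈ s, absF (f i) < 1) :
    absF (∑ i ∈ s, f i) < 1 :=
  absF_lt_one_iff.2 (absF_sum_le (inv_nonneg.2 (resCard_pos F).le) fun i hi =>
    absF_lt_one_iff.1 (h i hi))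

theorem absF_mul_apply_lt {κ ν : Type*} {A : Matrix κ ι F} {B : Matrix ι ν F}
    (hA : ∀ i j, absF (A i j) ≤ 1) (hB : ∀ i j, absF (B i j) < 1) (i : κ) (j : ν) :
    absF ((A * B) i j) < 1 := by
  rw [Matrix.mul_apply]
  refine absF_sum_lt fun k _ => ?_
  rw [absF_mul]
  exact (mul_le_of_le_one_left (absF_nonneg _) (hA i k)).trans_lt (hB k j)

theorem IsCong.absF_le_one {A : Matrix ι ι F} (hA : IsCong A) (i j : ι) : absF (A i j) ≤ 1 := by
  have h : A i j = (A - 1) i j + (1 : Matrix ι ι F) i j := by simp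
  rw [h]
  exact absF_add_le (hA i j).le (absF_one_apply_le i j)

theorem IsCong.absF_apply_lt {A : Matrix ι ι F} (hA : IsCong A) {i j : ι} (hij : i ≠ j) :
    absF (A i j) < 1 := by
  have := hA i j
  rwa [Matrix.sub_apply, Matrix.one_apply_ne hij, sub_zero] at this

theorem IsCong.absF_apply_self {A : Matrix ι ι F} (hA : IsCong A) (i : ι) :
    absF (A i i) = 1 := by
  have h := hA i i
  have h2 : A i i = 1 + (A - 1) i i := by simp
  rw [h2, absF_add_eq_of_lt (by rwa [absF_one]), absF_one]

theorem isCong_one : IsCong (1 : Matrix ι ι F) := fun i j => by simp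

theorem IsCong.mul {A B : Matrix ι ι F} (hA : IsCong A) (hB : IsCong B) : IsCong (A * B) := by
  intro i j
  have h : A * B - 1 = A * (B - 1) + (A - 1) := by noncomm_ring
  rw [h, Matrix.add_apply]
  exact absF_add_lt (absF_mul_apply_lt hA.absF_le_one hB i j) (hA i j)

theorem IsCong.submatrix {κ : Type*} [Fintype κ] [DecidableEq κ] {A : Matrix ι ι F}
    (hA : IsCong A) {f : κ → ι} (hf : Function.Injective f) : IsCong (A.submatrix f f) := by
  intro i j
  have h : (A.submatrix f f - 1) i j = (A - 1) (f i) (f j) := by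
    simp [Matrix.one_apply, hf.eq_iff]
  rw [h]
  exact hA _ _

/-- In the Leibniz expansion the identity permutation gives a unit, and every other term has an
off-diagonal factor of absolute value below 1. -/
theorem IsCong.absF_det {A : Matrix ι ι F} (hA : IsCong A) : absF A.det = 1 := by
  have h1 : A.det = ∏ i, A i i +
      ∑ σ ∈ Finset.univ.erase (1 : Equiv.Perm ι), Equiv.Perm.sign σ • ∏ i, A (σ i) i := by
    rw [det_apply, ← Finset.add_sum_erase _ _ (Finset.mem_univ (1 : Equiv.Perm ι))]
    simp
  have h2 : absF (∏ i, A i i) = 1 := by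
    rw [absF_prod]
    exact Finset.prod_eq_one fun i _ => hA.absF_apply_self i
  rw [h1, absF_add_eq_of_lt, h2]
  rw [h2]
  refine absF_sum_lt fun σ hσ => ?_
  obtain ⟨i, hi⟩ : ∃ i, σ i ≠ i := by
    by_contra! h
    exact (Finset.mem_erase.1 hσ).1 (Equiv.ext h)
  rw [absF_sign_smul, absF_prod, ← Finset.mul_prod_erase _ _ (Finset.mem_univ i)]
  exact (mul_le_of_le_one_right (absF_nonneg _)
    (Finset.prod_le_one (fun _ _ => absF_nonneg _) fun _ _ => hA.absF_le_one _ _)).trans_lt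
    (hA.absF_apply_lt hi)

theorem IsCong.mem_integralGL {k : GL ι F} (hk : IsCong k.val) : k ∈ integralGL ι F :=
  mem_integralGL_of_det hk.absF_le_one hk.absF_det

theorem IsCong.inv {k : GL ι F} (hk : IsCong k.val) : IsCong (k⁻¹).val := by
  intro i j
  have h : (k⁻¹).val - 1 = (k⁻¹).val * (1 - k.val) := by
    rw [mul_sub, mul_one, ← Units.val_mul, inv_mul_cancel, Units.val_one]
  rw [h]
  refine absF_mul_apply_lt hk.mem_integralGL.2 (fun i j => ?_) i j
  rw [← absF_neg, ← Matrix.neg_apply, neg_sub]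
  exact hk i j

variable (ι F) in
/-- The principal congruence subgroup of level one. -/
def congGL : Subgroup (GL ι F) where
  carrier := {k | IsCong k.val}
  mul_mem' ha hb := IsCong.mul ha hb
  one_mem' := isCong_one
  inv_mem' := IsCong.inv

theorem isOpen_congGL : IsOpen (congGL ι F : Set (GL ι F)) := by
  have h : (congGL ι F : Set (GL ι F)) = ⋂ i, ⋂ j, {k | absF ((k.val - 1) i j) < 1} := by
    ext k
    simp only [Set.mem_iInter]
    exact Iff.rfl
  rw [h]
  refine isOpen_iInter_of_finite fun i => isOpen_iInter_of_finite fun j => ?_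
  exact isOpen_lt (continuous_absF.comp
    ((Units.continuous_val.sub continuous_const).matrix_elem i j)) continuous_const

/-- If an upper and a lower triangular matrix differ by a matrix congruent to `1`, then their
diagonal entries have the same absolute values. -/
theorem absF_diag_eq_of_upper_lower {n : ℕ} {p l k : Matrix (Fin n) (Fin n) F}
    (hp : ∀ i j, j < i → p i j = 0) (hl : ∀ i j, i < j → l i j = 0) (hk : IsCong k)
    (h : l = p * k) (hp0 : ∀ i, p i i ≠ 0) (i : Fin n) : absF (l i i) = absF (p i i) := by
  -- Compare the minors on the indices ≥ i. The rows ≥ i of `p` vanish in columns < i, so the minor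
  -- of `p * k` is the product of the minors, and that of `k` is a unit.
  have hminor : ∀ i : Fin n, ∏ j ∈ Finset.Ici i, absF (l j j) =
      ∏ j ∈ Finset.Ici i, absF (p j j) := by
    intro i
    let f : {j : Fin n // j ∈ Finset.Ici i} → Fin n := Subtype.val
    have hsub : l.submatrix f f = p.submatrix f f * k.submatrix f f := by
      ext r s
      rw [Matrix.submatrix_apply, h, Matrix.mul_apply, Matrix.mul_apply]
      have h1 : ∑ j ∈ Finset.Ici i, p (f r) j * k j (f s) = ∑ j, p (f r) j * k j (f s) := by
        refine Finset.sum_subset (Finset.subset_univ _) fun j _ hj => ?_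
        rw [hp _ _ ((lt_of_not_ge fun h => hj (Finset.mem_Ici.2 h)).trans_le
          (Finset.mem_Ici.1 r.2)), zero_mul]
      rw [← h1, ← Finset.sum_coe_sort]
      rfl
    have hdet := congrArg (fun A => absF (Matrix.det A)) hsub
    have hlt : (l.submatrix f f).det = ∏ j, l (f j) (f j) :=
      det_of_isLowerTriangular _ fun r s hrs => hl _ _ hrs
    have hpt : (p.submatrix f f).det = ∏ j, p (f j) (f j) :=
      det_of_isUpperTriangular fun r s hrs => hp _ _ hrs
    rw [det_mul, absF_mul, (hk.submatrix Subtype.val_injective).absF_det, mul_one, hlt, hpt,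
      absF_prod, absF_prod] at hdet
    rw [← Finset.prod_coe_sort, ← Finset.prod_coe_sort (Finset.Ici i)]
    exact hdet
  -- Single entries are recovered from these products by descending induction.
  induction i using WellFoundedGT.induction with
  | _ i ih =>
    have h1 := hminor i
    rw [← Finset.insert_erase (Finset.mem_Ici.2 (le_refl i)),
      Finset.prod_insert (Finset.notMem_erase _ _), Finset.prod_insert (Finset.notMem_erase _ _),
      Finset.prod_congr rfl fun j hj => ih j (lt_of_le_of_ne
        (Finset.mem_Ici.1 (Finset.mem_erase.1 hj).2) (Finset.mem_erase.1 hj).1.symm)] at h1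
    exact mul_right_cancel₀ (Finset.prod_ne_zero_iff.2 fun j _ => (absF_pos (hp0 j)).ne') h1

end Congruence

/-! ### A test function with nonzero period -/

section TestFunction

variable {n : ℕ} {F : Type*} [Field F] [ValuativeRel F] [TopologicalSpace F]
  [IsNonarchimedeanLocalField F]

/-- The spherical element of `I(χ)`. -/
noncomputable def sphericalChi (z : Fin n → ℂ) (g : G n F) : ℂ :=
  ∏ i, (height finSumFinEquiv g i : ℂ) ^ charExp z i

theorem isLocallyConstant_sphericalChi (z : Fin n → ℂ) :
    IsLocallyConstant (sphericalChi z : G n F → ℂ) := by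
  rw [IsLocallyConstant.iff_eventually_eq]
  intro g
  have : ∀ᶠ x in nhds g, ∀ i, height (finSumFinEquiv (m := n) (n := n)) x i =
      height finSumFinEquiv g i := by
    rw [Filter.eventually_all]
    exact fun i => (IsLocallyConstant.iff_eventually_eq _).1 (isLocallyConstant_height i) g
  filter_upwards [this] with x hx
  simp only [sphericalChi, hx]

theorem sphericalChi_mul (z : Fin n → ℂ) {p : G n F} (hp : p ∈ P n F) (g : G n F) :
    sphericalChi z (p * g) = chi z p * (Real.sqrt (delta p) : ℂ) * sphericalChi z g := by
  rw [chi_mul_sqrt_delta z hp, sphericalChi, sphericalChi, ← Finset.prod_mul_distrib]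
  refine Finset.prod_congr rfl fun i _ => ?_
  rw [height_borel_mul ((mem_P_iff p).1 hp), Complex.ofReal_mul,
    Complex.mul_cpow_ofReal_nonneg (absF_nonneg _) (height_pos g i).le]

variable (n F) in
/-- The open set `P * congGL`. -/
def PCong : Set (G n F) := {g | ∃ p ∈ P n F, ∃ k ∈ congGL (Fin n ⊕ Fin n) F, g = p * k}

theorem mul_mem_PCong_left {p : G n F} (hp : p ∈ P n F) (g : G n F) :
    p * g ∈ PCong n F ↔ g ∈ PCong n F := by
  constructor
  · rintro ⟨q, hq, k, hk, h⟩
    exact ⟨p⁻¹ * q, mul_mem (inv_mem hp) hq, k, hk, by rw [mul_assoc, ← h, inv_mul_cancel_left]⟩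
  · rintro ⟨q, hq, k, hk, rfl⟩
    exact ⟨p * q, mul_mem hp hq, k, hk, by rw [mul_assoc]⟩

theorem mul_mem_PCong_right {k : G n F} (hk : k ∈ congGL (Fin n ⊕ Fin n) F) (g : G n F) :
    g * k ∈ PCong n F ↔ g ∈ PCong n F := by
  constructor
  · rintro ⟨q, hq, k', hk', h⟩
    exact ⟨q, hq, k' * k⁻¹, mul_mem hk' (inv_mem hk), by rw [← mul_assoc, ← h, mul_inv_cancel_right]⟩
  · rintro ⟨q, hq, k', hk', rfl⟩
    exact ⟨q, hq, k' * k, mul_mem hk' hk, by rw [mul_assoc]⟩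

theorem eventually_mem_PCong_iff (g : G n F) :
    ∀ᶠ x in nhds g, x ∈ PCong n F ↔ g ∈ PCong n F := by
  have h : (fun x => g⁻¹ * x) ⁻¹' (congGL (Fin n ⊕ Fin n) F : Set (G n F)) ∈ nhds g :=
    (isOpen_congGL.preimage (continuous_const_mul _)).mem_nhds (by simp)
  filter_upwards [h] with x hx
  rw [← mul_mem_PCong_right hx g, mul_inv_cancel_left]

theorem isOpen_PCong : IsOpen (PCong n F) :=
  isOpen_iff_eventually.2 fun g hg => (eventually_mem_PCong_iff g).mono fun _ hx => hx.2 hg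

open Classical in
/-- The element of `I(χ)` which is supported on `P * congGL` and is `1` at `1`. -/
noncomputable def testFunction (F : Type*) [Field F] [ValuativeRel F] [TopologicalSpace F]
    [IsNonarchimedeanLocalField F] (z : Fin n → ℂ) : I F z where
  val g := if g ∈ PCong n F then sphericalChi z g else 0
  property := by
    constructor
    · rw [IsLocallyConstant.iff_eventually_eq]
      intro g
      filter_upwards [eventually_mem_PCong_iff g,
        (IsLocallyConstant.iff_eventually_eq _).1 (isLocallyConstant_sphericalChi z) g]
        with x hx hx'
      simp only [hx, hx']
    · intro p hp g
      simp only [mul_mem_PCong_left hp]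
      split_ifs
      · exact sphericalChi_mul z hp g
      · rw [mul_zero]

/-- The elements of `H ∩ P * congGL`. -/
theorem exists_of_mem_PCong {h : H n F} (hh : (h : G n F) ∈ PCong n F) :
    (∃ (g : GL (Fin n) F) (X : Matrix (Fin n) (Fin n) F), h = mkH g X ∧
      ∀ i j, absF (X i j) ≤ 1) ∧
    ∃ p ∈ P n F, ∃ k ∈ congGL (Fin n ⊕ Fin n) F, (h : G n F) = p * k ∧
      ∀ i, absF (p.val (Sum.inr (Fin.rev i)) (Sum.inr (Fin.rev i))) =
        absF (p.val (Sum.inl i) (Sum.inl i)) := by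
  obtain ⟨p, hp, k, hk, hpk⟩ := hh
  obtain ⟨g, X, rfl⟩ := exists_mkH h
  have hp21 : toBlocks₂₁ p.val = 0 := by
    ext i j
    exact hp (Sum.Lex.inl_lt_inr _ _)
  set p1 := toBlocks₁₁ p.val with hp1
  set p12 := toBlocks₁₂ p.val with hp12
  set p2 := toBlocks₂₂ p.val with hp2
  set k11 := toBlocks₁₁ k.val with hk11
  set k12 := toBlocks₁₂ k.val with hk12
  set k21 := toBlocks₂₁ k.val with hk21
  set k22 := toBlocks₂₂ k.val with hk22
  have hblocks : (mkH g X : G n F).val = fromBlocks p1 p12 0 p2 * fromBlocks k11 k12 k21 k22 := by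
    rw [hpk, Units.val_mul, hk11, hk12, hk21, hk22, fromBlocks_toBlocks, ← hp21, hp1, hp12, hp2,
      fromBlocks_toBlocks]
  rw [mkH_val, fromBlocks_multiply, fromBlocks_inj] at hblocks
  simp only [zero_mul, zero_add] at hblocks
  obtain ⟨e11, e12, e21, e22⟩ := hblocks
  have hkc : IsCong k.val := hk
  have c11 : IsCong k11 := hkc.submatrix Sum.inl_injective
  have c22 : IsCong k22 := hkc.submatrix Sum.inr_injective
  have c12 : ∀ i j, absF (k12 i j) < 1 := fun i j => hkc.absF_apply_lt (by simp)
  have c21 : ∀ i j, absF (k21 i j) < 1 := fun i j => hkc.absF_apply_lt (by simp)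
  have hdet : k22.det ≠ 0 := fun h0 => by
    have := c22.absF_det
    rw [h0, absF_zero] at this
    exact zero_ne_one this
  let κ : GL (Fin n) F := Matrix.GeneralLinearGroup.mkOfDetNeZero k22 hdet
  have hκ : κ.val = k22 := rfl
  have cκ : IsCong (κ⁻¹).val := IsCong.inv (k := κ) c22
  have hκκ : k22 * (κ⁻¹).val = 1 := by rw [← hκ, ← Units.val_mul, mul_inv_cancel, Units.val_one]
  -- The upper right block of an element of `H` vanishes, which determines `p12`; g then becomes
  -- `p1` times a Schur complement of `k`, again congruent to 1.
  have hp12' : p12 = -(p1 * k12 * (κ⁻¹).val) := by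
    have : p12 = p12 * k22 * (κ⁻¹).val := by rw [mul_assoc, hκκ, mul_one]
    rw [this, ← neg_eq_of_add_eq_zero_right e12.symm, neg_mul]
  have hg1 : g.val = p1 * (k11 - k12 * (κ⁻¹).val * k21) := by
    rw [e11, hp12']; noncomm_ring
  have hg2 : g.val = (w₀ n F * p2 * w₀ n F) * (w₀ n F * k22 * w₀ n F) := by
    have : g.val = w₀ n F * (w₀ n F * g.val * w₀ n F) * w₀ n F := by
      rw [← mul_assoc, ← mul_assoc, w₀_mul_w₀, one_mul, mul_assoc, w₀_mul_w₀, mul_one]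
    rw [this, e22]
    simp only [mul_assoc]
    rw [← mul_assoc (w₀ n F) (w₀ n F), w₀_mul_w₀, one_mul]
  refine ⟨⟨g, X, rfl, ?_⟩, p, hp, k, hk, hpk, ?_⟩
  -- Dividing the lower left block w₀ g X = p2 k21 by the lower right block w₀ g w₀ = p2 k22
  -- eliminates `p2`.
  · have hX : X = w₀ n F * (κ⁻¹).val * k21 := by
      have h1 : g.val * X = g.val * (w₀ n F * (κ⁻¹).val * k21) := by
        have h2 : g.val * X = w₀ n F * (p2 * k21) := by
          rw [← e21, ← mul_assoc, w₀_mul_w₀, one_mul]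
        have h3 : g.val * w₀ n F = w₀ n F * (p2 * k22) := by
          rw [← e22, ← mul_assoc, ← mul_assoc, w₀_mul_w₀, one_mul]
        rw [h2, ← mul_assoc g.val, ← mul_assoc g.val, h3]
        simp only [mul_assoc]
        rw [← mul_assoc k22, hκκ, one_mul]
      have h4 := congrArg (fun A => (g⁻¹).val * A) h1
      rwa [← mul_assoc, ← mul_assoc (g⁻¹).val, ← Units.val_mul, inv_mul_cancel, Units.val_one,
        one_mul, one_mul] at h4
    intro i j
    rw [hX, mul_assoc, w₀_mul_apply]
    exact absF_mul_apply_le cκ.absF_le_one (fun i j => (c21 i j).le) _ _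
  · have cw : IsCong (w₀ n F * (κ⁻¹).val * w₀ n F) := by
      have : w₀ n F * (κ⁻¹).val * w₀ n F = (κ⁻¹).val.submatrix Fin.rev Fin.rev := by
        ext i j
        rw [mul_w₀_apply, w₀_mul_apply]; rfl
      rw [this]
      exact cκ.submatrix Fin.rev_injective
    have ck : IsCong (k11 - k12 * (κ⁻¹).val * k21) := by
      intro i j
      have h1 : k11 - k12 * (κ⁻¹).val * k21 - 1 = (k11 - 1) + -(k12 * (κ⁻¹).val * k21) := by
        noncomm_ring
      rw [h1, Matrix.add_apply]
      refine absF_add_lt (c11 i j) ?_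
      rw [Matrix.neg_apply, absF_neg]
      exact absF_mul_apply_lt (absF_mul_apply_le (fun i j => (c12 i j).le) cκ.absF_le_one) c21 i j
    -- Equating the two expressions for g makes the lower triangular w₀ p2 w₀ equal to the upper
    -- triangular `p1` up to a factor congruent to 1, as `absF_diag_eq_of_upper_lower` requires.
    have hl : w₀ n F * p2 * w₀ n F = p1 * ((k11 - k12 * (κ⁻¹).val * k21) *
        (w₀ n F * (κ⁻¹).val * w₀ n F)) := by
      rw [← mul_assoc p1, ← hg1, hg2]
      have h2 : (w₀ n F * k22 * w₀ n F) * (w₀ n F * (κ⁻¹).val * w₀ n F) = 1 := by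
        calc _ = w₀ n F * (k22 * ((w₀ n F * w₀ n F) * (κ⁻¹).val)) * w₀ n F := by
              simp only [mul_assoc]
          _ = 1 := by rw [w₀_mul_w₀, one_mul, hκκ, mul_one, w₀_mul_w₀]
      rw [mul_assoc (w₀ n F * p2 * w₀ n F), h2, mul_one]
    intro i
    have h3 := absF_diag_eq_of_upper_lower (p := p1) (l := w₀ n F * p2 * w₀ n F)
      (fun i j hij => hp (Sum.Lex.inl_lt_inl_iff.2 hij)) ?_ (ck.mul cw) hl
      (fun i => P_diag_ne_zero hp _) i
    · rw [mul_w₀_apply, w₀_mul_apply] at h3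
      exact h3
    · intro i j hij
      rw [mul_w₀_apply, w₀_mul_apply]
      exact hp (Sum.Lex.inr_lt_inr_iff.2 (Fin.rev_lt_rev.2 hij))

/-- The indices `inl i` and `inr (Fin.rev i)` have equal heights on this set and opposite exponents
in χδ^{1/2}, so their factors cancel. -/
theorem sphericalChi_of_mem_PCong (z : Fin n → ℂ) {h : H n F} (hh : (h : G n F) ∈ PCong n F) :
    sphericalChi z (h : G n F) = 1 := by
  obtain ⟨-, p, hp, k, hk, hpk, hd⟩ := exists_of_mem_PCong hh
  have hheight : ∀ i, height finSumFinEquiv (h : G n F) i = absF (p.val i i) := fun i => by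
    rw [hpk, height_mul ((mem_P_iff p).1 hp) (IsCong.mem_integralGL hk)]
  simp only [sphericalChi, hheight]
  rw [Fintype.prod_sum_type, ← Equiv.prod_comp Fin.revPerm
    (fun i => (absF (p.val (Sum.inr i) (Sum.inr i)) : ℂ) ^ charExp z (Sum.inr i)),
    ← Finset.prod_mul_distrib]
  refine Finset.prod_eq_one fun i _ => ?_
  rw [Fin.revPerm_apply, hd, ← Complex.cpow_add _ _
    (by exact_mod_cast (absF_pos (P_diag_ne_zero hp _)).ne')]
  have h0 : charExp z (Sum.inl i) + charExp z (Sum.inr (Fin.rev i)) = 0 := by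
    have hi : ((n + (Fin.rev i : ℕ) : ℕ) : ℂ) = 2 * n - 1 - (i : ℕ) := by
      have h1 : n + (Fin.rev i : ℕ) + (i : ℕ) + 1 = 2 * n := by
        have := i.2
        rw [Fin.val_rev]; omega
      have h2 : ((n + (Fin.rev i : ℕ) : ℕ) : ℂ) + (i : ℕ) + 1 = 2 * n := by exact_mod_cast h1
      linear_combination h2
    simp only [charExp, Sum.elim_inl, Sum.elim_inr, Fin.rev_rev, finSumFinEquiv_apply_left,
      finSumFinEquiv_apply_right, Fin.val_castAdd, Fin.val_natAdd]
    push_cast at hi ⊢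
    linear_combination -hi
  rw [h0, Complex.cpow_zero]

theorem PsiH_of_mem_PCong {ψ : AddChar F Circle} (hcond : HasConductorIntegers ψ) {h : H n F}
    (hh : (h : G n F) ∈ PCong n F) : PsiH ψ h = 1 := by
  obtain ⟨⟨g, X, rfl, hX⟩, -⟩ := exists_of_mem_PCong hh
  have h1 : trace X ∈ 𝒪[F] := absF_le_one_iff.1 (absF_sum_le zero_le_one fun i _ => hX i i)
  have h2 := (hcond (trace X)).1 h1 1 (one_mem _)
  rw [mul_one] at h2
  rw [PsiH_mkH, h2, Circle.coe_one]

variable [MeasurableSpace (GL (Fin n ⊕ Fin n) F)] [BorelSpace (GL (Fin n ⊕ Fin n) F)]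
  {dh : Measure (H n F)} [dh.IsHaarMeasure] {dt : Measure (PH n F)} [dt.IsHaarMeasure]
  {dq : Measure (Quo n F)}

open Classical in
theorem periodIntegrand_testFunction {ψ : AddChar F Circle} (hcond : HasConductorIntegers ψ)
    (z : Fin n → ℂ) (h : H n F) : periodIntegrand ψ (testFunction F z) (cosetMk (PH n F) h) =
      if (h : G n F) ∈ PCong n F then 1 else 0 := by
  change (if (h : G n F) ∈ PCong n F then sphericalChi z (h : G n F) else 0) * (PsiH ψ h)⁻¹ = _
  split_ifs with hh
  · rw [sphericalChi_of_mem_PCong z hh, PsiH_of_mem_PCong hcond hh, inv_one, mul_one]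
  · rw [zero_mul]

/-- The integrand takes only the values 0 and 1. The preimage in `H` of its support contains an open
neighbourhood of 1 inside `heightOne`, where the weight is a positive constant. -/
theorem integral_testFunction_ne_zero {ψ : AddChar F Circle} (hcond : HasConductorIntegers ψ)
    {z : Fin n → ℂ} (hdq : IsQuotientMeasure (PH n F) dh dt dq)
    (hint : Integrable (periodIntegrand ψ (testFunction F z)) dq) :
    ∫ q, periodIntegrand ψ (testFunction F z) q ∂dq ≠ 0 := by
  classical
  have hre : ∀ h : H n F, (periodIntegrand ψ (testFunction F z) (cosetMk (PH n F) h)).re =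
      if (h : G n F) ∈ PCong n F then 1 else 0 := by
    intro h
    rw [periodIntegrand_testFunction hcond]
    split_ifs <;> simp
  have h0 : 0 ≤ fun q => (periodIntegrand ψ (testFunction F z) q).re := by
    intro q
    rw [← cosetMk_out q]
    change 0 ≤ (periodIntegrand ψ (testFunction F z) (cosetMk (PH n F) q.out)).re
    rw [hre]
    split_ifs <;> simp
  have hpos : 0 < ∫ q, (periodIntegrand ψ (testFunction F z) q).re ∂dq := by
    refine (integral_pos_iff_support_of_nonneg h0 hint.re).2 ?_
    have hU : IsOpen {h : H n F | h ∈ heightOne n F ∧ (h : G n F) ∈ PCong n F} :=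
      isClopen_heightOne.2.inter (isOpen_PCong.preimage continuous_subtype_val)
    have h1 : (1 : H n F) ∈ {h : H n F | h ∈ heightOne n F ∧ (h : G n F) ∈ PCong n F} := by
      refine ⟨fun i => ?_, 1, one_mem _, 1, one_mem _, by simp⟩
      rw [map_one, height_integral (one_mem _)]
    have hUpos := hU.measure_pos dh ⟨1, h1⟩
    rw [hdq.eq_map (isWeight_heightWeight dt)]
    refine lt_of_lt_of_le ?_ (Measure.le_map_apply measurable_cosetMk.aemeasurable _)
    refine lt_of_lt_of_le ?_ (measure_mono (s := {h : H n F | h ∈ heightOne n F ∧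
      (h : G n F) ∈ PCong n F}) fun h hh => ?_)
    · rw [withDensity_apply _ hU.measurableSet]
      have h2 : ∫⁻ h in {h : H n F | h ∈ heightOne n F ∧ (h : G n F) ∈ PCong n F},
          heightWeight dt h ∂dh = ∫⁻ h in {h : H n F | h ∈ heightOne n F ∧
            (h : G n F) ∈ PCong n F}, (dt ((integralH n F).subgroupOf (PH n F)))⁻¹ ∂dh :=
        setLIntegral_congr_fun hU.measurableSet fun h hh => Set.indicator_of_mem hh.1 _
      rw [h2, setLIntegral_const]
      exact ENNReal.mul_pos (ENNReal.inv_ne_zero.2 (measure_integralPH_ne_top dt)) hUpos.ne'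
    · change (periodIntegrand ψ (testFunction F z) (cosetMk (PH n F) h)).re ≠ 0
      rw [hre, if_pos hh.2]
      exact one_ne_zero
  intro hzero
  have h3 := integral_re hint
  rw [hzero] at h3
  simp only [RCLike.re_to_complex, Complex.zero_re] at h3
  exact hpos.ne' h3

end TestFunction

end Shalika

open Shalika in
theorem mainTheorem4 {F : Type*} [Field F] [ValuativeRel F] [TopologicalSpace F]
    [IsNonarchimedeanLocalField F] (n : ℕ)
    [MeasurableSpace (GL (Fin n ⊕ Fin n) F)] [BorelSpace (GL (Fin n ⊕ Fin n) F)]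
    (ψ : AddChar F Circle) (hψ : Continuous ψ) (hcond : HasConductorIntegers ψ)
    (z : Fin n → ℂ) (hz : ∀ i j : Fin n, i < j → (z j).re < (z i).re)
    (hpos : ∀ i : Fin n, 0 < (z i).re)
    (dh : Measure (H n F)) [dh.IsHaarMeasure] (dt : Measure (PH n F)) [dt.IsHaarMeasure] :
    (∃ dq : Measure (Quo n F), IsQuotientMeasure (PH n F) dh dt dq) ∧
    ∀ dq : Measure (Quo n F), IsQuotientMeasure (PH n F) dh dt dq →
      (∀ φ : I F z, Integrable (periodIntegrand ψ φ) dq) ∧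
      ∃ Λ : I F z →ₗ[ℂ] ℂ,
        (∀ φ : I F z, Λ φ = ∫ q, periodIntegrand ψ φ q ∂dq) ∧
        IsShalikaFunctionalH ψ Λ ∧ Λ ≠ 0 ∧
        IsShalikaFunctional ψ (Λ ∘ₗ R (xi n F)) ∧ Λ ∘ₗ R (xi n F) ≠ 0 := by
  refine ⟨⟨_, isQuotientMeasure_map (isWeight_heightWeight dt)⟩, fun dq hdq => ?_⟩
  have hint : ∀ φ : I F z, Integrable (periodIntegrand ψ φ) dq :=
    integrable_periodIntegrand hψ hz hpos hdq
  have hH := isShalikaFunctionalH_periodFunctional hdq hint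
  have h0 : periodFunctional hint ≠ 0 := fun h =>
    integral_testFunction_ne_zero hcond hdq (hint _) (LinearMap.congr_fun h (testFunction F z))
  exact ⟨hint, periodFunctional hint, fun _ => rfl, hH, h0, hH.comp_R_xi, comp_R_ne_zero h0 _⟩
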